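/- **Theorem 5.** Let $k\ge 1$ be a fixed integer. There are a randomized algorithm $A_k$ and a constant $C$, both depending only on $k$, such that the following holds. The algorithm receives an undirected simple graph $G=(V,E)$ with $n\ge 2$ vertices (as an adjacency matrix), real edge weights $w:E\to\mathbb R$, and an integer $r\ge 1$ that sets the desired confidence. It always halts within $C\,r\,n^3/\log n$ steps. With probability at least $1-e^{-r}$ over its coin flips, it outputs a cycle of $G$ with exactly $k$ vertices whose total edge weight is maximum among all such cycles if $G$ has a cycle with $k$ vertices, and reports that there is none otherwise. In particular, for all fixed $k$ and $\varepsilon>0$, a maximum-weight cycle with $k$ vertices is found with probability at least $1-\varepsilon$ in $O(n^3/\log n)$ time. Here an algorithm is one fixed program for a random access machine whose integer words have $b$ bits, for any $b\ge c\log_2 n$ with $2^b>r$, where the constant $c$ depends only on $k$. Real numbers can only be copied, added and compared (the addition-comparison model). Each operation on words or reals, each memory access, each test and each fair coin flip takes one step. -/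

import Mathlib

/-!
# A randomized word RAM with real numbers in the addition-comparison model

Programs are finite texts of a structured language with integer variables, integer arrays and
real arrays.  Integers are machine words of `w` bits.  Real numbers can only be copied, added and
compared.  Every operation (including every operation inside an expression) costs one step.
-/

namespace WordRAM

/-- Integer expressions: constants, variables, array reads (indirect addressing) and the
arithmetic of words. -/
inductive IntExpr : Type
  | const (c : ℕ)
  | var (x : ℕ)
  | get (a : ℕ) (i : IntExpr)
  | add (e f : IntExpr)
  | sub (e f : IntExpr)
  | mul (e f : IntExpr)
  | div (e f : IntExpr)
  | mod (e f : IntExpr)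

/-- Real expressions: reads of real arrays, and addition. Nothing else is allowed. -/
inductive RealExpr : Type
  | get (a : ℕ) (i : IntExpr)
  | add (e f : RealExpr)

/-- Tests: comparison of words, comparison of reals, and Boolean combinations. -/
inductive Test : Type
  | lt (e f : IntExpr)
  | eq (e f : IntExpr)
  | realLe (e f : RealExpr)
  | not (b : Test)
  | and (b c : Test)
  | or (b c : Test)

/-- Programs. `flip x` stores the outcome of a fresh fair coin flip (`0` or `1`) in `x`. -/
inductive Program : Type
  | skip
  | assign (x : ℕ) (e : IntExpr)
  | store (a : ℕ) (i e : IntExpr)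
  | realStore (a : ℕ) (i : IntExpr) (e : RealExpr)
  | flip (x : ℕ)
  | seq (p q : Program)
  | ite (b : Test) (p q : Program)
  | while (b : Test) (p : Program)

/-- A memory configuration: the integer variables, the integer arrays, the real arrays
(the first argument is the name of the array, the second one the index), and the number of
coins flipped so far. -/
structure State : Type where
  var : ℕ → ℕ
  arr : ℕ → ℕ → ℕ
  real : ℕ → ℕ → ℝ
  coins : ℕ

/-- Value of an integer expression on a machine with `w`-bit words: results are reduced modulo
`2 ^ w`; subtraction is cut off at `0`, and division and remainder by `0` follow `ℕ`. -/
def IntExpr.eval (w : ℕ) (s : State) : IntExpr → ℕ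
  | const c => c % 2 ^ w
  | var x => s.var x
  | get a i => s.arr a (i.eval w s)
  | add e f => (e.eval w s + f.eval w s) % 2 ^ w
  | sub e f => (e.eval w s - f.eval w s) % 2 ^ w
  | mul e f => (e.eval w s * f.eval w s) % 2 ^ w
  | div e f => (e.eval w s / f.eval w s) % 2 ^ w
  | mod e f => (e.eval w s % f.eval w s) % 2 ^ w

/-- Number of steps for an integer expression: one per constant, variable and operation. -/
def IntExpr.cost : IntExpr → ℕ
  | const _ => 1
  | var _ => 1
  | get _ i => i.cost + 1
  | add e f => e.cost + f.cost + 1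
  | sub e f => e.cost + f.cost + 1
  | mul e f => e.cost + f.cost + 1
  | div e f => e.cost + f.cost + 1
  | mod e f => e.cost + f.cost + 1

/-- Value of a real expression. -/
noncomputable def RealExpr.eval (w : ℕ) (s : State) : RealExpr → ℝ
  | get a i => s.real a (i.eval w s)
  | add e f => e.eval w s + f.eval w s

/-- Number of steps for a real expression. -/
def RealExpr.cost : RealExpr → ℕ
  | get _ i => i.cost + 1
  | add e f => e.cost + f.cost + 1

/-- Truth of a test. -/
def Test.Holds (w : ℕ) (s : State) : Test → Prop
  | lt e f => e.eval w s < f.eval w s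
  | eq e f => e.eval w s = f.eval w s
  | realLe e f => e.eval w s ≤ f.eval w s
  | not b => ¬ b.Holds w s
  | and b c => b.Holds w s ∧ c.Holds w s
  | or b c => b.Holds w s ∨ c.Holds w s

/-- Number of steps for a test (both arguments of a connective are always evaluated). -/
def Test.cost : Test → ℕ
  | lt e f => e.cost + f.cost + 1
  | eq e f => e.cost + f.cost + 1
  | realLe e f => e.cost + f.cost + 1
  | not b => b.cost + 1
  | and b c => b.cost + c.cost + 1
  | or b c => b.cost + c.cost + 1

/-- Set the variable `x` to `v`. -/
def State.setVar (s : State) (x v : ℕ) : State :=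
  { s with var := Function.update s.var x v }

/-- Set the cell `i` of the integer array `a` to `v`. -/
def State.setArr (s : State) (a i v : ℕ) : State :=
  { s with arr := Function.update s.arr a (Function.update (s.arr a) i v) }

/-- Set the cell `i` of the real array `a` to `v`. -/
noncomputable def State.setReal (s : State) (a i : ℕ) (v : ℝ) : State :=
  { s with real := Function.update s.real a (Function.update (s.real a) i v) }

/-- `Exec w ω p s s' t`: on a machine with `w`-bit words, with coin flips `ω 0, ω 1, …`, the
program `p` started in `s` halts in `s'` after exactly `t` steps. -/
inductive Exec (w : ℕ) (ω : ℕ → Bool) : Program → State → State → ℕ → Prop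
  | skip (s : State) : Exec w ω .skip s s 1
  | assign (s : State) (x : ℕ) (e : IntExpr) :
      Exec w ω (.assign x e) s (s.setVar x (e.eval w s)) (e.cost + 1)
  | store (s : State) (a : ℕ) (i e : IntExpr) :
      Exec w ω (.store a i e) s (s.setArr a (i.eval w s) (e.eval w s)) (i.cost + e.cost + 1)
  | realStore (s : State) (a : ℕ) (i : IntExpr) (e : RealExpr) :
      Exec w ω (.realStore a i e) s (s.setReal a (i.eval w s) (e.eval w s))
        (i.cost + e.cost + 1)
  | flip (s : State) (x : ℕ) :
      Exec w ω (.flip x) s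
        { s.setVar x (if ω s.coins then 1 else 0) with coins := s.coins + 1 } 1
  | seq {p q : Program} {s s' s'' : State} {t t' : ℕ} :
      Exec w ω p s s' t → Exec w ω q s' s'' t' → Exec w ω (.seq p q) s s'' (t + t')
  | iteTrue {b : Test} {p q : Program} {s s' : State} {t : ℕ} :
      b.Holds w s → Exec w ω p s s' t → Exec w ω (.ite b p q) s s' (b.cost + 1 + t)
  | iteFalse {b : Test} {p q : Program} {s s' : State} {t : ℕ} :
      ¬ b.Holds w s → Exec w ω q s s' t → Exec w ω (.ite b p q) s s' (b.cost + 1 + t)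
  | whileFalse {b : Test} {p : Program} {s : State} :
      ¬ b.Holds w s → Exec w ω (.while b p) s s (b.cost + 1)
  | whileTrue {b : Test} {p : Program} {s s' s'' : State} {t t' : ℕ} :
      b.Holds w s → Exec w ω p s s' t → Exec w ω (.while b p) s' s'' t' →
      Exec w ω (.while b p) s s'' (b.cost + 1 + t + t')

/-- The law of an infinite sequence of independent fair coin flips. -/
noncomputable def coinMeasure : MeasureTheory.Measure (ℕ → Bool) :=
  MeasureTheory.Measure.infinitePi fun _ : ℕ => (PMF.uniformOfFintype Bool).toMeasure

end WordRAM

namespace MaxCycle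

open Classical in
/-- The weight of a pair of vertices: the given weight on edges, and `0` elsewhere. -/
noncomputable def edgeWeight {V : Type*} (G : SimpleGraph V) (wt : G.edgeSet → ℝ)
    (e : Sym2 V) : ℝ :=
  if h : e ∈ G.edgeSet then wt ⟨e, h⟩ else 0

/-- The weight of a walk: the sum of the weights of its edges. -/
noncomputable def walkWeight {V : Type*} (G : SimpleGraph V) (wt : G.edgeSet → ℝ) {u v : V}
    (p : G.Walk u v) : ℝ :=
  (p.edges.map (edgeWeight G wt)).sum

/-- `p` is a cycle on `k` vertices of maximum weight. -/
def IsMaxCycle {V : Type*} (k : ℕ) (G : SimpleGraph V) (wt : G.edgeSet → ℝ) {v : V}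
    (p : G.Walk v v) : Prop :=
  p.IsCycle ∧ p.length = k ∧
    ∀ (u : V) (q : G.Walk u u), q.IsCycle → q.length = k → walkWeight G wt q ≤ walkWeight G wt p

open Classical in
/-- The input: variable `0` holds `n` and variable `1` holds the confidence parameter `r`.
Cell `n * u + v` of integer array `0` tells whether `u` and `v` are adjacent, and the same cell of
real array `0` holds the weight of the edge. Everything else is `0`. -/
noncomputable def inputState (n r : ℕ) (G : SimpleGraph (Fin n)) (wt : G.edgeSet → ℝ) :
    WordRAM.State where
  var x := if x = 0 then n else if x = 1 then r else 0
  arr a i :=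
    if h : a = 0 ∧ i < n * n then
      let p : Fin n × Fin n := finProdFinEquiv.symm ⟨i, h.2⟩
      if G.Adj p.1 p.2 then 1 else 0
    else 0
  real a i :=
    if h : a = 0 ∧ i < n * n then
      let p : Fin n × Fin n := finProdFinEquiv.symm ⟨i, h.2⟩
      edgeWeight G wt s(p.1, p.2)
    else 0
  coins := 0

/-- The output is read off a final state as follows. If variable `2` is `1`, then the cells
`0, …, k - 1` of integer array `1` list the consecutive vertices of the cycle that was found; if
variable `2` is `0`, then the answer is that there is no cycle on `k` vertices. The output is
correct if the listed cycle exists and has maximum weight, respectively if there is no cycle on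
`k` vertices. -/
def CorrectOutput (k : ℕ) {n : ℕ} (G : SimpleGraph (Fin n)) (wt : G.edgeSet → ℝ)
    (s : WordRAM.State) : Prop :=
  (s.var 2 = 1 ∧ ∃ (v : Fin n) (p : G.Walk v v), IsMaxCycle k G wt p ∧
      ∀ i < k, s.arr 1 i = (p.getVert i : ℕ)) ∨
  (s.var 2 = 0 ∧ ∀ (v : Fin n) (p : G.Walk v v), p.IsCycle → p.length ≠ k)

end MaxCycle

/-! Write `K` for the number of vertices of the cycle. A simple graph has no cycle with `K ≤ 2`
vertices, and then the initial state is already a correct output. For `K = k + 3` the algorithm is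
color coding combined with a fast max-plus product.

In one trial every vertex is colored by the number of heads among `K` coins. A closed path through
the colors `0, …, K - 1` in this order has distinct vertices, so it is a cycle. Conversely, a fixed
maximum cycle is seen by a trial that gives its vertices the colors `0, …, K - 1`, and one pattern
of `K * K` coins forces this. With `T = 2 ^ (K * K)`, the probability that all of `r * T`
independent trials miss it is at most `(1 - 1 / T) ^ (r * T) ≤ exp (-r)`
(`coinMeasure_forall_ne_le`). A cycle that is reported always exists, and only its maximality
depends on the coins (`correctOutput_of_best`).

Paths have values in `ℤ ×ₗ ℝ`: the number of edges that lead from their color to the next one, then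
the weight. This is an ordered group, so best paths extend best paths, no value `-∞` is needed, and
a full first component certifies a genuine layered path. One more edge is one max-plus product
(`HoldsPaths.succ`).

The product of `n × n` matrices uses blocks of `d` midpoints, with `d` of order `log n`. Inside a
block, midpoint `l` wins for the pair `(i, j)` if `A i l' + B l' j` is smaller than `A i l + B l j`
for all other `l'`, ties going to the smaller midpoint. Fredman rewrites this as `A i l' - A i l < B
l j - B l' j`. For each `l'`, rows (red) and columns (blue) can therefore be sorted together, and
`l` beats `l'` exactly if the row precedes the column (`keySort_runs`).

Winning against all `l'` is a dominance condition in at most `d - 1` orders. It is represented by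
groups such that a row and a column have a common group, necessarily a unique one, iff the condition
holds (`IsFamily`). One more order splits each group into dyadic intervals of its members: a red
member enters the intervals that have it in the lower half, a blue member those that have it in the
upper half (`IsFamily.split`). Measured by `3 ^ Nat.clog 2` of the sizes, the total at most triples
(`sum_nodeWeight_le`), so the overhead of a block is about `d ^ 2 * 3 ^ d * n ^ (log₂ 3) * log n`.
With `d = Nat.log 65536 n + 1` this is `O(n ^ 2)` (`comparison_cost_le`). Each pair has at most one
winner in a block, so the winners of a block are listed in `O(n ^ 2)` steps (`sum_relatedCount_le`).
There are about `n / d` blocks, hence `O(n ^ 3 / log n)` for a product. -/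

namespace WordRAM

/-! ### A calculus of total correctness with time bounds. -/

/-- The variables a program may change. -/
def Program.modVars : Program → List ℕ
  | .assign x _ => [x]
  | .flip x => [x]
  | .seq p q => p.modVars ++ q.modVars
  | .ite _ p q => p.modVars ++ q.modVars
  | .while _ p => p.modVars
  | _ => []

/-- The integer arrays a program may change. -/
def Program.modArrs : Program → List ℕ
  | .store a _ _ => [a]
  | .seq p q => p.modArrs ++ q.modArrs
  | .ite _ p q => p.modArrs ++ q.modArrs
  | .while _ p => p.modArrs
  | _ => []

/-- The real arrays a program may change. -/
def Program.modReals : Program → List ℕ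
  | .realStore a _ _ => [a]
  | .seq p q => p.modReals ++ q.modReals
  | .ite _ p q => p.modReals ++ q.modReals
  | .while _ p => p.modReals
  | _ => []

/-- Whether a program flips coins. -/
def Program.flips : Program → Bool
  | .flip _ => true
  | .seq p q => p.flips || q.flips
  | .ite _ p q => p.flips || q.flips
  | .while _ p => p.flips
  | _ => false

/-- `s'` differs from `s` only where `p` is allowed to write. -/
structure Frame (p : Program) (s s' : State) : Prop where
  var : ∀ x, x ∉ p.modVars → s'.var x = s.var x
  arr : ∀ a, a ∉ p.modArrs → s'.arr a = s.arr a
  real : ∀ a, a ∉ p.modReals → s'.real a = s.real a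
  coins : p.flips = false → s'.coins = s.coins

theorem Frame.refl (p : Program) (s : State) : Frame p s s :=
  ⟨fun _ _ => rfl, fun _ _ => rfl, fun _ _ => rfl, fun _ => rfl⟩

theorem Frame.trans {p : Program} {s s' s'' : State} (h : Frame p s s') (h' : Frame p s' s'') :
    Frame p s s'' :=
  ⟨fun x hx => (h'.var x hx).trans (h.var x hx), fun x hx => (h'.arr x hx).trans (h.arr x hx),
    fun x hx => (h'.real x hx).trans (h.real x hx), fun hp => (h'.coins hp).trans (h.coins hp)⟩

/-- Only the names that a program may write matter, so a frame of one program serves for every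
program that writes at least as much. For concrete programs the inclusions are decided by
evaluation. -/
theorem Frame.mono {p q : Program} {s s' : State} (h : Frame p s s')
    (hv : p.modVars ⊆ q.modVars) (ha : p.modArrs ⊆ q.modArrs) (hr : p.modReals ⊆ q.modReals)
    (hc : q.flips = false → p.flips = false) : Frame q s s' :=
  ⟨fun x hx => h.var x fun h' => hx (hv h'), fun x hx => h.arr x fun h' => hx (ha h'),
    fun x hx => h.real x fun h' => hx (hr h'), fun hp => h.coins (hc hp)⟩

theorem Frame.seq_left {p q : Program} {s s' : State} (h : Frame p s s') :
    Frame (.seq p q) s s' :=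
  h.mono (List.subset_append_left _ _) (List.subset_append_left _ _)
    (List.subset_append_left _ _) (by simp +contextual [Program.flips])

theorem Frame.seq_right {p q : Program} {s s' : State} (h : Frame q s s') :
    Frame (.seq p q) s s' :=
  h.mono (List.subset_append_right _ _) (List.subset_append_right _ _)
    (List.subset_append_right _ _) (by simp +contextual [Program.flips])

theorem Frame.of_exec {w : ℕ} {ω : ℕ → Bool} {p : Program} {s s' : State} {t : ℕ}
    (h : Exec w ω p s s' t) : Frame p s s' := by
  induction h with
  | skip s => exact .refl _ _
  | assign s x e =>
    exact ⟨fun y hy => Function.update_of_ne (by simpa [Program.modVars] using hy) _ _,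
      fun _ _ => rfl, fun _ _ => rfl, fun _ => rfl⟩
  | store s a i e =>
    exact ⟨fun _ _ => rfl, fun y hy => Function.update_of_ne (by simpa [Program.modArrs] using hy) _ _,
      fun _ _ => rfl, fun _ => rfl⟩
  | realStore s a i e =>
    exact ⟨fun _ _ => rfl, fun _ _ => rfl,
      fun y hy => Function.update_of_ne (by simpa [Program.modReals] using hy) _ _, fun _ => rfl⟩
  | flip s x =>
    exact ⟨fun y hy => Function.update_of_ne (by simpa [Program.modVars] using hy) _ _,
      fun _ _ => rfl, fun _ _ => rfl, fun h => by simp [Program.flips] at h⟩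
  | seq _ _ h1 h2 => exact (Frame.seq_left h1).trans (Frame.seq_right h2)
  | iteTrue _ _ h1 =>
    exact h1.mono (List.subset_append_left _ _) (List.subset_append_left _ _)
      (List.subset_append_left _ _) (by simp +contextual [Program.flips])
  | iteFalse _ _ h1 =>
    exact h1.mono (List.subset_append_right _ _) (List.subset_append_right _ _)
      (List.subset_append_right _ _) (by simp +contextual [Program.flips])
  | whileFalse _ => exact .refl _ _
  | whileTrue _ _ _ h1 h2 => exact Frame.trans (h1.mono (fun _ h => h) (fun _ h => h)
      (fun _ h => h) (fun h => h)) h2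

/-- Total correctness with a time bound: `p` started in `s` halts within `T` steps in a state
with the property `Q`. -/
def Runs (w : ℕ) (ω : ℕ → Bool) (p : Program) (s : State) (T : ℕ) (Q : State → Prop) : Prop :=
  ∃ s' t, Exec w ω p s s' t ∧ t ≤ T ∧ Q s'

variable {w : ℕ} {ω : ℕ → Bool}

/-- The rule of consequence. The new postcondition may use the frame, so postconditions need not
mention memory that is left alone. -/
theorem Runs.mono {p : Program} {s : State} {T T' : ℕ} {Q Q' : State → Prop}
    (h : Runs w ω p s T Q) (hT : T ≤ T') (hQ : ∀ s', Frame p s s' → Q s' → Q' s') :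
    Runs w ω p s T' Q' := by
  obtain ⟨s', t, he, ht, hq⟩ := h
  exact ⟨s', t, he, ht.trans hT, hQ s' (.of_exec he) hq⟩

theorem Runs.seq {p q : Program} {s : State} {T T' : ℕ} {Q R : State → Prop}
    (h : Runs w ω p s T Q) (h' : ∀ s', Q s' → Frame p s s' → Runs w ω q s' T' R) :
    Runs w ω (.seq p q) s (T + T') R := by
  obtain ⟨s', t, he, ht, hq⟩ := h
  obtain ⟨s'', t', he', ht', hr⟩ := h' s' hq (.of_exec he)
  exact ⟨s'', t + t', .seq he he', by omega, hr⟩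

theorem Runs.ite {b : Test} {p q : Program} {s : State} {T : ℕ} {Q : State → Prop}
    (h : b.Holds w s → Runs w ω p s T Q) (h' : ¬ b.Holds w s → Runs w ω q s T Q) :
    Runs w ω (.ite b p q) s (b.cost + 1 + T) Q := by
  by_cases hb : b.Holds w s
  · obtain ⟨s', t, he, ht, hq⟩ := h hb
    exact ⟨s', _, .iteTrue hb he, by omega, hq⟩
  · obtain ⟨s', t, he, ht, hq⟩ := h' hb
    exact ⟨s', _, .iteFalse hb he, by omega, hq⟩

/-- `I i` describes the state after `i` iterations and `c i` bounds the time of the next one.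
Letting `c` depend on `i` makes amortized bounds possible: the total is a sum that can be estimated
as a whole. -/
theorem Runs.loop {b : Test} {p : Program} {s₀ : State} (m : ℕ) (I : ℕ → State → Prop)
    (c : ℕ → ℕ) (h0 : I 0 s₀)
    (step : ∀ i < m, ∀ s, I i s → Frame p s₀ s →
      b.Holds w s ∧ Runs w ω p s (c i) (I (i + 1)))
    (halt : ∀ s, I m s → Frame p s₀ s → ¬ b.Holds w s) :
    Runs w ω (.while b p) s₀ (∑ i ∈ Finset.range m, (c i + b.cost + 1) + (b.cost + 1))
      (I m) := by
  -- Induction on the number `j` of iterations that are still to come.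
  have key : ∀ j ≤ m, ∀ s, I (m - j) s → Frame p s₀ s →
      Runs w ω (.while b p) s (∑ i ∈ Finset.Ico (m - j) m, (c i + b.cost + 1) + (b.cost + 1))
        (I m) := by
    intro j
    induction j with
    | zero =>
      intro _ s hs hf
      exact ⟨s, _, .whileFalse (halt s hs hf), by simp, hs⟩
    | succ j ih =>
      intro hj s hs hf
      obtain ⟨hb, s', t, he, ht, hs'⟩ := step (m - (j + 1)) (by omega) s hs hf
      have e1 : m - (j + 1) + 1 = m - j := by omega
      rw [e1] at hs'
      obtain ⟨s'', t', he', ht', hq⟩ := ih (by omega) s' hs' (hf.trans (.of_exec he))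
      refine ⟨s'', _, .whileTrue hb he he', ?_, hq⟩
      rw [Finset.sum_eq_sum_Ico_succ_bot (by omega), e1]
      omega
  have h := key m le_rfl s₀ (by simpa using h0) (.refl _ _)
  rw [Nat.sub_self, ← Finset.range_eq_Ico] at h
  exact h

/-- A loop whose iterations all have the same time bound. -/
theorem Runs.loop_const {b : Test} {p : Program} {s₀ : State} (m : ℕ) (I : ℕ → State → Prop)
    (c : ℕ) (h0 : I 0 s₀)
    (step : ∀ i < m, ∀ s, I i s → Frame p s₀ s →
      b.Holds w s ∧ Runs w ω p s c (I (i + 1)))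
    (halt : ∀ s, I m s → Frame p s₀ s → ¬ b.Holds w s) :
    Runs w ω (.while b p) s₀ (m * (c + b.cost + 1) + (b.cost + 1)) (I m) := by
  have := Runs.loop (w := w) (ω := ω) m I (fun _ => c) h0 step halt
  simpa using this

/-- Programs without loops and coin flips. -/
def Program.loopFree : Program → Bool
  | .seq p q => p.loopFree && q.loopFree
  | .ite _ p q => p.loopFree && q.loopFree
  | .while _ _ => false
  | _ => true

/-- The largest number of steps a loop-free program can take. -/
def Program.maxCost : Program → ℕ
  | .skip => 1
  | .assign _ e => e.cost + 1
  | .store _ i e => i.cost + e.cost + 1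
  | .realStore _ i e => i.cost + e.cost + 1
  | .flip _ => 1
  | .seq p q => p.maxCost + q.maxCost
  | .ite b p q => b.cost + 1 + max p.maxCost q.maxCost
  | .while _ _ => 0

open Classical in
/-- The final state of a loop-free program. -/
noncomputable def Program.step (w : ℕ) (ω : ℕ → Bool) : Program → State → State
  | .skip, s => s
  | .assign x e, s => s.setVar x (e.eval w s)
  | .store a i e, s => s.setArr a (i.eval w s) (e.eval w s)
  | .realStore a i e, s => s.setReal a (i.eval w s) (e.eval w s)
  | .flip x, s => { s.setVar x (if ω s.coins then 1 else 0) with coins := s.coins + 1 }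
  | .seq p q, s => q.step w ω (p.step w ω s)
  | .ite b p q, s => if b.Holds w s then p.step w ω s else q.step w ω s
  | .while _ _, s => s

/-- Straight-line code is evaluated symbolically: `Program.step` is a function that `simp` can
unfold, and `maxCost` is computed by `decide`. Their values at `while` are defaults that never
enter. -/
theorem Exec.of_loopFree {p : Program} (hp : p.loopFree = true) (s : State) :
    ∃ t, Exec w ω p s (p.step w ω s) t ∧ t ≤ p.maxCost := by
  induction p generalizing s with
  | skip => exact ⟨_, .skip s, le_rfl⟩
  | assign x e => exact ⟨_, .assign s x e, le_rfl⟩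
  | store a i e => exact ⟨_, .store s a i e, le_rfl⟩
  | realStore a i e => exact ⟨_, .realStore s a i e, le_rfl⟩
  | flip x => exact ⟨_, .flip s x, le_rfl⟩
  | seq p q ihp ihq =>
    simp only [Program.loopFree, Bool.and_eq_true] at hp
    obtain ⟨t, h, ht⟩ := ihp hp.1 s
    obtain ⟨t', h', ht'⟩ := ihq hp.2 (p.step w ω s)
    exact ⟨_, .seq h h', Nat.add_le_add ht ht'⟩
  | ite b p q ihp ihq =>
    simp only [Program.loopFree, Bool.and_eq_true] at hp
    by_cases hb : b.Holds w s
    · obtain ⟨t, h, ht⟩ := ihp hp.1 s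
      refine ⟨_, by simpa [Program.step, hb] using Exec.iteTrue hb h, ?_⟩
      simp only [Program.maxCost]; omega
    · obtain ⟨t, h, ht⟩ := ihq hp.2 s
      refine ⟨_, by simpa [Program.step, hb] using Exec.iteFalse hb h, ?_⟩
      simp only [Program.maxCost]; omega
  | _ => simp [Program.loopFree] at hp

theorem Runs.of_loopFree {p : Program} {s : State} {Q : State → Prop}
    (hp : p.loopFree = true) (h : Q (p.step w ω s)) : Runs w ω p s p.maxCost Q := by
  obtain ⟨t, he, ht⟩ := Exec.of_loopFree (w := w) (ω := ω) hp s
  exact ⟨_, t, he, ht, h⟩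

section Eval
variable {s : State}

attribute [simp] IntExpr.eval RealExpr.eval Test.Holds Program.step

@[simp] theorem State.var_setVar {x v y : ℕ} :
    (s.setVar x v).var y = if y = x then v else s.var y := Function.update_apply ..

@[simp] theorem State.arr_setVar {x v : ℕ} : (s.setVar x v).arr = s.arr := rfl

@[simp] theorem State.real_setVar {x v : ℕ} : (s.setVar x v).real = s.real := rfl

@[simp] theorem State.coins_setVar {x v : ℕ} : (s.setVar x v).coins = s.coins := rfl

@[simp] theorem State.var_setArr {a i v : ℕ} : (s.setArr a i v).var = s.var := rfl

@[simp] theorem State.arr_setArr {a i v b : ℕ} :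
    (s.setArr a i v).arr b = if b = a then Function.update (s.arr a) i v else s.arr b :=
  Function.update_apply ..

@[simp] theorem State.real_setArr {a i v : ℕ} : (s.setArr a i v).real = s.real := rfl

@[simp] theorem State.coins_setArr {a i v : ℕ} : (s.setArr a i v).coins = s.coins := rfl

@[simp] theorem State.var_setReal {a i : ℕ} {v : ℝ} : (s.setReal a i v).var = s.var := rfl

@[simp] theorem State.arr_setReal {a i : ℕ} {v : ℝ} : (s.setReal a i v).arr = s.arr := rfl

@[simp] theorem State.real_setReal {a i b : ℕ} {v : ℝ} :
    (s.setReal a i v).real b = if b = a then Function.update (s.real a) i v else s.real b :=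
  Function.update_apply ..

@[simp] theorem State.coins_setReal {a i : ℕ} {v : ℝ} : (s.setReal a i v).coins = s.coins := rfl

end Eval

infixr:60 " ;; " => Program.seq

end WordRAM


/-! ### Names of the variables and arrays. -/

namespace WordRAM

notation "vNum" => (0 : ℕ)
notation "vConf" => (1 : ℕ)
notation "vOut" => (2 : ℕ)
notation "vBlock" => (3 : ℕ)
notation "vRound" => (4 : ℕ)
notation "vTrial" => (5 : ℕ)
notation "vStep" => (6 : ℕ)
notation "vRow" => (7 : ℕ)
notation "vCol" => (8 : ℕ)
notation "vFlag" => (9 : ℕ)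
notation "vLo" => (10 : ℕ)
notation "vHi" => (11 : ℕ)
notation "vMid" => (12 : ℕ)
notation "vAlt" => (13 : ℕ)
notation "vTop" => (14 : ℕ)
notation "vGrpLo" => (15 : ℕ)
notation "vGrpHi" => (16 : ℕ)
notation "vNew" => (17 : ℕ)
notation "vIdx" => (18 : ℕ)
notation "vElt" => (19 : ℕ)
notation "vPtr" => (20 : ℕ)
notation "vGrp" => (21 : ℕ)
notation "vPos" => (22 : ℕ)
notation "vPow" => (23 : ℕ)
notation "vRed" => (24 : ℕ)
notation "vQuo" => (25 : ℕ)
notation "vWidth" => (26 : ℕ)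
notation "vBase" => (27 : ℕ)
notation "vLeft" => (28 : ℕ)
notation "vSep" => (29 : ℕ)
notation "vRight" => (30 : ℕ)
notation "vEnd" => (31 : ℕ)
notation "vWrite" => (32 : ℕ)
notation "vBestFlag" => (33 : ℕ)
notation "vBestCode" => (34 : ℕ)
notation "vCoin" => (35 : ℕ)
notation "vElts" => (36 : ℕ)

notation "aAdj" => (0 : ℕ)
notation "aOut" => (1 : ℕ)
notation "aColor" => (2 : ℕ)
notation "aFlagA" => (3 : ℕ)
notation "aCodeA" => (4 : ℕ)
notation "aFlagB" => (5 : ℕ)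
notation "aFlagC" => (6 : ℕ)
notation "aCodeC" => (7 : ℕ)
notation "aKeyPos" => (8 : ℕ)
notation "aKeyNeg" => (9 : ℕ)
notation "aKeyTie" => (10 : ℕ)
notation "aOrd" => (11 : ℕ)
notation "aTmp" => (12 : ℕ)
notation "aStart" => (13 : ℕ)
notation "aStop" => (14 : ℕ)
notation "aPool" => (15 : ℕ)
notation "aSize" => (16 : ℕ)
notation "aCount" => (17 : ℕ)
notation "aOff" => (18 : ℕ)
notation "aSlot" => (19 : ℕ)

notation "rWt" => (0 : ℕ)
notation "rA" => (1 : ℕ)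
notation "rC" => (2 : ℕ)
notation "rKeyPos" => (3 : ℕ)
notation "rKeyNeg" => (4 : ℕ)
notation "rBest" => (5 : ℕ)

/-! ### Merge sort -/

/-- Comparison of the keys of two elements: lexicographic in the difference of the integer keys,
the difference of the real keys, and the tie-breaking key. -/
def keyLe (e f : IntExpr) : Test :=
  .or (.lt (.add (.get aKeyPos e) (.get aKeyNeg f)) (.add (.get aKeyPos f) (.get aKeyNeg e)))
    (.and (.eq (.add (.get aKeyPos e) (.get aKeyNeg f)) (.add (.get aKeyPos f) (.get aKeyNeg e)))
      (.and (.realLe (.add (.get rKeyPos e) (.get rKeyNeg f)) (.add (.get rKeyPos f) (.get rKeyNeg e)))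
        (.or (.not (.realLe (.add (.get rKeyPos f) (.get rKeyNeg e))
            (.add (.get rKeyPos e) (.get rKeyNeg f))))
          (.not (.lt (.get aKeyTie f) (.get aKeyTie e))))))

/-- Connectives evaluate both arguments, so keys are also compared when one run is used up. The
outcome is then irrelevant. -/
def mergeStepTest : Test :=
  .and (.lt (.var vLeft) (.var vSep))
    (.or (.not (.lt (.var vRight) (.var vEnd)))
      (keyLe (.get aOrd (.var vLeft)) (.get aOrd (.var vRight))))

def mergeStep : Program :=
  .ite mergeStepTest
    (.store aTmp (.var vWrite) (.get aOrd (.var vLeft)) ;;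
      .assign vLeft (.add (.var vLeft) (.const 1)) ;;
      .assign vWrite (.add (.var vWrite) (.const 1)))
    (.store aTmp (.var vWrite) (.get aOrd (.var vRight)) ;;
      .assign vRight (.add (.var vRight) (.const 1)) ;;
      .assign vWrite (.add (.var vWrite) (.const 1)))

/-- The two tests clip the runs at the end of the array, whose length need not be a power of two. -/
def mergeSetup : Program :=
  .assign vLeft (.var vBase) ;;
  .assign vWrite (.var vBase) ;;
  .assign vSep (.add (.var vBase) (.var vWidth)) ;;
  .assign vEnd (.add (.var vSep) (.var vWidth)) ;;
  .ite (.lt (.var vElts) (.var vSep)) (.assign vSep (.var vElts)) .skip ;;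
  .ite (.lt (.var vElts) (.var vEnd)) (.assign vEnd (.var vElts)) .skip ;;
  .assign vRight (.var vSep)

def mergeLoop : Program := .while (.lt (.var vWrite) (.var vEnd)) mergeStep

def mergeRun : Program := mergeSetup ;; mergeLoop ;; .assign vBase (.var vEnd)

def mergePass : Program :=
  .assign vBase (.const 0) ;; .while (.lt (.var vBase) (.var vElts)) mergeRun

def copyBack : Program :=
  .assign vWrite (.const 0) ;;
  .while (.lt (.var vWrite) (.var vElts))
    (.store aOrd (.var vWrite) (.get aTmp (.var vWrite)) ;;
      .assign vWrite (.add (.var vWrite) (.const 1)))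

def mergeSort : Program :=
  .assign vWidth (.const 1) ;;
  .while (.lt (.var vWidth) (.var vElts))
    (mergePass ;; copyBack ;; .assign vWidth (.mul (.var vWidth) (.const 2)))

/-- The cells `lo, …, hi - 1` of an array. -/
def slice (A : ℕ → ℕ) (lo hi : ℕ) : List ℕ := (List.range' lo (hi - lo)).map A

theorem slice_self (A : ℕ → ℕ) (lo : ℕ) : slice A lo lo = [] := by simp [slice]

theorem slice_cons (A : ℕ → ℕ) {lo hi : ℕ} (h : lo < hi) :
    slice A lo hi = A lo :: slice A (lo + 1) hi := by
  obtain ⟨d, rfl⟩ := Nat.exists_eq_add_of_lt h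
  simp [slice, show lo + d + 1 - lo = d + 1 by omega, show lo + d + 1 - (lo + 1) = d by omega,
    List.range'_succ]

theorem slice_append (A : ℕ → ℕ) {lo mid hi : ℕ} (h : lo ≤ mid) (h' : mid ≤ hi) :
    slice A lo mid ++ slice A mid hi = slice A lo hi := by
  obtain ⟨d, rfl⟩ := Nat.exists_eq_add_of_le h
  obtain ⟨e, rfl⟩ := Nat.exists_eq_add_of_le h'
  simp [slice, ← List.map_append, show lo + d + e - lo = d + e by omega]

theorem slice_concat (A : ℕ → ℕ) {lo hi : ℕ} (h : lo ≤ hi) :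
    slice A lo (hi + 1) = slice A lo hi ++ [A hi] := by
  rw [← slice_append A h (Nat.le_succ hi), slice_cons A (Nat.lt_succ_self hi), slice_self]

theorem slice_congr {A B : ℕ → ℕ} {lo hi : ℕ} (h : ∀ i, lo ≤ i → i < hi → A i = B i) :
    slice A lo hi = slice B lo hi := by
  refine List.map_congr_left fun i hi' => ?_
  rw [List.mem_range'_1] at hi'
  exact h i hi'.1 (by omega)

theorem mem_slice {A : ℕ → ℕ} {lo hi x : ℕ} :
    x ∈ slice A lo hi ↔ ∃ i, lo ≤ i ∧ i < hi ∧ A i = x := by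
  simp only [slice, List.mem_map, List.mem_range'_1]
  constructor
  · rintro ⟨i, h, rfl⟩; exact ⟨i, h.1, by omega, rfl⟩
  · rintro ⟨i, h, h', rfl⟩; exact ⟨i, ⟨h, by omega⟩, rfl⟩

variable {w : ℕ} {ω : ℕ → Bool}

theorem mergeStepTest_cost : mergeStepTest.cost ≤ 100 := by decide

/-- The invariant: the cells written so far, followed by the merge of what is left of both runs,
form the merge of the full runs. `hle` lets the test decide `le` in every state the sort can reach;
the sort never writes the keys, so this can be checked from the keys at the start. It is limited to
elements below `N`, whose keys are known not to overflow. -/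
theorem mergeLoop_runs {s : State} {le : ℕ → ℕ → Bool} {N lo m h : ℕ} (hw : 1 < 2 ^ w)
    (hN : N + 1 < 2 ^ w)
    (hle : ∀ s', Frame mergeSort s s' → ∀ e f : IntExpr, e.eval w s' < N → f.eval w s' < N →
      ((keyLe e f).Holds w s' ↔ le (e.eval w s') (f.eval w s') = true))
    (hA : ∀ q < N, s.arr aOrd q < N)
    (hl : s.var vLeft = lo) (hx : s.var vWrite = lo) (hm : s.var vSep = m)
    (hr : s.var vRight = m) (hh : s.var vEnd = h) (h1 : lo ≤ m) (h2 : m ≤ h) (h3 : h ≤ N) :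
    Runs w ω mergeLoop s ((h - lo) * 130 + 4) fun s' =>
      slice (s'.arr aTmp) lo h
        = (slice (s.arr aOrd) lo m).merge (slice (s.arr aOrd) m h) le ∧
      ∀ z < lo, s'.arr aTmp z = s.arr aTmp z := by
  refine (Runs.loop_const (h - lo) (fun y s' => ∃ i j, lo ≤ i ∧ i ≤ m ∧ m ≤ j ∧ j ≤ h ∧
      lo + y = i + (j - m) ∧ s'.var vLeft = i ∧ s'.var vRight = j ∧ s'.var vWrite = lo + y ∧
      slice (s'.arr aTmp) lo (lo + y)
        ++ (slice (s.arr aOrd) i m).merge (slice (s.arr aOrd) j h) le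
        = (slice (s.arr aOrd) lo m).merge (slice (s.arr aOrd) m h) le ∧
      ∀ z < lo, s'.arr aTmp z = s.arr aTmp z) 126 ?_ ?_ ?_).mono ?_ ?_
  · exact ⟨lo, m, le_rfl, h1, le_rfl, h2, by omega, hl, hr, hx, by simp [slice_self], by simp⟩
  · rintro y hy s' ⟨i, j, hi, hi', hj, hj', hij, vi, vj, vx, hB, hz⟩ hf
    have hA' : s'.arr aOrd = s.arr aOrd := hf.arr _ (by decide)
    have hm' : s'.var vSep = m := (hf.var _ (by decide)).trans hm
    have hh' : s'.var vEnd = h := (hf.var _ (by decide)).trans hh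
    have hle' := hle s' (hf.mono (by decide) (by decide) (by decide) (by decide))
    refine ⟨by simp only [Test.Holds, IntExpr.eval, hh', vx]; omega, ?_⟩
    refine (Runs.ite (T := 20) (Q := _) (fun hb => ?_) (fun hb => ?_)).mono
      (by have := mergeStepTest_cost; omega) (fun _ _ h => h)
    · refine (Runs.of_loopFree rfl ?_).mono (by decide) (fun _ _ h => h)
      simp only [mergeStepTest, Test.Holds, IntExpr.eval, hm', hh', vi, vj] at hb
      obtain ⟨him, hor⟩ := hb
      refine ⟨i + 1, j, by omega, by omega, hj, hj', by omega, ?_, ?_, ?_, ?_, ?_⟩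
      · simp (disch := omega) [vi, Nat.mod_eq_of_lt]
      · simp (disch := omega) [vj, Nat.mod_eq_of_lt]
      · simp (disch := omega) [vx, Nat.mod_eq_of_lt, add_assoc]
      · simp (disch := omega) only [Program.step, State.arr_setVar, State.arr_setArr, IntExpr.eval,
          vx, vi, hA', ite_true]
        rw [← add_assoc, slice_concat _ (by omega), Function.update_self,
          slice_congr (B := s'.arr aTmp) (fun z _ hz => Function.update_of_ne (by omega) _ _),
          ← hB, slice_cons _ him]
        by_cases hjh : j < h
        · have := (hle' (.get aOrd (.var vLeft)) (.get aOrd (.var vRight))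
            (by simpa [hA', vi] using hA i (by omega))
            (by simpa [hA', vj] using hA j (by omega))).1
            (hor.resolve_left (by simpa using hjh))
          simp only [IntExpr.eval, vi, vj, hA'] at this
          rw [slice_cons _ hjh, List.cons_merge_cons, if_pos this, List.append_assoc]
          rfl
        · have : j = h := by omega
          subst this
          simp [slice_self]
      · intro z hz'
        simp (disch := omega) [vx, vi, Function.update_of_ne, hz z hz']
    · refine (Runs.of_loopFree rfl ?_).mono (by decide) (fun _ _ h => h)
      simp only [mergeStepTest, Test.Holds, IntExpr.eval, hm', hh', vi, vj] at hb
      have hjh : j < h := by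
        by_contra hjh
        exact hb ⟨by omega, Or.inl hjh⟩
      refine ⟨i, j + 1, by omega, by omega, by omega, by omega, by omega, ?_, ?_, ?_, ?_, ?_⟩
      · simp (disch := omega) [vi, Nat.mod_eq_of_lt]
      · simp (disch := omega) [vj, Nat.mod_eq_of_lt]
      · simp (disch := omega) [vx, Nat.mod_eq_of_lt, add_assoc]
      · simp (disch := omega) only [Program.step, State.arr_setVar, State.arr_setArr, IntExpr.eval,
          vx, vj, hA', ite_true]
        rw [← add_assoc, slice_concat _ (by omega), Function.update_self,
          slice_congr (B := s'.arr aTmp) (fun z _ hz => Function.update_of_ne (by omega) _ _),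
          ← hB, slice_cons _ hjh]
        by_cases him : i < m
        · have hn : ¬ (keyLe (.get aOrd (.var vLeft)) (.get aOrd (.var vRight))).Holds w s' :=
            fun hc => hb ⟨him, Or.inr hc⟩
          rw [hle' (.get aOrd (.var vLeft)) (.get aOrd (.var vRight))
            (by simpa [hA', vi] using hA i (by omega))
            (by simpa [hA', vj] using hA j (by omega))] at hn
          simp only [IntExpr.eval, vi, vj, hA'] at hn
          rw [slice_cons _ him, List.cons_merge_cons, if_neg hn, List.append_assoc]
          rfl
        · have : i = m := by omega
          subst this
          simp [slice_self]
      · intro z hz'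
        simp (disch := omega) [vx, vj, Function.update_of_ne, hz z hz']
  · rintro s' ⟨i, j, hi, hi', hj, hj', hij, vi, vj, vx, hB, hz⟩ hf
    have hh' : s'.var vEnd = h := (hf.var _ (by decide)).trans hh
    simp only [Test.Holds, IntExpr.eval, hh', vx]; omega
  · exact Nat.add_le_add_right (Nat.mul_le_mul_left _ (by decide)) _
  · rintro s' hf ⟨i, j, hi, hi', hj, hj', hij, vi, vj, vx, hB, hz⟩
    refine ⟨?_, hz⟩
    have : i = m := by omega
    subst this
    have : j = h := by omega
    subst this
    rw [← hB]
    simp [slice_self, show lo + (j - lo) = j by omega]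

theorem mergeRun_runs {s : State} {le : ℕ → ℕ → Bool} {N wd lo : ℕ} (hw : 1 < 2 ^ w)
    (hN : 4 * N + 1 < 2 ^ w)
    (hle : ∀ s', Frame mergeSort s s' → ∀ e f : IntExpr, e.eval w s' < N → f.eval w s' < N →
      ((keyLe e f).Holds w s' ↔ le (e.eval w s') (f.eval w s') = true))
    (hA : ∀ q < N, s.arr aOrd q < N) (hlo : lo < N) (hwd : wd < N)
    (hb : s.var vBase = lo) (hv : s.var vWidth = wd) (hn : s.var vElts = N) :
    Runs w ω mergeRun s (wd * 260 + 60) fun s' =>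
      slice (s'.arr aTmp) lo (min (lo + 2 * wd) N)
        = (slice (s.arr aOrd) lo (min (lo + wd) N)).merge
            (slice (s.arr aOrd) (min (lo + wd) N) (min (lo + 2 * wd) N)) le ∧
      (∀ z < lo, s'.arr aTmp z = s.arr aTmp z) ∧ s'.var vBase = min (lo + 2 * wd) N := by
  refine (Runs.seq (T := 50) (Q := fun s' => s'.var vLeft = lo ∧ s'.var vWrite = lo ∧
    s'.var vSep = min (lo + wd) N ∧ s'.var vRight = min (lo + wd) N ∧
    s'.var vEnd = min (lo + 2 * wd) N) ?_ fun s' h hf => Runs.seq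
      (mergeLoop_runs (s := s') (le := le) hw (by omega) (fun s'' h' => hle s''
        (Frame.trans (hf.mono (by decide) (by decide) (by decide) (by decide)) h'))
        (by rw [hf.arr _ (by decide)]; exact hA) h.1 h.2.1 h.2.2.1 h.2.2.2.1 h.2.2.2.2
        (by omega) (by omega) (by omega))
      (T' := 6) fun s'' h'' hf'' => (Runs.of_loopFree rfl ?_).mono (by decide)
        fun _ _ h => h).mono ?_ fun _ _ h => h
  · refine (Runs.of_loopFree rfl ?_).mono (by decide) (fun _ _ h => h)
    by_cases c1 : N < lo + wd
    · by_cases c2 : N < lo + wd + wd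
      · simp (disch := omega) [mergeSetup, hb, hv, hn, Nat.mod_eq_of_lt, c1, c2]
      · omega
    · by_cases c2 : N < lo + wd + wd
      · simp (disch := omega) [mergeSetup, hb, hv, hn, Nat.mod_eq_of_lt, c1, c2]
      · simp (disch := omega) [mergeSetup, hb, hv, hn, Nat.mod_eq_of_lt, c1, c2]; try omega
  · rw [hf.arr aOrd (by decide), hf.arr aTmp (by decide)] at h''
    refine ⟨h''.1, h''.2, ?_⟩
    have := hf''.var vEnd (by decide)
    simp [this, h.2.2.2.2]
  · have : min (lo + 2 * wd) N - lo ≤ 2 * wd := by omega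
    have := Nat.mul_le_mul_right 130 this
    omega

/-- All aligned runs of length `wd` are sorted. -/
def SortedRuns (le : ℕ → ℕ → Bool) (A : ℕ → ℕ) (N wd : ℕ) : Prop :=
  ∀ y, (slice A (min (wd * y) N) (min (wd * y + wd) N)).Pairwise (fun a b => le a b = true)

theorem mergePass_runs {s : State} {le : ℕ → ℕ → Bool} {N wd : ℕ} (hw : 1 < 2 ^ w)
    (hN : 4 * N + 1 < 2 ^ w)
    (htr : ∀ a b c, le a b = true → le b c = true → le a c = true)
    (htot : ∀ a b, (le a b || le b a) = true)
    (hle : ∀ s', Frame mergeSort s s' → ∀ e f : IntExpr, e.eval w s' < N → f.eval w s' < N →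
      ((keyLe e f).Holds w s' ↔ le (e.eval w s') (f.eval w s') = true))
    (hA : ∀ q < N, s.arr aOrd q < N) (hwd : wd < N) (hwd0 : 0 < wd)
    (hv : s.var vWidth = wd) (hn : s.var vElts = N)
    (hs : SortedRuns le (s.arr aOrd) N wd) :
    Runs w ω mergePass s (N * 460 + 20) fun s' =>
      SortedRuns le (s'.arr aTmp) N (2 * wd) ∧
      (slice (s'.arr aTmp) 0 N).Perm (slice (s.arr aOrd) 0 N) := by
  -- The number of new runs is `N / (2 * wd)` rounded up: run `y` exists iff its first cell `2 * wd
  -- * y` does.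
  have hM : ∀ y, y < (N + 2 * wd - 1) / (2 * wd) ↔ 2 * wd * y < N := by
    intro y
    rw [Nat.lt_iff_add_one_le, Nat.le_div_iff_mul_le (by omega)]
    have : (y + 1) * (2 * wd) = 2 * wd * y + 2 * wd := by ring
    omega
  have hMN : (N + 2 * wd - 1) / (2 * wd) * (2 * wd) ≤ N + 2 * wd - 1 := Nat.div_mul_le_self _ _
  set M := (N + 2 * wd - 1) / (2 * wd) with hMdef
  refine (Runs.seq (T := 2) (Q := fun s' => s'.var vBase = 0)
    ((Runs.of_loopFree rfl (by simp)).mono (by decide) fun _ _ h => h)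
    fun s1 hs1 hf1 => Runs.loop_const M (fun y s' => s'.var vBase = min (2 * wd * y) N ∧
      (slice (s'.arr aTmp) 0 (min (2 * wd * y) N)).Perm
        (slice (s.arr aOrd) 0 (min (2 * wd * y) N)) ∧
      ∀ x < y, (slice (s'.arr aTmp) (min (2 * wd * x) N)
        (min (2 * wd * x + 2 * wd) N)).Pairwise (fun a b => le a b = true)) (wd * 260 + 60)
      ?_ ?_ ?_).mono ?_ ?_
  · simp [hs1, slice_self]
  · rintro y hy s' ⟨hb, hp, hso⟩ hf
    rw [hM] at hy
    have hA' : s'.arr aOrd = s.arr aOrd := (hf.arr _ (by decide)).trans (hf1.arr _ (by decide))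
    have hn' : s'.var vElts = N :=
      ((hf.var _ (by decide)).trans (hf1.var _ (by decide))).trans hn
    have hv' : s'.var vWidth = wd :=
      ((hf.var _ (by decide)).trans (hf1.var _ (by decide))).trans hv
    have hmin : min (2 * wd * y) N = 2 * wd * y := by omega
    rw [hmin] at hb hp
    refine ⟨by simp only [Test.Holds, IntExpr.eval, hb, hn']; omega, ?_⟩
    refine (mergeRun_runs (le := le) (lo := 2 * wd * y) hw hN (fun s'' h'' => hle s''
        (Frame.trans (Frame.trans (hf1.mono (by decide) (by decide) (by decide) (by decide))
          (hf.mono (by decide) (by decide) (by decide) (by decide))) h''))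
        (by rw [hA']; exact hA) hy hwd hb hv' hn').mono le_rfl ?_
    rintro s'' - ⟨hm, hz, hb''⟩
    rw [hA'] at hm
    have e1 : 2 * wd * (y + 1) = 2 * wd * y + 2 * wd := by ring
    rw [e1]
    refine ⟨hb'', ?_, ?_⟩
    · rw [← slice_append (s''.arr aTmp) (Nat.zero_le (2 * wd * y)) (by omega),
        ← slice_append (s.arr aOrd) (Nat.zero_le (2 * wd * y)) (by omega), hm,
        slice_congr (fun i _ hi => hz i hi)]
      refine hp.append ((List.merge_perm_append le).trans ?_)
      rw [slice_append _ (by omega) (by omega)]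
    · intro x hx
      rcases Nat.lt_succ_iff_lt_or_eq.1 hx with hx | rfl
      · have : 2 * wd * x + 2 * wd ≤ 2 * wd * y := by
          have := Nat.mul_le_mul_left (2 * wd) (Nat.succ_le_of_lt hx)
          rw [Nat.mul_succ] at this; exact this
        rw [slice_congr (B := s'.arr aTmp) (fun i _ hi => hz i (by omega))]
        exact hso x hx
      · rw [hmin, hm]
        -- The halves of the new run `x` are the old runs `2 * x` and `2 * x + 1`.
        have h1 := hs (2 * x)
        have h2 := hs (2 * x + 1)
        rw [show wd * (2 * x) = 2 * wd * x by ring] at h1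
        rw [show wd * (2 * x + 1) = 2 * wd * x + wd by ring,
          show 2 * wd * x + wd + wd = 2 * wd * x + 2 * wd by ring] at h2
        rw [hmin] at h1
        exact List.pairwise_merge htr htot _ _ h1 h2
  · rintro s' ⟨hb, -, -⟩ hf
    have hn' : s'.var vElts = N :=
      ((hf.var _ (by decide)).trans (hf1.var _ (by decide))).trans hn
    have := (hM M).not.1 (lt_irrefl _)
    simp only [Test.Holds, IntExpr.eval, hb, hn']; omega
  -- Since `wd < N`, rounding up costs at most two further copies of `N`.
  · have h1 : M * (2 * wd) ≤ 3 * N := by omega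
    have h2 : M * 1 ≤ M * (2 * wd) := Nat.mul_le_mul_left _ (by omega)
    have h3 : M * (wd * 260 + 60 + (Test.lt (.var vBase) (.var vElts)).cost + 1)
      = M * (2 * wd) * 130 + M * 1 * 64 := by
      simp only [Test.cost, IntExpr.cost]; ring
    rw [h3]
    simp only [Test.cost, IntExpr.cost]
    have : M ≤ N := by
      by_contra hMN'
      have h4 := Nat.mul_le_mul_right (2 * wd) (show N + 1 ≤ M by omega)
      have h5 : N * 1 ≤ N * (2 * wd) := Nat.mul_le_mul_left _ (by omega)
      rw [Nat.add_mul] at h4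
      omega
    omega
  · rintro s' hf ⟨hb, hp, hso⟩
    have := (hM M).not.1 (lt_irrefl _)
    rw [show min (2 * wd * M) N = N by omega] at hp
    refine ⟨fun y => ?_, hp⟩
    by_cases hy : y < M
    · exact hso y hy
    · have := (hM y).not.1 hy
      rw [show min (2 * wd * y) N = N by omega, show min (2 * wd * y + 2 * wd) N = N by omega,
        slice_self]
      exact List.Pairwise.nil

theorem copyBack_runs {s : State} {N : ℕ} (hw : 1 < 2 ^ w) (hN : N + 1 < 2 ^ w)
    (hn : s.var vElts = N) :
    Runs w ω copyBack s (N * 20 + 20) fun s' => ∀ q < N, s'.arr aOrd q = s.arr aTmp q := by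
  refine (Runs.seq (T := 2) (Q := fun s' => s'.var vWrite = 0)
    ((Runs.of_loopFree rfl (by simp)).mono (by decide) fun _ _ h => h)
    fun s1 hs1 hf1 => Runs.loop_const N (fun y s' => s'.var vWrite = y ∧
      ∀ q < y, s'.arr aOrd q = s.arr aTmp q) 10
      ⟨hs1, by simp⟩ ?_ ?_).mono ?_ fun _ _ h => h.2
  · rintro y hy s' ⟨hx, hc⟩ hf
    have hn' : s'.var vElts = N :=
      ((hf.var _ (by decide)).trans (hf1.var _ (by decide))).trans hn
    have hA' : s'.arr aTmp = s.arr aTmp := (hf.arr _ (by decide)).trans (hf1.arr _ (by decide))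
    refine ⟨by simp only [Test.Holds, IntExpr.eval, hx, hn']; omega, ?_⟩
    refine (Runs.of_loopFree rfl ?_).mono (by decide) (fun _ _ h => h)
    refine ⟨by simp (disch := omega) [hx, Nat.mod_eq_of_lt], fun q hq => ?_⟩
    simp only [Program.step, State.arr_setVar, State.arr_setArr, IntExpr.eval, hx, hA', ite_true]
    rcases Nat.lt_succ_iff_lt_or_eq.1 hq with hq | rfl
    · rw [Function.update_of_ne (by omega), hc q hq]
    · rw [Function.update_self]
  · rintro s' ⟨hx, -⟩ hf
    have hn' : s'.var vElts = N :=
      ((hf.var _ (by decide)).trans (hf1.var _ (by decide))).trans hn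
    simp only [Test.Holds, IntExpr.eval, hx, hn']; omega
  · simp only [Test.cost, IntExpr.cost]; omega

/-- Merge sort of `aOrd`, which initially lists the elements `0, …, N - 1`. -/
theorem mergeSort_runs {s : State} {le : ℕ → ℕ → Bool} {N : ℕ} (hw : 2 < 2 ^ w)
    (hN : 4 * N + 1 < 2 ^ w)
    (htr : ∀ a b c, le a b = true → le b c = true → le a c = true)
    (htot : ∀ a b, (le a b || le b a) = true)
    (hle : ∀ s', Frame mergeSort s s' → ∀ e f : IntExpr, e.eval w s' < N → f.eval w s' < N →
      ((keyLe e f).Holds w s' ↔ le (e.eval w s') (f.eval w s') = true))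
    (hA : ∀ q < N, s.arr aOrd q = q) (hn : s.var vElts = N) :
    Runs w ω mergeSort s (Nat.clog 2 N * (N * 480 + 60) + 20) fun s' =>
      (slice (s'.arr aOrd) 0 N).Perm (List.range N) ∧
      (slice (s'.arr aOrd) 0 N).Pairwise (fun a b => le a b = true) := by
  -- After `i` passes the sorted runs have length `2 ^ i`, so the loop makes exactly `Nat.clog 2 N`
  -- passes.
  have hpow : ∀ i, i < Nat.clog 2 N ↔ 2 ^ i < N := fun i =>
    Nat.lt_clog_iff_pow_lt (by norm_num)
  have h0 : slice (s.arr aOrd) 0 N = List.range N := by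
    rw [slice_congr (B := id) (fun i _ hi => hA i hi)]
    simp [slice, List.range_eq_range']
  refine (Runs.seq (T := 2) (Q := fun s' => s'.var vWidth = 1)
    ((Runs.of_loopFree rfl (by simp (disch := omega) [Nat.mod_eq_of_lt])).mono (by decide)
      fun _ _ h => h)
    fun s1 hs1 hf1 => Runs.loop_const (Nat.clog 2 N) (fun y s' => s'.var vWidth = 2 ^ y ∧
      (slice (s'.arr aOrd) 0 N).Perm (List.range N) ∧ SortedRuns le (s'.arr aOrd) N (2 ^ y))
      (N * 460 + 20 + (N * 20 + 20 + 10))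
      ⟨hs1, ?_, ?_⟩ ?_ ?_).mono ?_ ?_
  · rw [hf1.arr _ (by decide), h0]
  · intro y
    by_cases hy : y < N
    · rw [show min (2 ^ 0 * y) N = y by omega, show min (2 ^ 0 * y + 2 ^ 0) N = y + 1 by omega,
        slice_cons _ (by omega), slice_self]
      simp
    · rw [show min (2 ^ 0 * y) N = N by omega, show min (2 ^ 0 * y + 2 ^ 0) N = N by omega,
        slice_self]
      exact List.Pairwise.nil
  · rintro y hy s' ⟨hx, hp, hso⟩ hf
    rw [hpow] at hy
    have hn' : s'.var vElts = N :=
      ((hf.var _ (by decide)).trans (hf1.var _ (by decide))).trans hn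
    refine ⟨by simp only [Test.Holds, IntExpr.eval, hx, hn']; omega, ?_⟩
    have hF : Frame mergeSort s s' := Frame.trans
      (hf1.mono (by decide) (by decide) (by decide) (by decide))
      (hf.mono (by decide) (by decide) (by decide) (by decide))
    refine Runs.seq (mergePass_runs (le := le) (by omega) hN htr htot
      (fun s'' h'' => hle s'' (hF.trans h'')) (fun q hq => ?_) hy (by positivity) hx hn' hso)
      fun s2 h2 hf2 => Runs.seq (copyBack_runs (N := N) (by omega) (by omega)
        ((hf2.var _ (by decide)).trans hn')) fun s3 h3 hf3 =>
        (Runs.of_loopFree rfl ?_).mono (by decide) fun _ _ h => h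
    · exact List.mem_range.1 (hp.subset (mem_slice.2 ⟨q, by omega, hq, rfl⟩))
    · have hx3 : s3.var vWidth = 2 ^ y :=
        ((hf3.var _ (by decide)).trans (hf2.var _ (by decide))).trans hx
      have hc : ∀ lo hi, hi ≤ N → slice (s3.arr aOrd) lo hi = slice (s2.arr aTmp) lo hi :=
        fun lo hi hh => slice_congr fun i _ hi => h3 i (by omega)
      simp only [Program.step, State.arr_setVar, State.var_setVar, IntExpr.eval, hx3, ite_true]
      refine ⟨?_, ?_, fun z => ?_⟩
      · rw [Nat.mod_eq_of_lt hw, Nat.mod_eq_of_lt (by omega), pow_succ]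
      · rw [hc _ _ le_rfl]
        exact h2.2.trans hp
      · rw [hc _ _ (by omega), pow_succ']
        exact h2.1 z
  · rintro s' ⟨hx, -⟩ hf
    have hn' : s'.var vElts = N :=
      ((hf.var _ (by decide)).trans (hf1.var _ (by decide))).trans hn
    have := (hpow (Nat.clog 2 N)).not.1 (lt_irrefl _)
    simp only [Test.Holds, IntExpr.eval, hx, hn']; omega
  · simp only [Test.cost, IntExpr.cost]
    have : Nat.clog 2 N * (N * 460 + 20 + (N * 20 + 20 + 10) + (1 + 1 + 1) + 1)
      ≤ Nat.clog 2 N * (N * 480 + 60) := Nat.mul_le_mul_left _ (by omega)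
    omega
  · rintro s' - ⟨-, hp, hso⟩
    have := (hpow (Nat.clog 2 N)).not.1 (lt_irrefl _)
    refine ⟨hp, ?_⟩
    have h := hso 0
    rwa [show min (2 ^ Nat.clog 2 N * 0) N = 0 by omega,
      show min (2 ^ Nat.clog 2 N * 0 + 2 ^ Nat.clog 2 N) N = N by omega] at h

end WordRAM


/-! ### Splitting groups along a linear order -/

namespace Dominance

/-- The dyadic nodes of a position `p` in a list of length `m`, shifted by `o`. For `z = 1` these are
the nodes that have `p` in their lower half, for `z = 0` those that have `p` in their upper half. A node
is named by its midpoint. -/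
def nodes (m z o p : ℕ) : List ℕ :=
  (List.range (Nat.clog 2 m)).filterMap fun i =>
    if (p / 2 ^ i + z) % 2 = 1 ∧ (p / 2 ^ i + z) * 2 ^ i < m then some (o + (p / 2 ^ i + z) * 2 ^ i)
    else none

/-- The bound on the levels in the definition loses nothing: a midpoint below `m` has a level below
`Nat.clog 2 m`. -/
theorem mem_nodes {m z o p x : ℕ} :
    x ∈ nodes m z o p ↔ ∃ i b, p / 2 ^ i + z = 2 * b + 1 ∧ (2 * b + 1) * 2 ^ i < m ∧
      x = o + (2 * b + 1) * 2 ^ i := by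
  simp only [nodes, List.mem_filterMap, List.mem_range, Option.ite_none_right_eq_some,
    Option.some.injEq]
  constructor
  · rintro ⟨i, -, ⟨h1, h2⟩, rfl⟩
    refine ⟨i, (p / 2 ^ i + z) / 2, by omega, ?_, ?_⟩ <;>
      rw [show 2 * ((p / 2 ^ i + z) / 2) + 1 = p / 2 ^ i + z by omega]
    exact h2
  · rintro ⟨i, b, h1, h2, rfl⟩
    refine ⟨i, ?_, ⟨by omega, by rwa [h1]⟩, by rw [h1]⟩
    rw [Nat.lt_clog_iff_pow_lt (by norm_num)]
    calc 2 ^ i ≤ (2 * b + 1) * 2 ^ i := Nat.le_mul_of_pos_left _ (by omega)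
      _ < m := h2

/-- Odd part and power of two are unique, so a midpoint determines the level and the interval of its
node. -/
theorem odd_mul_two_pow_inj {a b i j : ℕ} (h : (2 * a + 1) * 2 ^ i = (2 * b + 1) * 2 ^ j) :
    i = j ∧ a = b := by
  wlog hij : i ≤ j generalizing a b i j
  · have := this h.symm (by omega)
    exact ⟨this.1.symm, this.2.symm⟩
  obtain ⟨d, rfl⟩ := Nat.exists_eq_add_of_le hij
  rw [pow_add, ← mul_assoc, mul_right_comm] at h
  have h := Nat.eq_of_mul_eq_mul_right (by positivity) h
  rcases d with _ | d
  · simp at h; omega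
  · rw [pow_succ', ← mul_assoc, mul_comm _ 2, mul_assoc] at h
    omega

theorem nodes_nodup (m z o p : ℕ) : (nodes m z o p).Nodup := by
  unfold nodes
  refine List.Nodup.filterMap ?_ List.nodup_range
  intro i j x hi hj
  simp only [Option.mem_def, Option.ite_none_right_eq_some, Option.some.injEq] at hi hj
  obtain ⟨⟨h1, -⟩, h⟩ := hi
  obtain ⟨⟨h2, -⟩, h'⟩ := hj
  have e : (2 * ((p / 2 ^ i + z) / 2) + 1) * 2 ^ i = (2 * ((p / 2 ^ j + z) / 2) + 1) * 2 ^ j := by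
    rw [show 2 * ((p / 2 ^ i + z) / 2) + 1 = p / 2 ^ i + z by omega,
      show 2 * ((p / 2 ^ j + z) / 2) + 1 = p / 2 ^ j + z by omega]
    omega
  exact (odd_mul_two_pow_inj e).1

/-- Halve both positions until they agree. Just before, they are the two children `2 * b` and `2 * b
+ 1` of the same dyadic interval. -/
theorem exists_level {p p' : ℕ} (h : p < p') :
    ∃ i b, p / 2 ^ i + 1 = 2 * b + 1 ∧ p' / 2 ^ i = 2 * b + 1 := by
  induction p' using Nat.strong_induction_on generalizing p with
  | _ p' ih =>
    by_cases h2 : p / 2 < p' / 2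
    · obtain ⟨i, b, h3, h4⟩ := ih (p' / 2) (by omega) h2
      refine ⟨i + 1, b, ?_, ?_⟩ <;>
        rw [pow_succ', ← Nat.div_div_eq_div_mul] <;> assumption
    · exact ⟨0, p / 2, by simp; omega, by simp; omega⟩

theorem div_bounds {p q c i : ℕ} (h : p / 2 ^ i = q) (hc : c = q * 2 ^ i) :
    c ≤ p ∧ p < c + 2 ^ i := by
  have h1 := Nat.div_mul_le_self p (2 ^ i)
  have h2 := Nat.lt_div_mul_add (a := p) (b := 2 ^ i) (by positivity)
  rw [h, ← hc] at h1 h2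
  exact ⟨h1, h2⟩

/-- A position in the lower half and a position in the upper half of a list have exactly one common
node if the former comes first, and none otherwise. -/
theorem exists_common_node {m o p p' : ℕ} (h : p' < m) :
    (∃ x, x ∈ nodes m 1 o p ∧ x ∈ nodes m 0 o p') ↔ p < p' := by
  simp only [mem_nodes]
  constructor
  · rintro ⟨x, ⟨i, b, h1, h2, rfl⟩, i', b', h1', h2', h3⟩
    obtain ⟨rfl, rfl⟩ := odd_mul_two_pow_inj (Nat.add_left_cancel h3)
    have hp := div_bounds (show p / 2 ^ i = 2 * b by omega) rfl
    have hp' := div_bounds (show p' / 2 ^ i = 2 * b + 1 by omega) rfl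
    rw [Nat.add_mul] at hp'
    omega
  · intro hp
    obtain ⟨i, b, h1, h2⟩ := exists_level hp
    have hp' := div_bounds h2 rfl
    exact ⟨_, ⟨i, b, h1, by omega, rfl⟩, i, b, h2, by omega, rfl⟩

/-- If the two positions are separated at level `i`, then their quotients by `2 ^ (i + 1)` agree,
and so no higher level can separate them again. -/
theorem common_node_unique {m o p p' x y : ℕ} (hx : x ∈ nodes m 1 o p) (hx' : x ∈ nodes m 0 o p')
    (hy : y ∈ nodes m 1 o p) (hy' : y ∈ nodes m 0 o p') : x = y := by
  rw [mem_nodes] at hx hx' hy hy'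
  obtain ⟨i, b, h1, h2, rfl⟩ := hx
  obtain ⟨i', b', h1', h2', h3⟩ := hx'
  obtain ⟨rfl, rfl⟩ := odd_mul_two_pow_inj (Nat.add_left_cancel h3)
  obtain ⟨j, a, h4, h5, rfl⟩ := hy
  obtain ⟨j', a', h4', h5', h6⟩ := hy'
  obtain ⟨rfl, rfl⟩ := odd_mul_two_pow_inj (Nat.add_left_cancel h6)
  have key : ∀ {i j a b : ℕ}, i < j → p / 2 ^ i + 1 = 2 * b + 1 → p' / 2 ^ i + 0 = 2 * b + 1 →
      p / 2 ^ j + 1 = 2 * a + 1 → p' / 2 ^ j + 0 = 2 * a + 1 → False := by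
    intro i j a b hij e1 e2 e3 e4
    obtain ⟨d, rfl⟩ := Nat.exists_eq_add_of_lt hij
    rw [pow_succ, pow_add, mul_assoc, mul_comm (2 ^ d) 2, ← mul_assoc, ← Nat.div_div_eq_div_mul,
      ← Nat.div_div_eq_div_mul] at e3 e4
    rw [show p / 2 ^ i / 2 = b by omega] at e3
    rw [show p' / 2 ^ i / 2 = b by omega] at e4
    omega
  rcases lt_trichotomy i j with hij | rfl | hij
  · exact (key hij h1 h1' h4 h4').elim
  · rw [show b = a by omega]
  · exact (key hij h4 h4' h1 h1').elim

/-! The weight of all nodes of a list. -/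

/-- An upper bound for the weight of the node with midpoint `c`. -/
def nodeWeight (c : ℕ) : ℕ := if c = 0 then 1 else 3 ^ (padicValNat 2 c + 1)

/-- The node covers the `2 ^ (i + 1)` positions around its midpoint, which explains the exponent. -/
theorem nodeWeight_odd_mul (b i : ℕ) : nodeWeight ((2 * b + 1) * 2 ^ i) = 3 ^ (i + 1) := by
  have h1 : (2 * b + 1) * 2 ^ i ≠ 0 := by positivity
  rw [nodeWeight, if_neg h1, padicValNat.mul (by omega) (by positivity),
    padicValNat.eq_zero_of_not_dvd (by omega), padicValNat.prime_pow, zero_add]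

theorem exists_odd_mul {c : ℕ} (h : c ≠ 0) : ∃ b i, c = (2 * b + 1) * 2 ^ i := by
  obtain ⟨k, m, ⟨b, rfl⟩, rfl⟩ := Nat.exists_eq_two_pow_mul_odd h
  exact ⟨b, k, mul_comm _ _⟩

/-- Level `i` has `2 ^ (H - 1 - i)` midpoints of weight `3 ^ (i + 1)`, a geometric sum dominated by
the top level. This is the reason for the base `3`: with base `2` all levels would contribute
equally, and every splitting would cost a factor `log n` instead of a constant, too much for `log n`
splittings. -/
theorem sum_nodeWeight_two_pow (H : ℕ) :
    ∑ c ∈ Finset.range (2 ^ H), nodeWeight c + 3 * 2 ^ H = 1 + 3 * 3 ^ H := by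
  induction H with
  | zero => simp [nodeWeight]
  | succ H ih =>
    -- Doubling a positive midpoint triples its weight, and odd midpoints weigh `3`. The correction
    -- `2` comes from the midpoint `0`, whose weight stays `1`.
    have key : ∀ m, 0 < m → ∑ c ∈ Finset.range (2 * m), nodeWeight c + 2
        = 3 * ∑ c ∈ Finset.range m, nodeWeight c + 3 * m := by
      intro m hm
      induction m, hm using Nat.le_induction with
      | base =>
        have : nodeWeight 1 = 3 := by simpa using nodeWeight_odd_mul 0 0
        simp [Finset.sum_range_succ, nodeWeight]
      | succ m hm ih =>
        have h1 : nodeWeight (2 * m) = 3 * nodeWeight m := by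
          obtain ⟨b, i, rfl⟩ := exists_odd_mul (show m ≠ 0 by omega)
          rw [show 2 * ((2 * b + 1) * 2 ^ i) = (2 * b + 1) * 2 ^ (i + 1) by ring,
            nodeWeight_odd_mul, nodeWeight_odd_mul]
          ring
        have h2 : nodeWeight (2 * m + 1) = 3 := by simpa using nodeWeight_odd_mul m 0
        rw [show 2 * (m + 1) = 2 * m + 1 + 1 by ring, Finset.sum_range_succ, Finset.sum_range_succ,
          Finset.sum_range_succ, h1, h2]
        omega
    have := key (2 ^ H) (by positivity)
    rw [pow_succ' 2 H, pow_succ' 3 H]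
    omega

theorem sum_nodeWeight_le (m : ℕ) :
    ∑ c ∈ Finset.range m, nodeWeight c ≤ 3 * 3 ^ Nat.clog 2 m := by
  have h1 := sum_nodeWeight_two_pow (Nat.clog 2 m)
  have h2 : m ≤ 2 ^ Nat.clog 2 m := Nat.le_pow_clog (by norm_num) m
  have h3 : ∑ c ∈ Finset.range m, nodeWeight c ≤ ∑ c ∈ Finset.range (2 ^ Nat.clog 2 m), nodeWeight c :=
    Finset.sum_le_sum_of_subset (Finset.range_subset_range.2 h2)
  have : 0 < 2 ^ Nat.clog 2 m := by positivity
  omega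

/-! Families of groups. -/

/-- The number of elements of group `g`. -/
def groupSize (L : ℕ → List ℕ) (N g : ℕ) : ℕ := ∑ e ∈ Finset.range N, (L e).count g

/-- The number of members of group `g` among the first `q` elements of `ord`. -/
def occ (L : ℕ → List ℕ) (ord : ℕ → ℕ) (q g : ℕ) : ℕ := ∑ x ∈ Finset.range q, (L (ord x)).count g

/-- The first name of the nodes of group `g`. -/
def offset (L : ℕ → List ℕ) (N lo hi g : ℕ) : ℕ := hi + ∑ g' ∈ Finset.Ico lo g, groupSize L N g'

/-- The groups of the `q`-th element of `ord` after splitting along `ord`. -/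
def splitAt (L : ℕ → List ℕ) (z ord : ℕ → ℕ) (N lo hi q : ℕ) : List ℕ :=
  (L (ord q)).flatMap fun g =>
    nodes (groupSize L N g) (z (ord q)) (offset L N lo hi g) (occ L ord q g)

/-- The indicator of the red elements. -/
def redness (n e : ℕ) : ℕ := if e < n then 1 else 0

/-- Every element `e < N` lies in the groups `L e`, which are numbered from `lo` to `hi - 1`. A red
element `i < n` and a blue element `n ≤ j < N` have a common group, which is unique, if and only if
`D i j`. The total weight of the groups is at most `W`. -/
structure IsFamily (n N : ℕ) (L : ℕ → List ℕ) (lo hi : ℕ) (D : ℕ → ℕ → Prop) (W : ℕ) : Prop where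
  le : lo ≤ hi
  mem_range : ∀ e < N, ∀ g ∈ L e, lo ≤ g ∧ g < hi
  nodup : ∀ e < N, (L e).Nodup
  common : ∀ i < n, ∀ j, n ≤ j → j < N → ((∃ g, g ∈ L i ∧ g ∈ L j) ↔ D i j)
  unique : ∀ i < n, ∀ j, n ≤ j → j < N → ∀ g g', g ∈ L i → g ∈ L j → g' ∈ L i → g' ∈ L j → g = g'
  weight : ∑ g ∈ Finset.Ico lo hi, 3 ^ Nat.clog 2 (groupSize L N g) ≤ W

section
variable {n N : ℕ} {L : ℕ → List ℕ} {lo hi : ℕ} {D : ℕ → ℕ → Prop} {W : ℕ} {ord pos : ℕ → ℕ}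

theorem le_three_pow_clog (m : ℕ) : m ≤ 3 ^ Nat.clog 2 m :=
  (Nat.le_pow_clog (by norm_num) m).trans (Nat.pow_le_pow_left (by norm_num) _)

/-- The weight dominates all that has to be stored: here the number of memberships, and in
`IsFamily.card_le` the number of names. -/
theorem IsFamily.sum_groupSize_le (h : IsFamily n N L lo hi D W) :
    ∑ g ∈ Finset.Ico lo hi, groupSize L N g ≤ W :=
  (Finset.sum_le_sum fun _ _ => le_three_pow_clog _).trans h.weight

/-- Even an empty group has weight `1`. -/
theorem IsFamily.card_le (h : IsFamily n N L lo hi D W) : hi ≤ lo + W := by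
  have : ∑ g ∈ Finset.Ico lo hi, 1 ≤ W :=
    (Finset.sum_le_sum fun _ _ => Nat.one_le_pow _ _ (by norm_num)).trans h.weight
  simp at this
  omega

theorem IsFamily.sum_length_le (h : IsFamily n N L lo hi D W) :
    ∑ e ∈ Finset.range N, (L e).length ≤ W := by
  refine le_trans (le_of_eq ?_) h.sum_groupSize_le
  simp only [groupSize]
  rw [Finset.sum_comm]
  refine Finset.sum_congr rfl fun e he => ?_
  have := Multiset.sum_count_eq_card (s := Finset.Ico lo hi) (m := (L e : Multiset ℕ))
    (fun a ha => Finset.mem_Ico.2 (h.mem_range e (Finset.mem_range.1 he) a (by simpa using ha)))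
  simpa using this.symm

theorem offset_succ {g : ℕ} (h : lo ≤ g) :
    offset L N lo hi (g + 1) = offset L N lo hi g + groupSize L N g := by
  rw [offset, Finset.sum_Ico_succ_top h, offset, add_assoc]

theorem offset_mono {g g' : ℕ} (h : g ≤ g') : offset L N lo hi g ≤ offset L N lo hi g' :=
  Nat.add_le_add_left (Finset.sum_le_sum_of_subset (Finset.Ico_subset_Ico_right h)) _

/-- Group `g` owns as many consecutive new names as it has members, and these segments do not
overlap. -/
theorem offset_add_inj {g g' c c' : ℕ} (hg : lo ≤ g) (hg' : lo ≤ g')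
    (hc : c < groupSize L N g) (hc' : c' < groupSize L N g')
    (h : offset L N lo hi g + c = offset L N lo hi g' + c') : g = g' ∧ c = c' := by
  have key : ∀ {a b x y : ℕ}, lo ≤ a → a < b → x < groupSize L N a →
      offset L N lo hi a + x = offset L N lo hi b + y → False := by
    intro a b x y ha hab hx e
    have := offset_mono (L := L) (N := N) (lo := lo) (hi := hi) (Nat.succ_le_of_lt hab)
    rw [Nat.succ_eq_add_one, offset_succ ha] at this
    omega
  rcases lt_trichotomy g g' with hgg | rfl | hgg
  · exact (key hg hgg hc h).elim
  · exact ⟨rfl, by omega⟩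
  · exact (key hg' hgg hc' h.symm).elim

theorem sum_Ico_offset (f : ℕ → ℕ) {b : ℕ} (hb : lo ≤ b) :
    ∑ x ∈ Finset.Ico hi (offset L N lo hi b), f x
      = ∑ g ∈ Finset.Ico lo b, ∑ c ∈ Finset.range (groupSize L N g), f (offset L N lo hi g + c) := by
  induction b, hb using Nat.le_induction with
  | base => simp [offset]
  | succ b hb ih =>
    rw [Finset.sum_Ico_succ_top hb, ← ih, offset_succ hb, ← Finset.sum_Ico_consecutive f
      (show hi ≤ offset L N lo hi b by unfold offset; omega) (Nat.le_add_right _ _),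
      Finset.sum_Ico_eq_sum_range f (offset L N lo hi b), Nat.add_sub_cancel_left]

/-- `occ` is the rank of an element among the members of its group. Using ranks instead of positions
in `ord` keeps the dyadic tree as small as the group. -/
theorem occ_strictMono {q q' g : ℕ} (hq : g ∈ L (ord q)) (h : q < q') :
    occ L ord q g < occ L ord q' g := by
  have h1 : occ L ord (q + 1) g ≤ occ L ord q' g :=
    Finset.sum_le_sum_of_subset (Finset.range_subset_range.2 h)
  have h2 : 0 < (L (ord q)).count g := List.count_pos_iff.2 hq
  rw [occ, Finset.sum_range_succ, ← occ] at h1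
  omega

theorem sum_comp_ord (hpos : ∀ e < N, pos e < N ∧ ord (pos e) = e)
    (hord : ∀ q < N, ord q < N ∧ pos (ord q) = q) (f : ℕ → ℕ) :
    ∑ x ∈ Finset.range N, f (ord x) = ∑ e ∈ Finset.range N, f e := by
  refine Finset.sum_nbij' ord pos ?_ ?_ ?_ ?_ ?_
  · simpa using fun q hq => (hord q hq).1
  · simpa using fun q hq => (hpos q hq).1
  · simpa using fun q hq => (hord q hq).2
  · simpa using fun q hq => (hpos q hq).2
  · simp

theorem occ_lt {q g : ℕ} (hpos : ∀ e < N, pos e < N ∧ ord (pos e) = e)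
    (hord : ∀ q < N, ord q < N ∧ pos (ord q) = q) (hq : q < N) (hg : g ∈ L (ord q)) :
    occ L ord q g < groupSize L N g := by
  have := occ_strictMono hg hq
  rwa [occ, occ, sum_comp_ord hpos hord (fun e => (L e).count g), ← groupSize] at this

theorem mem_splitAt {q x : ℕ} {z : ℕ → ℕ} : x ∈ splitAt L z ord N lo hi q ↔ ∃ g ∈ L (ord q),
    x ∈ nodes (groupSize L N g) (z (ord q)) (offset L N lo hi g) (occ L ord q g) := by
  simp [splitAt]

theorem mem_nodes_offset {g z o p x : ℕ} (h : x ∈ nodes (groupSize L N g) z o p) :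
    ∃ c < groupSize L N g, x = o + c := by
  rw [mem_nodes] at h
  obtain ⟨i, b, -, h, rfl⟩ := h
  exact ⟨_, h, rfl⟩

theorem splitAt_nodup (h : IsFamily n N L lo hi D W) {z : ℕ → ℕ} {q : ℕ} (hq : ord q < N) :
    (splitAt L z ord N lo hi q).Nodup := by
  unfold splitAt
  rw [List.nodup_flatMap]
  refine ⟨fun _ _ => nodes_nodup _ _ _ _, (h.nodup _ hq).imp_of_mem ?_⟩
  intro g g' hg hg' hne x hx hx'
  obtain ⟨c, hc, rfl⟩ := mem_nodes_offset hx
  obtain ⟨c', hc', e⟩ := mem_nodes_offset hx'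
  exact hne (offset_add_inj (h.mem_range _ hq _ hg).1 (h.mem_range _ hq _ hg').1 hc hc' e).1

/-- A new name reveals the old group it comes from, so elements that share a new group already
shared an old one. -/
theorem common_split {q q' : ℕ} (hord : ∀ q < N, ord q < N ∧ pos (ord q) = q) (h : IsFamily n N L lo hi D W)
    (hq : q < N) (hq' : q' < N) (hr : ord q < n) (hb : n ≤ ord q') {x : ℕ}
    (hx : x ∈ splitAt L (redness n) ord N lo hi q) (hx' : x ∈ splitAt L (redness n) ord N lo hi q') :
    ∃ g, g ∈ L (ord q) ∧ g ∈ L (ord q') ∧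
      x ∈ nodes (groupSize L N g) 1 (offset L N lo hi g) (occ L ord q g) ∧
      x ∈ nodes (groupSize L N g) 0 (offset L N lo hi g) (occ L ord q' g) := by
  rw [mem_splitAt] at hx hx'
  obtain ⟨g, hg, hx⟩ := hx
  obtain ⟨g', hg', hx'⟩ := hx'
  obtain ⟨c, hc, e⟩ := mem_nodes_offset hx
  obtain ⟨c', hc', e'⟩ := mem_nodes_offset hx'
  obtain ⟨rfl, rfl⟩ := offset_add_inj (h.mem_range _ (hord _ hq).1 _ hg).1
    (h.mem_range _ (hord _ hq').1 _ hg').1 hc hc' (e.symm.trans e')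
  exact ⟨g, hg, hg', by simpa [redness, hr] using hx, by simpa [redness, hb.not_gt] using hx'⟩

/-- The members of the node with midpoint `(2 * b + 1) * 2 ^ i` have distinct ranks between `2 * b *
2 ^ i` and `(2 * b + 2) * 2 ^ i`, so there are at most `2 ^ (i + 1)` of them. -/
theorem groupSize_split_le (hpos : ∀ e < N, pos e < N ∧ ord (pos e) = e)
    (hord : ∀ q < N, ord q < N ∧ pos (ord q) = q) (h : IsFamily n N L lo hi D W) {g c : ℕ}
    (hg : lo ≤ g) (hc : c < groupSize L N g) :
    3 ^ Nat.clog 2 (groupSize (fun e => splitAt L (redness n) ord N lo hi (pos e)) N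
      (offset L N lo hi g + c)) ≤ nodeWeight c := by
  set x := offset L N lo hi g + c with hxdef
  have hsize : groupSize (fun e => splitAt L (redness n) ord N lo hi (pos e)) N x
      = (Finset.range N |>.filter fun q => x ∈ splitAt L (redness n) ord N lo hi q).card := by
    rw [groupSize, ← sum_comp_ord hpos hord
      (fun e => (splitAt L (redness n) ord N lo hi (pos e)).count x), Finset.card_filter]
    refine Finset.sum_congr rfl fun q hq => ?_
    rw [Finset.mem_range] at hq
    rw [(hord q hq).2]
    split_ifs with hx
    · exact List.count_eq_one_of_mem (splitAt_nodup h (hord q hq).1) hx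
    · exact List.count_eq_zero_of_not_mem hx
  have hmem : ∀ q < N, x ∈ splitAt L (redness n) ord N lo hi q → g ∈ L (ord q) ∧
      ∃ i b, c = (2 * b + 1) * 2 ^ i ∧ occ L ord q g / 2 ^ i + redness n (ord q) = 2 * b + 1 := by
    intro q hq hx
    rw [mem_splitAt] at hx
    obtain ⟨g', hg', hx⟩ := hx
    rw [mem_nodes] at hx
    obtain ⟨i, b, h1, h2, h3⟩ := hx
    obtain ⟨rfl, rfl⟩ := offset_add_inj hg (h.mem_range _ (hord _ hq).1 _ hg').1 hc h2 h3
    exact ⟨hg', i, b, rfl, h1⟩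
  -- No node has midpoint `0`. Its name is wasted, at the price of weight `1`.
  rcases eq_or_ne c 0 with rfl | hc0
  · have : groupSize (fun e => splitAt L (redness n) ord N lo hi (pos e)) N x = 0 := by
      rw [hsize, Finset.card_eq_zero, Finset.filter_eq_empty_iff]
      intro q hq hx
      obtain ⟨-, i, b, h1, -⟩ := hmem q (Finset.mem_range.1 hq) hx
      have : 0 < (2 * b + 1) * 2 ^ i := by positivity
      omega
    rw [this]
    simp [nodeWeight]
  · obtain ⟨b, i, rfl⟩ := exists_odd_mul hc0
    rw [nodeWeight_odd_mul]
    refine Nat.pow_le_pow_right (by norm_num) (Nat.clog_le_of_le_pow ?_)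
    rw [hsize]
    have hcard : (Finset.Ico ((2 * b) * 2 ^ i) ((2 * b + 2) * 2 ^ i)).card = 2 ^ (i + 1) := by
      rw [Nat.card_Ico, ← Nat.sub_mul, pow_succ', show 2 * b + 2 - 2 * b = 2 by omega]
    rw [← hcard]
    refine Finset.card_le_card_of_injOn (fun q => occ L ord q g) ?_ ?_
    · intro q hq
      simp only [Finset.coe_filter, Finset.mem_range, Set.mem_ofPred_eq] at hq
      obtain ⟨-, i', b', e1, e2⟩ := hmem q hq.1 hq.2
      obtain ⟨rfl, rfl⟩ := odd_mul_two_pow_inj e1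
      simp only [Finset.coe_Ico, Set.mem_Ico]
      have hz : redness n (ord q) ≤ 1 := by unfold redness; split_ifs <;> simp
      have hd := div_bounds (p := occ L ord q g) (i := i) rfl rfl
      have h1 : (2 * b) * 2 ^ i ≤ occ L ord q g / 2 ^ i * 2 ^ i := Nat.mul_le_mul_right _ (by omega)
      have h2 : (occ L ord q g / 2 ^ i + 1) * 2 ^ i ≤ (2 * b + 2) * 2 ^ i :=
        Nat.mul_le_mul_right _ (by omega)
      rw [Nat.add_mul, one_mul] at h2
      omega
    · intro q hq q' hq' e
      simp only [Finset.coe_filter, Finset.mem_range, Set.mem_ofPred_eq] at hq hq'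
      have hg1 := (hmem q hq.1 hq.2).1
      have hg2 := (hmem q' hq'.1 hq'.2).1
      rcases lt_trichotomy q q' with hlt | he | hlt
      · exact ((occ_strictMono hg1 hlt).ne e).elim
      · exact he
      · exact ((occ_strictMono hg2 hlt).ne' e).elim

/-- Splitting along a linear order refines the domination relation by that order, and at most
triples the weight. -/
theorem IsFamily.split (hpos : ∀ e < N, pos e < N ∧ ord (pos e) = e)
    (hord : ∀ q < N, ord q < N ∧ pos (ord q) = q) (hn : n ≤ N) (h : IsFamily n N L lo hi D W) :
    IsFamily n N (fun e => splitAt L (redness n) ord N lo hi (pos e)) hi (offset L N lo hi hi)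
      (fun i j => D i j ∧ pos i < pos j) (3 * W) where
  le := by unfold offset; omega
  mem_range e he x hx := by
    rw [mem_splitAt, (hpos e he).2] at hx
    obtain ⟨g, hg, hx⟩ := hx
    obtain ⟨c, hc, rfl⟩ := mem_nodes_offset hx
    have h1 := h.mem_range e he g hg
    refine ⟨by unfold offset; omega, ?_⟩
    have := offset_mono (L := L) (N := N) (lo := lo) (hi := hi) (Nat.succ_le_of_lt h1.2)
    rw [Nat.succ_eq_add_one, offset_succ h1.1] at this
    omega
  nodup e he := splitAt_nodup h (by rw [(hpos e he).2]; exact he)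
  common i hi' j hj hj' := by
    have pi := hpos i (by omega)
    have pj := hpos j hj'
    rw [← h.common i hi' j hj hj']
    constructor
    · rintro ⟨x, hx, hx'⟩
      obtain ⟨g, hg, hg', h1, h2⟩ := common_split hord h pi.1 pj.1 (by rw [pi.2]; exact hi')
        (by rw [pj.2]; exact hj) hx hx'
      have hlt := (exists_common_node (occ_lt hpos hord pj.1 hg')).1 ⟨x, h1, h2⟩
      rw [pi.2] at hg
      rw [pj.2] at hg'
      refine ⟨⟨g, hg, hg'⟩, ?_⟩
      -- `occ` is monotone, so within a common group the order of the ranks decides the order of the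
      -- positions.
      by_contra hle
      have : occ L ord (pos j) g ≤ occ L ord (pos i) g :=
        Finset.sum_le_sum_of_subset (Finset.range_subset_range.2 (by omega))
      omega
    · rintro ⟨⟨g, hg, hg'⟩, hlt⟩
      have hgi : g ∈ L (ord (pos i)) := by rwa [pi.2]
      have hgj : g ∈ L (ord (pos j)) := by rwa [pj.2]
      obtain ⟨x, hx, hx'⟩ := (exists_common_node (o := offset L N lo hi g)
        (occ_lt hpos hord pj.1 hgj)).2 (occ_strictMono hgi hlt)
      refine ⟨x, mem_splitAt.2 ⟨g, hgi, ?_⟩, mem_splitAt.2 ⟨g, hgj, ?_⟩⟩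
      · rwa [pi.2, redness, if_pos hi']
      · rwa [pj.2, redness, if_neg (by omega)]
  unique i hi' j hj hj' x y hx hx' hy hy' := by
    have pi := hpos i (by omega)
    have pj := hpos j hj'
    obtain ⟨g, hg, hg', h1, h2⟩ := common_split hord h pi.1 pj.1 (by rw [pi.2]; exact hi')
      (by rw [pj.2]; exact hj) hx hx'
    obtain ⟨g2, hg2, hg2', h3, h4⟩ := common_split hord h pi.1 pj.1 (by rw [pi.2]; exact hi')
      (by rw [pj.2]; exact hj) hy hy'
    rw [pi.2] at hg hg2
    rw [pj.2] at hg' hg2'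
    obtain rfl := h.unique i hi' j hj hj' g g2 hg hg' hg2 hg2'
    exact common_node_unique h1 h2 h3 h4
  weight := by
    -- The new names are collected by the old group that owns them; each old group at most triples.
    rw [sum_Ico_offset _ h.le]
    calc _ ≤ ∑ g ∈ Finset.Ico lo hi, 3 * 3 ^ Nat.clog 2 (groupSize L N g) := by
          refine Finset.sum_le_sum fun g hg => ?_
          refine (Finset.sum_le_sum fun c hc => ?_).trans (sum_nodeWeight_le _)
          exact groupSize_split_le hpos hord h (Finset.mem_Ico.1 hg).1 (Finset.mem_range.1 hc)
      _ ≤ 3 * W := by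
          rw [← Finset.mul_sum]
          exact Nat.mul_le_mul_left _ h.weight

/-- Before any comparison all pairs are related, through the single group `0`. -/
theorem isFamily_init (n N : ℕ) :
    IsFamily n N (fun _ => [0]) 0 1 (fun _ _ => True) (3 ^ Nat.clog 2 N) where
  le := by omega
  mem_range := by simp
  nodup := by simp
  common := by simp
  unique := by simp
  weight := by simp [groupSize]

end

end Dominance


namespace WordRAM
open Dominance

/-! ### Splitting groups on the machine -/

/-- `aOff` receives the first new name of each group, and `aCount`, reset here, will count the
members met so far, which gives the rank of the next one. -/
def offsetStep : Program :=
  .store aOff (.var vGrp) (.var vNew) ;;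
  .store aCount (.var vGrp) (.const 0) ;;
  .assign vNew (.add (.var vNew) (.get aSize (.var vGrp))) ;;
  .assign vGrp (.add (.var vGrp) (.const 1))

def initOffsets : Program :=
  (.assign vNew (.var vGrpHi) ;; .assign vGrp (.var vGrpLo)) ;;
  .while (.lt (.var vGrp) (.var vGrpHi)) offsetStep

/-- This continues at the value of `vGrp` that `initOffsets` leaves behind, which is the first new
name. -/
def clearSizes : Program :=
  .while (.lt (.var vGrp) (.var vNew))
    (.store aSize (.var vGrp) (.const 0) ;; .assign vGrp (.add (.var vGrp) (.const 1)))

def pushNode : Program :=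
  .assign vQuo (.add (.get aOff (.var vGrp)) (.mul (.var vQuo) (.var vPow))) ;;
  .store aPool (.var vTop) (.var vQuo) ;;
  .store aSize (.var vQuo) (.add (.get aSize (.var vQuo)) (.const 1)) ;;
  .assign vTop (.add (.var vTop) (.const 1))

def pushStep : Program :=
  .assign vQuo (.add (.div (.var vPos) (.var vPow)) (.var vRed)) ;;
  .ite (.and (.eq (.mod (.var vQuo) (.const 2)) (.const 1))
      (.lt (.mul (.var vQuo) (.var vPow)) (.get aSize (.var vGrp)))) pushNode .skip ;;
  .assign vPow (.mul (.var vPow) (.const 2))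

def pushNodes : Program :=
  .assign vPow (.const 1) ;; .while (.lt (.var vPow) (.get aSize (.var vGrp))) pushStep

def splitGroup : Program :=
  (.assign vGrp (.get aPool (.var vPtr)) ;;
    .assign vPos (.get aCount (.var vGrp)) ;;
    .store aCount (.var vGrp) (.add (.var vPos) (.const 1))) ;;
  pushNodes ;;
  .assign vPtr (.add (.var vPtr) (.const 1))

/-- The new list goes to the top of the pool and the old one stays in place. `aStart` can be
overwritten at once, because `vPtr` keeps the old start; `aStop` still bounds the loop and is
overwritten last. -/
def splitElement : Program :=
  (.assign vPtr (.get aStart (.var vElt)) ;; .store aStart (.var vElt) (.var vTop)) ;;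
  .while (.lt (.var vPtr) (.get aStop (.var vElt))) splitGroup ;;
  .store aStop (.var vElt) (.var vTop)

def splitNext : Program :=
  (.assign vElt (.get aOrd (.var vIdx)) ;;
    .ite (.lt (.var vElt) (.var vNum)) (.assign vRed (.const 1)) (.assign vRed (.const 0))) ;;
  splitElement ;;
  .assign vIdx (.add (.var vIdx) (.const 1))

def splitAll : Program :=
  .assign vIdx (.const 0) ;; .while (.lt (.var vIdx) (.var vElts)) splitNext

def refineGroups : Program :=
  initOffsets ;; clearSizes ;; splitAll ;;
  .assign vGrpLo (.var vGrpHi) ;; .assign vGrpHi (.var vNew)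

variable {w : ℕ} {ω : ℕ → Bool}

theorem initOffsets_runs {s : State} {L : ℕ → List ℕ} {N lo hi : ℕ} (hlo : s.var vGrpLo = lo)
    (hhi : s.var vGrpHi = hi) (hle : lo ≤ hi)
    (hsz : ∀ g, lo ≤ g → g < hi → s.arr aSize g = groupSize L N g)
    (hw : offset L N lo hi hi + 1 < 2 ^ w) :
    Runs w ω initOffsets s ((hi - lo) * 30 + 20) fun s' =>
      s'.var vNew = offset L N lo hi hi ∧ s'.var vGrp = hi ∧
      ∀ g, lo ≤ g → g < hi → s'.arr aOff g = offset L N lo hi g ∧ s'.arr aCount g = 0 := by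
  have hhw : hi ≤ offset L N lo hi hi := Nat.le_add_right _ _
  refine (Runs.seq (T := 10) (Q := fun s' => s'.var vNew = hi ∧ s'.var vGrp = lo)
    ((Runs.of_loopFree rfl (by simp [hlo, hhi])).mono (by decide) fun _ _ h => h)
    fun s1 hs1 hf1 => Runs.loop_const (hi - lo) (fun y s' =>
      s'.var vNew = offset L N lo hi (lo + y) ∧ s'.var vGrp = lo + y ∧
      ∀ g, lo ≤ g → g < lo + y → s'.arr aOff g = offset L N lo hi g ∧ s'.arr aCount g = 0) 20
      ⟨by simp [hs1, offset], hs1.2, fun g _ _ => by omega⟩ ?_ ?_).mono ?_ ?_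
  · rintro y hy s' ⟨h1, h2, h3⟩ hf
    have hhi' : s'.var vGrpHi = hi :=
      ((hf.var _ (by decide)).trans (hf1.var _ (by decide))).trans hhi
    have hsz' : s'.arr aSize = s.arr aSize := (hf.arr _ (by decide)).trans (hf1.arr _ (by decide))
    refine ⟨by simp only [Test.Holds, IntExpr.eval, hhi', h2]; omega, ?_⟩
    refine (Runs.of_loopFree rfl ?_).mono (by decide) fun _ _ h => h
    have h4 : offset L N lo hi (lo + y + 1) = offset L N lo hi (lo + y) + groupSize L N (lo + y) :=
      offset_succ (by omega)
    have h5 : offset L N lo hi (lo + y + 1) ≤ offset L N lo hi hi := offset_mono (by omega)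
    have h6 := hsz (lo + y) (by omega) (by omega)
    refine ⟨?_, ?_, fun g hg hg' => ?_⟩
    · simp (disch := omega) [offsetStep, h1, h2, hsz', h6, Nat.mod_eq_of_lt]
      rw [← add_assoc, h4]
    · simp (disch := omega) [offsetStep, h2, Nat.mod_eq_of_lt, add_assoc]
    · simp (disch := omega) only [offsetStep, Program.step, State.arr_setVar, State.arr_setArr,
        State.var_setArr, IntExpr.eval, h1, h2, ite_true, Nat.zero_mod]
      by_cases hgy : g = lo + y
      · subst hgy
        simp
      · have := h3 g hg (by omega)
        simpa [Function.update_of_ne hgy] using this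
  · rintro s' ⟨-, h2, -⟩ hf
    have hhi' : s'.var vGrpHi = hi :=
      ((hf.var _ (by decide)).trans (hf1.var _ (by decide))).trans hhi
    simp only [Test.Holds, IntExpr.eval, hhi', h2]; omega
  · simp only [Test.cost, IntExpr.cost]; omega
  · rintro s' - ⟨h1, h2, h3⟩
    rw [show lo + (hi - lo) = hi by omega] at h1 h2 h3
    exact ⟨h1, h2, h3⟩

theorem clearSizes_runs {s : State} {a b : ℕ} (ha : s.var vGrp = a) (hb : s.var vNew = b)
    (hab : a ≤ b) (hw : b + 1 < 2 ^ w) :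
    Runs w ω clearSizes s ((b - a) * 20 + 20) fun s' =>
      (∀ g, a ≤ g → g < b → s'.arr aSize g = 0) ∧ ∀ g < a, s'.arr aSize g = s.arr aSize g := by
  refine (Runs.loop_const (b - a) (fun y s' => s'.var vGrp = a + y ∧
      (∀ g, a ≤ g → g < a + y → s'.arr aSize g = 0) ∧ ∀ g < a, s'.arr aSize g = s.arr aSize g) 10
      ⟨ha, fun g _ _ => by omega, fun _ _ => rfl⟩ ?_ ?_).mono ?_ ?_
  · rintro y hy s' ⟨h1, h2, h3⟩ hf
    have hb' : s'.var vNew = b := (hf.var _ (by decide)).trans hb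
    refine ⟨by simp only [Test.Holds, IntExpr.eval, hb', h1]; omega, ?_⟩
    refine (Runs.of_loopFree rfl ?_).mono (by decide) fun _ _ h => h
    refine ⟨?_, fun g hg hg' => ?_, fun g hg => ?_⟩
    · simp (disch := omega) [h1, Nat.mod_eq_of_lt, add_assoc]
    · by_cases hgy : g = a + y
      · subst hgy
        simp [h1]
      · have := h2 g hg (by omega)
        simpa [h1, Function.update_of_ne hgy] using this
    · simpa [h1, Function.update_of_ne (show g ≠ a + y by omega)] using h3 g hg
  · rintro s' ⟨h2, -⟩ hf
    have hb' : s'.var vNew = b := (hf.var _ (by decide)).trans hb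
    simp only [Test.Holds, IntExpr.eval, hb', h2]; omega
  · simp only [Test.cost, IntExpr.cost]; omega
  · rintro s' - ⟨-, h2, h3⟩
    rw [show a + (b - a) = b by omega] at h2
    exact ⟨h2, h3⟩

/-- The nodes on the first `y` levels. -/
def nodesUpTo (m z o p y : ℕ) : List ℕ :=
  (List.range y).filterMap fun i =>
    if (p / 2 ^ i + z) % 2 = 1 ∧ (p / 2 ^ i + z) * 2 ^ i < m then some (o + (p / 2 ^ i + z) * 2 ^ i)
    else none

theorem nodesUpTo_succ (m z o p y : ℕ) : nodesUpTo m z o p (y + 1) = nodesUpTo m z o p y ++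
    if (p / 2 ^ y + z) % 2 = 1 ∧ (p / 2 ^ y + z) * 2 ^ y < m then [o + (p / 2 ^ y + z) * 2 ^ y]
    else [] := by
  rw [nodesUpTo, List.range_succ, List.filterMap_append, ← nodesUpTo]
  split_ifs with h <;> simp [h]

theorem nodesUpTo_length_mono (m z o p : ℕ) : Monotone fun y => (nodesUpTo m z o p y).length :=
  monotone_nat_of_le_succ fun y => by rw [nodesUpTo_succ, List.length_append]; omega

theorem pos_of_odd {x : ℕ} (h : x % 2 = 1) : 0 < x := by omega

theorem lt_of_mem_nodesUpTo {m z o p y x : ℕ} (h : x ∈ nodesUpTo m z o p y) : o < x := by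
  simp only [nodesUpTo, List.mem_filterMap, Option.ite_none_right_eq_some,
    Option.some.injEq] at h
  obtain ⟨i, -, ⟨h1, -⟩, rfl⟩ := h
  have : 0 < (p / 2 ^ i + z) * 2 ^ i := Nat.mul_pos (pos_of_odd h1) (by positivity)
  omega

/-- Pushed names exceed `o`, and `g < o`. Hence counting up the sizes of the new groups does not
touch the size of `g`, which bounds the loop. -/
theorem pushNodes_runs {s : State} {g m z o p top : ℕ} (hg : s.var vGrp = g) (hp : s.var vPos = p)
    (hz : s.var vRed = z) (ht : s.var vTop = top) (hm : s.arr aSize g = m) (ho : s.arr aOff g = o)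
    (hgo : g < o) (hz1 : z ≤ 1) (hpm : p < m) (hw : 2 < 2 ^ w) (hom : o + 2 * m < 2 ^ w)
    (htop : top + (nodes m z o p).length < 2 ^ w)
    (hsz : ∀ x, o ≤ x → x < o + m → s.arr aSize x + (nodes m z o p).length < 2 ^ w) :
    Runs w ω pushNodes s (Nat.clog 2 m * 70 + 20) fun s' =>
      s'.var vTop = top + (nodes m z o p).length ∧
      slice (s'.arr aPool) top (s'.var vTop) = nodes m z o p ∧
      (∀ y < top, s'.arr aPool y = s.arr aPool y) ∧
      ∀ x, s'.arr aSize x = s.arr aSize x + (nodes m z o p).count x := by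
  have hpow : ∀ i, i < Nat.clog 2 m ↔ 2 ^ i < m := fun i =>
    Nat.lt_clog_iff_pow_lt (by norm_num)
  have hnodes : nodes m z o p = nodesUpTo m z o p (Nat.clog 2 m) := rfl
  rw [hnodes] at htop hsz ⊢
  refine (Runs.seq (T := 2) (Q := fun s' => s'.var vPow = 1)
    ((Runs.of_loopFree rfl (by simp (disch := omega) [Nat.mod_eq_of_lt])).mono (by decide)
      fun _ _ h => h)
    fun s1 hs1 hf1 => Runs.loop_const (Nat.clog 2 m) (fun y s' => s'.var vPow = 2 ^ y ∧
      s'.var vTop = top + (nodesUpTo m z o p y).length ∧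
      slice (s'.arr aPool) top (s'.var vTop) = nodesUpTo m z o p y ∧
      (∀ y < top, s'.arr aPool y = s.arr aPool y) ∧
      ∀ x, s'.arr aSize x = s.arr aSize x + (nodesUpTo m z o p y).count x) 60
      ⟨hs1, ?_, ?_, ?_, ?_⟩ ?_ ?_).mono ?_ fun s' _ h => h.2
  · simpa [nodesUpTo] using (hf1.var _ (by decide)).trans ht
  · simp [nodesUpTo, (hf1.var vTop (by decide)).trans ht, slice_self]
  · intro y _
    rw [hf1.arr _ (by decide)]
  · intro x
    rw [hf1.arr _ (by decide)]
    simp [nodesUpTo]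
  · rintro y hy s' ⟨h1, h2, h3, h4, h5⟩ hf
    have hy' := (hpow y).1 hy
    have hlen := nodesUpTo_length_mono m z o p (Nat.succ_le_of_lt hy)
    simp only [Nat.succ_eq_add_one] at hlen
    have hg' : s'.var vGrp = g := ((hf.var _ (by decide)).trans (hf1.var _ (by decide))).trans hg
    have hp' : s'.var vPos = p := ((hf.var _ (by decide)).trans (hf1.var _ (by decide))).trans hp
    have hz' : s'.var vRed = z := ((hf.var _ (by decide)).trans (hf1.var _ (by decide))).trans hz
    have ho' : s'.arr aOff g = o := by
      rw [hf.arr _ (by decide), hf1.arr _ (by decide), ho]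
    have hm' : s'.arr aSize g = m := by
      rw [h5, hm, List.count_eq_zero_of_not_mem fun hc => ?_, add_zero]
      exact absurd (lt_of_mem_nodesUpTo hc) (by omega)
    have hd1 : p / 2 ^ y * 2 ^ y ≤ p := Nat.div_mul_le_self _ _
    have hd2 : p / 2 ^ y ≤ p := Nat.div_le_self _ _
    -- Before it is tested against `m`, a candidate for a midpoint can be as large as this, which is
    -- less than `2 * m`. This is why `hom` leaves room for `2 * m`.
    have hd3 : (p / 2 ^ y + z) * 2 ^ y ≤ p + 2 ^ y := by
      rw [Nat.add_mul]
      have := Nat.mul_le_mul_right (2 ^ y) hz1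
      omega
    have hr : (p / 2 ^ y + z) % 2 < 2 := Nat.mod_lt _ (by norm_num)
    refine ⟨by simp only [Test.Holds, IntExpr.eval, hg', h1, hm']; omega, ?_⟩
    refine (Runs.of_loopFree rfl ?_).mono (by decide) fun _ _ h => h
    have hlt : ((Program.assign vQuo (.add (.div (.var vPos) (.var vPow)) (.var vRed))).step w ω s')
        = s'.setVar vQuo (p / 2 ^ y + z) := by
      simp (disch := omega) [h1, hp', hz', Nat.mod_eq_of_lt]
    rw [nodesUpTo_succ] at hlen ⊢
    by_cases hc : (p / 2 ^ y + z) % 2 = 1 ∧ (p / 2 ^ y + z) * 2 ^ y < m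
    · have hq0 : 0 < (p / 2 ^ y + z) * 2 ^ y := Nat.mul_pos (pos_of_odd hc.1) (by positivity)
      rw [if_pos hc] at hlen ⊢
      rw [List.length_append, List.length_singleton] at hlen
      have hsq := h5 (o + (p / 2 ^ y + z) * 2 ^ y)
      have hcount := List.count_le_length (a := o + (p / 2 ^ y + z) * 2 ^ y)
        (l := nodesUpTo m z o p y)
      have hsw := hsz (o + (p / 2 ^ y + z) * 2 ^ y) (by omega) (by omega)
      have hstep : pushStep.step w ω s' = (((((s'.setVar vQuo (p / 2 ^ y + z)).setVar vQuo
          (o + (p / 2 ^ y + z) * 2 ^ y)).setArr aPool (s'.var vTop)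
          (o + (p / 2 ^ y + z) * 2 ^ y)).setArr aSize (o + (p / 2 ^ y + z) * 2 ^ y)
          (s'.arr aSize (o + (p / 2 ^ y + z) * 2 ^ y) + 1)).setVar vTop (s'.var vTop + 1)).setVar vPow (2 ^ y * 2) := by
        simp (disch := omega) [pushStep, pushNode, h1, h2, hg', hm', ho', hp', hz', hc,
          Nat.mod_eq_of_lt]
      rw [hstep]
      refine ⟨?_, ?_, ?_, ?_, ?_⟩
      · simp [pow_succ]
      · simp [h2, add_assoc]
      · simp only [State.var_setVar, State.arr_setVar, State.arr_setArr, reduceIte,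
          Nat.reduceEqDiff]
        rw [slice_concat _ (by omega), Function.update_self,
          slice_congr (B := s'.arr aPool) (fun z _ hz => Function.update_of_ne (by omega) _ _), h3]
      · intro x hx
        simp [Function.update_of_ne (show x ≠ s'.var vTop by omega), h4 x hx]
      · intro x
        simp only [State.arr_setVar, State.arr_setArr, reduceIte, Nat.reduceEqDiff]
        by_cases hx : x = o + (p / 2 ^ y + z) * 2 ^ y
        · subst hx
          rw [Function.update_self, hsq]
          simp [List.count_append, add_assoc]
        · rw [Function.update_of_ne hx, h5, List.count_append, List.count_singleton]
          simp [Ne.symm hx]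
    · rw [if_neg hc, List.append_nil] at hlen ⊢
      have hstep : pushStep.step w ω s' = (s'.setVar vQuo (p / 2 ^ y + z)).setVar vPow
          (2 ^ y * 2) := by
        simp (disch := omega) [pushStep, h1, hg', hm', hp', hz', hc, Nat.mod_eq_of_lt]
      rw [hstep]
      refine ⟨?_, ?_, ?_, ?_, ?_⟩
      · simp [pow_succ]
      · simpa using h2
      · simpa using h3
      · simpa using h4
      · simpa using h5
  · rintro s' ⟨h1, h2, h3, h4, h5⟩ hf
    have := (hpow (Nat.clog 2 m)).not.1 (lt_irrefl _)
    have hg' : s'.var vGrp = g := ((hf.var _ (by decide)).trans (hf1.var _ (by decide))).trans hg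
    have hm' : s'.arr aSize g = m := by
      rw [h5, hm, List.count_eq_zero_of_not_mem fun hc => ?_, add_zero]
      exact absurd (lt_of_mem_nodesUpTo hc) (by omega)
    simp only [Test.Holds, IntExpr.eval, hg', h1, hm']; omega
  · simp only [Test.cost, IntExpr.cost]; omega

end WordRAM


/-! ### Splitting all elements along the sorted order. -/

namespace WordRAM
open Dominance

variable {w : ℕ} {ω : ℕ → Bool}

theorem slice_length (A : ℕ → ℕ) (lo hi : ℕ) : (slice A lo hi).length = hi - lo := by simp [slice]

theorem slice_getElem {A : ℕ → ℕ} {lo hi : ℕ} {l : List ℕ} (h : slice A lo hi = l) {x : ℕ}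
    (hx : x < l.length) : A (lo + x) = l[x] := by
  subst h
  simp [slice]

theorem flatMap_take_succ {l : List ℕ} {x : ℕ} (hx : x < l.length) (F : ℕ → List ℕ) :
    (l.take (x + 1)).flatMap F = (l.take x).flatMap F ++ F l[x] := by
  rw [List.take_succ_eq_append_getElem hx, List.flatMap_append]
  simp

theorem flatMap_take_length_le (l : List ℕ) (x : ℕ) (F : ℕ → List ℕ) :
    ((l.take x).flatMap F).length ≤ (l.flatMap F).length := by
  conv_rhs => rw [← List.take_append_drop x l, List.flatMap_append, List.length_append]
  omega

theorem count_take_of_nodup {l : List ℕ} (h : l.Nodup) {x : ℕ} (hx : x < l.length) :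
    (l.take x).count l[x] = 0 := by
  refine List.count_eq_zero_of_not_mem fun hm => ?_
  obtain ⟨y, hy, e⟩ := List.mem_iff_getElem.1 hm
  rw [List.getElem_take] at e
  rw [List.length_take] at hy
  have := (List.Nodup.getElem_inj_iff h).1 e
  omega

/-- As `l` has no repetitions, the counter of each group still has its initial value `cnt g` when
that group is reached. -/
theorem splitElement_runs {s : State} {e z top hi hi2 H : ℕ} {l : List ℕ} {m off cnt : ℕ → ℕ}
    (he : s.var vElt = e) (ht : s.var vTop = top) (hz : s.var vRed = z) (hz1 : z ≤ 1)
    (hl : slice (s.arr aPool) (s.arr aStart e) (s.arr aStop e) = l)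
    (hse : s.arr aStart e ≤ s.arr aStop e) (hen : s.arr aStop e ≤ top) (hnd : l.Nodup)
    (hg : ∀ g ∈ l, g < hi ∧ s.arr aSize g = m g ∧ s.arr aOff g = off g ∧ s.arr aCount g = cnt g ∧
      cnt g < m g ∧ hi ≤ off g ∧ off g + m g ≤ hi2 ∧ Nat.clog 2 (m g) ≤ H)
    (hw : 2 < 2 ^ w) (hhi2 : 2 * hi2 < 2 ^ w)
    (htop : top + (l.flatMap fun g => nodes (m g) z (off g) (cnt g)).length + 1 < 2 ^ w)
    (hsz : ∀ x, hi ≤ x → x < hi2 →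
      s.arr aSize x + (l.flatMap fun g => nodes (m g) z (off g) (cnt g)).length < 2 ^ w) :
    Runs w ω splitElement s (l.length * (H * 70 + 60) + 30) fun s' =>
      s'.var vTop = top + (l.flatMap fun g => nodes (m g) z (off g) (cnt g)).length ∧
      slice (s'.arr aPool) top (s'.var vTop)
        = l.flatMap (fun g => nodes (m g) z (off g) (cnt g)) ∧
      (∀ y < top, s'.arr aPool y = s.arr aPool y) ∧
      (∀ x, s'.arr aSize x
        = s.arr aSize x + (l.flatMap fun g => nodes (m g) z (off g) (cnt g)).count x) ∧
      (∀ g, s'.arr aCount g = s.arr aCount g + l.count g) ∧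
      s'.arr aStart = Function.update (s.arr aStart) e top ∧
      s'.arr aStop = Function.update (s.arr aStop) e (s'.var vTop) := by
  set F : ℕ → List ℕ := fun g => nodes (m g) z (off g) (cnt g) with hF
  set st := s.arr aStart e with hst
  have hlen : l.length = s.arr aStop e - st := by rw [← hl, slice_length]
  -- New names are at least `hi`, so the sizes of the old groups survive.
  have hFhi : ∀ x, ∀ g < hi, g ∉ (l.take x).flatMap F := by
    intro x g hgx hc
    rw [List.mem_flatMap] at hc
    obtain ⟨g', hg', hc⟩ := hc
    have h1 := lt_of_mem_nodesUpTo hc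
    have h2 := hg g' (List.mem_of_mem_take hg')
    omega
  refine (Runs.seq (T := 10) (Q := fun s' => s'.var vPtr = st ∧ s'.var vTop = top ∧
      s'.arr aStart = Function.update (s.arr aStart) e top)
    ((Runs.of_loopFree rfl (by simp [he, ht, hst])).mono (by decide)
      fun _ _ h => h)
    fun s1 hs1 hf1 => Runs.seq (Runs.loop_const l.length (fun x s' => s'.var vPtr = st + x ∧
      s'.var vTop = top + ((l.take x).flatMap F).length ∧
      slice (s'.arr aPool) top (s'.var vTop) = (l.take x).flatMap F ∧
      (∀ y < top, s'.arr aPool y = s.arr aPool y) ∧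
      (∀ x', s'.arr aSize x' = s.arr aSize x' + ((l.take x).flatMap F).count x') ∧
      (∀ g, s'.arr aCount g = s.arr aCount g + (l.take x).count g)) (H * 70 + 45)
      ⟨hs1.1, ?_, ?_, ?_, ?_, ?_⟩ ?_ ?_) (T' := 6) fun s2 h2 hf2 =>
        (Runs.of_loopFree rfl ?_).mono (by decide) fun _ _ h => h).mono ?_ fun _ _ h => h
  · simpa using hs1.2.1
  · simp [hs1.2.1, slice_self]
  · intro y _
    rw [hf1.arr _ (by decide)]
  · intro y
    rw [hf1.arr _ (by decide)]
    simp
  · intro y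
    rw [hf1.arr _ (by decide)]
    simp
  · rintro x hx s' ⟨h1, h2, h3, h4, h5, h6⟩ hf
    have he' : s'.var vElt = e := ((hf.var _ (by decide)).trans (hf1.var _ (by decide))).trans he
    have hz' : s'.var vRed = z := ((hf.var _ (by decide)).trans (hf1.var _ (by decide))).trans hz
    have hen' : s'.arr aStop = s.arr aStop := (hf.arr _ (by decide)).trans (hf1.arr _ (by decide))
    have hoff' : s'.arr aOff = s.arr aOff := (hf.arr _ (by decide)).trans (hf1.arr _ (by decide))
    have hgx : s'.arr aPool (st + x) = l[x] := by
      rw [h4 _ (by omega)]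
      exact slice_getElem hl hx
    obtain ⟨g1, g2, g3, g4, g5, g6, g7, g8⟩ := hg l[x] (List.getElem_mem hx)
    have hlx := flatMap_take_length_le l (x + 1) F
    rw [flatMap_take_succ hx, List.length_append] at hlx
    have hcx : s'.arr aCount l[x] = cnt l[x] := by
      rw [h6, g4, count_take_of_nodup hnd hx, add_zero]
    refine ⟨by simp only [Test.Holds, IntExpr.eval, he', h1, hen']; omega, ?_⟩
    refine (Runs.seq (T := 12) (Q := fun s'' => s''.var vGrp = l[x] ∧ s''.var vPos = cnt l[x] ∧
      s''.arr aCount = Function.update (s'.arr aCount) l[x] (cnt l[x] + 1)) ?_ fun s2 k2 hf2 =>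
      Runs.seq (pushNodes_runs (s := s2) (g := l[x]) (m := m l[x]) (z := z) (o := off l[x])
        (p := cnt l[x]) (top := top + ((l.take x).flatMap F).length) k2.1 k2.2.1
        ((hf2.var _ (by decide)).trans hz') ((hf2.var _ (by decide)).trans h2) ?_ ?_ (by omega) hz1
        g5 hw (by omega) ?_ ?_) (T' := 6) fun s3 k3 hf3 =>
          (Runs.of_loopFree rfl ?_).mono (by decide) fun _ _ h => h).mono ?_ fun _ _ h => h
    · refine (Runs.of_loopFree rfl ?_).mono (by decide) fun _ _ h => h
      simp (disch := omega) [h1, hgx, hcx, Nat.mod_eq_of_lt]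
    · rw [hf2.arr _ (by decide), h5, g2, List.count_eq_zero_of_not_mem (hFhi x _ g1), add_zero]
    · rw [hf2.arr _ (by decide), hoff', g3]
    · have : (F l[x]).length = (nodes (m l[x]) z (off l[x]) (cnt l[x])).length := rfl
      omega
    · intro y hy hy'
      rw [hf2.arr _ (by decide), h5]
      have := hsz y (by omega) (by omega)
      have hc := List.count_le_length (a := y) (l := (l.take x).flatMap F)
      have : (F l[x]).length = (nodes (m l[x]) z (off l[x]) (cnt l[x])).length := rfl
      omega
    · obtain ⟨k3a, k3b, k3c, k3d⟩ := k3
      have hp3 : s3.var vPtr = st + x :=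
        ((hf3.var _ (by decide)).trans (hf2.var _ (by decide))).trans h1
      have hpool : s2.arr aPool = s'.arr aPool := hf2.arr _ (by decide)
      have hsize : s2.arr aSize = s'.arr aSize := hf2.arr _ (by decide)
      rw [hpool] at k3c
      refine ⟨?_, ?_, ?_, ?_, ?_, ?_⟩
      · simp (disch := omega) [hp3, Nat.mod_eq_of_lt, add_assoc]
      · rw [flatMap_take_succ hx, List.length_append]
        simpa [add_assoc] using k3a
      · simp only [Program.step, State.arr_setVar, State.var_setVar, reduceIte, Nat.reduceEqDiff]
        rw [flatMap_take_succ hx, ← slice_append _ (show top ≤ s'.var vTop by omega) (by omega),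
          slice_congr (fun y _ hy => k3c y (by omega)), h3, h2, k3b]
      · intro y hy
        simpa [h4 y hy] using k3c y (by omega)
      · intro y
        simp only [Program.step, State.arr_setVar]
        rw [k3d, hsize, h5, flatMap_take_succ hx, List.count_append, add_assoc]
      · intro y
        simp only [Program.step, State.arr_setVar]
        rw [hf3.arr _ (by decide), k2.2.2, List.take_succ_eq_append_getElem hx, List.count_append,
          List.count_singleton]
        by_cases hy : y = l[x]
        · subst hy
          rw [Function.update_self, ← hcx, h6]
          simp [add_assoc]
        · rw [Function.update_of_ne hy, h6]
          simp [Ne.symm hy]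
    · have := Nat.mul_le_mul_right 70 g8
      omega
  · rintro s' ⟨h1, -⟩ hf
    have he' : s'.var vElt = e := ((hf.var _ (by decide)).trans (hf1.var _ (by decide))).trans he
    have hen' : s'.arr aStop = s.arr aStop := (hf.arr _ (by decide)).trans (hf1.arr _ (by decide))
    simp only [Test.Holds, IntExpr.eval, he', h1, hen']; omega
  · obtain ⟨k1, k2, k3, k4, k5, k6⟩ := h2
    rw [List.take_length] at k2 k3 k5 k6
    have he' : s2.var vElt = e := ((hf2.var _ (by decide)).trans (hf1.var _ (by decide))).trans he
    have hen' : s2.arr aStop = s.arr aStop := (hf2.arr _ (by decide)).trans (hf1.arr _ (by decide))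
    have hst' : s2.arr aStart = Function.update (s.arr aStart) e top :=
      (hf2.arr _ (by decide)).trans hs1.2.2
    refine ⟨?_, ?_, ?_, ?_, ?_, ?_, ?_⟩
    · simpa using k2
    · simpa using k3
    · simpa using k4
    · simpa using k5
    · simpa using k6
    · simpa using hst'
    · simp [he', hen']
  · simp only [Test.cost, IntExpr.cost]
    have : l.length * (H * 70 + 45 + (1 + (1 + 1) + 1) + 1) ≤ l.length * (H * 70 + 60) :=
      Nat.mul_le_mul_left _ (by omega)
    omega

/-- The machine holds the groups `L e` of the elements `e < N`, and the sizes of these groups. -/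
structure HoldsGroups (s : State) (L : ℕ → List ℕ) (N lo hi top : ℕ) : Prop where
  lo_eq : s.var vGrpLo = lo
  hi_eq : s.var vGrpHi = hi
  top_eq : s.var vTop = top
  list : ∀ e < N, slice (s.arr aPool) (s.arr aStart e) (s.arr aStop e) = L e
  start_le : ∀ e < N, s.arr aStart e ≤ s.arr aStop e
  stop_le : ∀ e < N, s.arr aStop e ≤ top
  size : ∀ g, lo ≤ g → g < hi → s.arr aSize g = groupSize L N g

theorem clog_groupSize_le {L : ℕ → List ℕ} {N g : ℕ} (h : ∀ e < N, (L e).Nodup) :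
    Nat.clog 2 (groupSize L N g) ≤ Nat.clog 2 N := by
  refine Nat.clog_mono_right _ ?_
  calc groupSize L N g ≤ ∑ e ∈ Finset.range N, 1 :=
        Finset.sum_le_sum fun e he => List.nodup_iff_count_le_one.1 (h e (Finset.mem_range.1 he)) g
    _ = N := by simp

/-- When the first `q` elements of the order are done, they have their new lists, the others still
their old ones, and the counters hold `occ L ord q`. The time is amortized over the at most `W`
memberships, each of which costs at most `Nat.clog 2 N` levels. -/
theorem refineGroups_runs {s : State} {n N lo hi top W : ℕ} {L : ℕ → List ℕ} {D : ℕ → ℕ → Prop}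
    {ord pos : ℕ → ℕ} (hpos : ∀ e < N, pos e < N ∧ ord (pos e) = e)
    (hord : ∀ q < N, ord q < N ∧ pos (ord q) = q) (hnN : n ≤ N)
    (hfam : IsFamily n N L lo hi D W) (hs : HoldsGroups s L N lo hi top)
    (hn : s.var vNum = n) (hN : s.var vElts = N) (ho : ∀ q < N, s.arr aOrd q = ord q)
    (hw : 2 * (hi + W + N + 2) < 2 ^ w) (htop : top + 3 * W + 1 < 2 ^ w) :
    Runs w ω refineGroups s (W * (Nat.clog 2 N * 70 + 200) + N * 80 + 100) fun s' =>
      HoldsGroups s' (fun e => splitAt L (redness n) ord N lo hi (pos e)) N hi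
        (offset L N lo hi hi) (s'.var vTop) ∧ s'.var vTop ≤ top + 3 * W := by
  set hi2 := offset L N lo hi hi with hhi2
  set L' : ℕ → List ℕ := fun e => splitAt L (redness n) ord N lo hi (pos e) with hL'
  have hfam' := hfam.split hpos hord hnN
  have hcard := hfam.card_le
  have hle := hfam.le
  have hhi2W : hi2 ≤ hi + W := by
    have := hfam.sum_groupSize_le
    rw [hhi2, offset]; omega
  have hhi : hi ≤ hi2 := Nat.le_add_right _ _
  -- the entries written so far
  set NL : ℕ → List ℕ := fun q => splitAt L (redness n) ord N lo hi q with hNL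
  set acc : ℕ → List ℕ := fun q => (List.range q).flatMap NL with hacc
  have hacc_succ : ∀ q, acc (q + 1) = acc q ++ NL q := by
    intro q; simp [hacc, List.range_succ]
  have hacc_mono : ∀ q ≤ N, (acc q).length ≤ (acc N).length := by
    intro q hq
    have : Monotone fun q => (acc q).length :=
      monotone_nat_of_le_succ fun y => by simp only [hacc_succ, List.length_append]; omega
    exact this hq
  -- The machine works in sorted order, the bounds of `IsFamily` are indexed by elements.
  have hsumNL : ∀ f : List ℕ → ℕ, ∑ q ∈ Finset.range N, f (NL q)
      = ∑ e ∈ Finset.range N, f (L' e) := by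
    intro f
    rw [← sum_comp_ord hpos hord (fun e => f (L' e))]
    refine Finset.sum_congr rfl fun q hq => ?_
    simp only [hL', hNL, (hord q (Finset.mem_range.1 hq)).2]
  have hlenacc : ∀ q, (acc q).length = ∑ x ∈ Finset.range q, (NL x).length := by
    intro q
    induction q with
    | zero => simp [hacc]
    | succ q ih => rw [hacc_succ, List.length_append, ih, Finset.sum_range_succ]
  have hcountacc : ∀ x q, (acc q).count x = ∑ y ∈ Finset.range q, (NL y).count x := by
    intro x q
    induction q with
    | zero => simp [hacc]
    | succ q ih => rw [hacc_succ, List.count_append, ih, Finset.sum_range_succ]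
  have haccN : (acc N).length ≤ 3 * W := by
    rw [hlenacc, hsumNL List.length]
    exact hfam'.sum_length_le
  have hNLhi : ∀ q < N, ∀ x ∈ NL q, hi ≤ x := by
    intro q hq x hx
    refine (hfam'.mem_range (ord q) (hord q hq).1 x ?_).1
    simpa only [(hord q hq).2] using hx
  have hacchi : ∀ q ≤ N, ∀ g < hi, (acc q).count g = 0 := by
    intro q hq g hg
    rw [hcountacc]
    refine Finset.sum_eq_zero fun y hy => List.count_eq_zero_of_not_mem fun hc => ?_
    have := hNLhi y (by rw [Finset.mem_range] at hy; omega) g hc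
    omega
  have hlensum : ∑ q ∈ Finset.range N, (L (ord q)).length ≤ W := by
    rw [sum_comp_ord hpos hord (fun e => (L e).length)]
    exact hfam.sum_length_le
  refine (Runs.seq (initOffsets_runs hs.lo_eq hs.hi_eq hle hs.size (by omega))
    fun s1 h1 hf1 => Runs.seq (clearSizes_runs h1.2.1 h1.1 hhi (by omega))
    fun s2 h2 hf2 => Runs.seq (T := 2 + (∑ q ∈ Finset.range N,
        ((L (ord q)).length * (Nat.clog 2 N * 70 + 60) + 60 + (Test.lt (.var vIdx) (.var vElts)).cost
          + 1) + ((Test.lt (.var vIdx) (.var vElts)).cost + 1)))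
      (Q := fun s' => s'.var vTop = top + (acc N).length ∧
      (∀ e < N, slice (s'.arr aPool) (s'.arr aStart e) (s'.arr aStop e) = L' e) ∧
      (∀ e < N, s'.arr aStart e ≤ s'.arr aStop e ∧ s'.arr aStop e ≤ s'.var vTop) ∧
      (∀ x, hi ≤ x → x < hi2 → s'.arr aSize x = (acc N).count x))
    ?_ (T' := 10) fun s3 h3 hf3 => (Runs.of_loopFree rfl ?_).mono (by decide) fun _ _ h => h).mono ?_
    fun _ _ h => h
  · obtain ⟨h1a, h1b, h1c⟩ := h1
    obtain ⟨h2a, h2b⟩ := h2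
    have ev2 : ∀ x, x ∉ (initOffsets ;; clearSizes).modVars → s2.var x = s.var x := fun x hx =>
      (hf1.seq_left.trans hf2.seq_right).var x hx
    have ea2 : ∀ x, x ∉ (initOffsets ;; clearSizes).modArrs → s2.arr x = s.arr x := fun x hx =>
      (hf1.seq_left.trans hf2.seq_right).arr x hx
    have hoff2 : s2.arr aOff = s1.arr aOff := hf2.arr _ (by decide)
    have hcnt2 : s2.arr aCount = s1.arr aCount := hf2.arr _ (by decide)
    refine Runs.seq (T := 2) (Q := fun s' => s'.var vIdx = 0)
      ((Runs.of_loopFree rfl (by simp)).mono (by decide) fun _ _ h => h)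
      fun s3 h3 hf3 => (Runs.loop (b := .lt (.var vIdx) (.var vElts)) N (fun q s' => s'.var vIdx = q ∧
        s'.var vTop = top + (acc q).length ∧
        (∀ e < N, slice (s'.arr aPool) (s'.arr aStart e) (s'.arr aStop e)
          = if pos e < q then L' e else L e) ∧
        (∀ e < N, s'.arr aStart e ≤ s'.arr aStop e ∧ s'.arr aStop e ≤ s'.var vTop) ∧
        (∀ x, hi ≤ x → x < hi2 → s'.arr aSize x = (acc q).count x) ∧
        (∀ g, lo ≤ g → g < hi → s'.arr aSize g = groupSize L N g ∧
          s'.arr aCount g = occ L ord q g))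
        (fun q => (L (ord q)).length * (Nat.clog 2 N * 70 + 60) + 60)
        ⟨h3, ?_, ?_, ?_, ?_, ?_⟩ ?_ ?_).mono le_rfl ?_
    · rw [hf3.var _ (by decide), ev2 _ (by decide), hs.top_eq]
      simp [hacc]
    · intro e he
      rw [hf3.arr _ (by decide), hf3.arr _ (by decide), hf3.arr _ (by decide), ea2 _ (by decide),
        ea2 _ (by decide), ea2 _ (by decide)]
      simpa using hs.list e he
    · intro e he
      rw [hf3.var _ (by decide), hf3.arr _ (by decide), hf3.arr _ (by decide), ea2 _ (by decide),
        ea2 _ (by decide), ev2 _ (by decide), hs.top_eq]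
      exact ⟨hs.start_le e he, hs.stop_le e he⟩
    · intro x hx hx'
      rw [hf3.arr _ (by decide), h2a x hx hx']
      simp [hacc]
    · intro g hg hg'
      rw [hf3.arr _ (by decide), hf3.arr _ (by decide), h2b g hg', hcnt2, (h1c g hg hg').2,
        hf1.arr _ (by decide), hs.size g hg hg']
      simp [occ]
    · rintro q hq s4 ⟨k1, k2, k3, k4, k5, k6⟩ hf4
      have ev4 : ∀ x, x ∉ (splitAll).modVars → s4.var x = s2.var x := fun x hx =>
        (hf3.seq_left.trans (hf4.mono (q := splitAll) (by decide) (by decide) (by decide)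
          (by decide))).var x hx
      have ea4 : ∀ x, x ∉ (splitAll).modArrs → s4.arr x = s2.arr x := fun x hx =>
        (hf3.seq_left.trans (hf4.mono (q := splitAll) (by decide) (by decide) (by decide)
          (by decide))).arr x hx
      have hN4 : s4.var vElts = N := by rw [ev4 _ (by decide), ev2 _ (by decide), hN]
      have hn4 : s4.var vNum = n := by rw [ev4 _ (by decide), ev2 _ (by decide), hn]
      have ho4 : s4.arr aOrd q = ord q := by
        rw [ea4 _ (by decide), ea2 _ (by decide), ho q hq]
      have hoq := hord q hq
      have hmono := hacc_mono (q + 1) (by omega)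
      rw [hacc_succ, List.length_append] at hmono
      have hLq := k3 (ord q) hoq.1
      rw [hoq.2, if_neg (lt_irrefl q)] at hLq
      refine ⟨by simp only [Test.Holds, IntExpr.eval, k1, hN4]; omega, ?_⟩
      refine (Runs.seq (T := 12) (Q := fun s' => s'.var vElt = ord q ∧
          s'.var vRed = redness n (ord q)) ?_ fun s5 k7 hf5 =>
        Runs.seq (splitElement_runs (s := s5) (hi := hi) (hi2 := hi2) (H := Nat.clog 2 N)
          (l := L (ord q)) (m := groupSize L N) (off := offset L N lo hi) (cnt := occ L ord q)
          (top := top + (acc q).length) k7.1 ((hf5.var _ (by decide)).trans k2) k7.2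
          (by unfold redness; split_ifs <;> simp) ?_ ?_ ?_ (hfam.nodup _ hoq.1) ?_ (by omega)
          (by omega) ?_ ?_) (T' := 6) fun s6 k8 hf6 =>
        (Runs.of_loopFree rfl ?_).mono (by decide) fun _ _ h => h).mono (by omega) fun _ _ h => h
      · refine (Runs.of_loopFree rfl ?_).mono (by decide) fun _ _ h => h
        by_cases hr : ord q < n
        · simp (disch := omega) [k1, ho4, hn4, hr, redness, Nat.mod_eq_of_lt]
        · simp (disch := omega) [k1, ho4, hn4, hr, redness, Nat.mod_eq_of_lt]
      · rw [hf5.arr _ (by decide), hf5.arr _ (by decide), hf5.arr _ (by decide)]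
        exact hLq
      · rw [hf5.arr _ (by decide), hf5.arr _ (by decide)]
        exact (k4 _ hoq.1).1
      · rw [hf5.arr _ (by decide)]
        have := (k4 _ hoq.1).2
        omega
      · intro g hg
        have hgr := hfam.mem_range _ hoq.1 g hg
        have hb := offset_mono (L := L) (N := N) (lo := lo) (hi := hi) (Nat.succ_le_of_lt hgr.2)
        rw [Nat.succ_eq_add_one, offset_succ hgr.1] at hb
        rw [hf5.arr _ (by decide), hf5.arr _ (by decide), hf5.arr _ (by decide)]
        refine ⟨hgr.2, (k6 g hgr.1 hgr.2).1, ?_, (k6 g hgr.1 hgr.2).2, occ_lt hpos hord hq hg,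
          Nat.le_add_right _ _, hb, clog_groupSize_le hfam.nodup⟩
        rw [ea4 _ (by decide), hoff2, (h1c g hgr.1 hgr.2).1]
      · change top + (acc q).length + (NL q).length + 1 < _
        omega
      · intro x hx hx'
        rw [hf5.arr _ (by decide), k5 x hx hx']
        change (acc q).count x + (NL q).length < _
        have := List.count_le_length (a := x) (l := acc q)
        omega
      · obtain ⟨m1, m2, m3, m4, m5, m6, m7⟩ := k8
        change s6.var vTop = top + (acc q).length + (NL q).length at m1
        change slice _ _ _ = NL q at m2
        change ∀ x, s6.arr aSize x = s5.arr aSize x + (NL q).count x at m4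
        rw [hf5.arr _ (by decide)] at m3 m4 m5 m6 m7
        have hi6 : s6.var vIdx = q := by
          rw [hf6.var _ (by decide), hf5.var _ (by decide), k1]
        simp only [Program.step, State.arr_setVar, State.var_setVar, IntExpr.eval, hi6, reduceIte,
          Nat.reduceEqDiff]
        refine ⟨by rw [Nat.mod_eq_of_lt (show 1 < 2 ^ w by omega), Nat.mod_eq_of_lt (by omega)],
          ?_, ?_, ?_, ?_, ?_⟩
        · rw [hacc_succ, List.length_append, m1, add_assoc]
        · intro e he
          rw [m6, m7]
          by_cases hpe : pos e = q
          · have : e = ord q := by rw [← hpe, (hpos e he).2]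
            subst this
            rw [Function.update_self, Function.update_self, m2, if_pos (by omega)]
            simp only [hL', hNL, hpe]
          · have : e ≠ ord q := fun hc => hpe (by rw [hc, hoq.2])
            rw [Function.update_of_ne this, Function.update_of_ne this,
              slice_congr (B := s4.arr aPool) (fun y _ hy => m3 y ?_), k3 e he]
            · simp only [show pos e < q + 1 ↔ pos e < q by omega]
            · have := (k4 e he).2
              omega
        · intro e he
          rw [m6, m7]
          by_cases hpe : e = ord q
          · subst hpe
            rw [Function.update_self, Function.update_self]
            omega
          · rw [Function.update_of_ne hpe, Function.update_of_ne hpe]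
            have := k4 e he
            omega
        · intro x hx hx'
          rw [m4, k5 x hx hx', hacc_succ, List.count_append]
        · intro g hg hg'
          rw [m4, m5, (k6 g hg hg').1, (k6 g hg hg').2, List.count_eq_zero_of_not_mem (fun hc => by
            have := hNLhi q hq g hc; omega), add_zero, occ, occ, Finset.sum_range_succ]
          exact ⟨rfl, rfl⟩
    · rintro s4 ⟨k1, -⟩ hf4
      have hN4 : s4.var vElts = N := by
        rw [hf4.var _ (by decide), hf3.var _ (by decide), ev2 _ (by decide), hN]
      simp only [Test.Holds, IntExpr.eval, k1, hN4]; omega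
    · rintro s4 - ⟨k1, k2, k3, k4, k5, k6⟩
      refine ⟨k2, fun e he => ?_, k4, k5⟩
      rw [k3 e he, if_pos (hpos e he).1]
  · obtain ⟨k1, k2, k3, k4⟩ := h3
    have hG : s3.var vGrpHi = hi := by
      rw [hf3.var _ (by decide), hf2.var _ (by decide), hf1.var _ (by decide), hs.hi_eq]
    have hNw : s3.var vNew = hi2 := by
      rw [hf3.var _ (by decide), hf2.var _ (by decide), h1.1]
    refine ⟨⟨?_, ?_, rfl, ?_, ?_, ?_, ?_⟩, ?_⟩
    · simpa using hG
    · simpa using hNw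
    · simpa using k2
    · simpa using fun e he => (k3 e he).1
    · simpa using fun e he => (k3 e he).2
    · intro g hg hg'
      have := k4 g hg hg'
      rw [hcountacc] at this
      rw [groupSize, ← hsumNL (fun l => l.count g), ← this]
      simp
    · simp [k1]
      omega
  · have e1 : ∑ q ∈ Finset.range N, ((L (ord q)).length * (Nat.clog 2 N * 70 + 60) + 60
          + (Test.lt (.var vIdx) (.var vElts)).cost + 1)
        = (∑ q ∈ Finset.range N, (L (ord q)).length) * (Nat.clog 2 N * 70 + 60) + N * 64 := by
      simp only [add_assoc, Test.cost, IntExpr.cost]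
      rw [Finset.sum_add_distrib, ← Finset.sum_mul]
      simp
    have e2 := Nat.mul_le_mul_right (Nat.clog 2 N * 70 + 60) hlensum
    have e3 : W * (Nat.clog 2 N * 70 + 200) = W * (Nat.clog 2 N * 70 + 60) + W * 140 := by ring
    rw [e1, e3]
    simp only [Test.cost, IntExpr.cost]
    omega

end WordRAM


namespace WordRAM
open Dominance

/-! ### Reporting the pairs with a common group -/

/-- The cell keeps the better of its value and that of the path over `vMid`, comparing flags before
weights. The code of a path has its vertices as base-`vNum` digits, and the midpoint is appended as
the last digit. -/
def updateCell : Program :=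
  (.assign vFlag (.add (.get aFlagA (.add (.mul (.var vNum) (.var vRow)) (.var vMid)))
      (.get aFlagB (.add (.mul (.var vNum) (.var vMid)) (.var vCol)))) ;;
    .assign vElt (.add (.mul (.var vNum) (.var vRow)) (.var vCol))) ;;
  .ite (.or (.lt (.get aFlagC (.var vElt)) (.var vFlag))
      (.and (.eq (.get aFlagC (.var vElt)) (.var vFlag))
        (.not (.realLe (.add (.get rA (.add (.mul (.var vNum) (.var vRow)) (.var vMid)))
          (.get rWt (.add (.mul (.var vNum) (.var vMid)) (.var vCol)))) (.get rC (.var vElt))))))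
    (.store aFlagC (.var vElt) (.var vFlag) ;;
      .realStore rC (.var vElt) (.add (.get rA (.add (.mul (.var vNum) (.var vRow)) (.var vMid)))
          (.get rWt (.add (.mul (.var vNum) (.var vMid)) (.var vCol)))) ;;
      .store aCodeC (.var vElt) (.add (.mul (.get aCodeA
        (.add (.mul (.var vNum) (.var vRow)) (.var vMid))) (.var vNum)) (.var vMid)))
    .skip

def emitRedStep : Program :=
  .assign vGrp (.get aPool (.var vPtr)) ;;
  .store aSlot (.add (.get aOff (.var vGrp)) (.get aCount (.var vGrp))) (.var vIdx) ;;
  .store aCount (.var vGrp) (.add (.get aCount (.var vGrp)) (.const 1)) ;;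
  .assign vPtr (.add (.var vPtr) (.const 1))

def emitRed : Program :=
  .assign vPtr (.get aStart (.var vIdx)) ;;
  .while (.lt (.var vPtr) (.get aStop (.var vIdx))) emitRedStep ;;
  .assign vIdx (.add (.var vIdx) (.const 1))

/-- A bucket sort of the red elements by group. The bucket of a group is the segment of `aSlot` from
`aOff` on, which is long enough for all its members. -/
def emitReds : Program :=
  .assign vIdx (.const 0) ;; .while (.lt (.var vIdx) (.var vNum)) emitRed

def emitSlot : Program :=
  .assign vRow (.get aSlot (.var vPos)) ;; updateCell ;;
  .assign vPos (.add (.var vPos) (.const 1))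

/-- The bucket lists the rows that are related to the current column through this group. -/
def emitBlueStep : Program :=
  (.assign vGrp (.get aPool (.var vPtr)) ;;
    .assign vPos (.get aOff (.var vGrp)) ;;
    .assign vQuo (.add (.var vPos) (.get aCount (.var vGrp)))) ;;
  .while (.lt (.var vPos) (.var vQuo)) emitSlot ;;
  .assign vPtr (.add (.var vPtr) (.const 1))

def emitBlue : Program :=
  (.assign vCol (.sub (.var vIdx) (.var vNum)) ;; .assign vPtr (.get aStart (.var vIdx))) ;;
  .while (.lt (.var vPtr) (.get aStop (.var vIdx))) emitBlueStep ;;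
  .assign vIdx (.add (.var vIdx) (.const 1))

def emitBlues : Program := .while (.lt (.var vIdx) (.var vElts)) emitBlue

def emitPairs : Program := initOffsets ;; emitReds ;; emitBlues

variable {w : ℕ} {ω : ℕ → Bool}

/-- The value of a cell: the flag counts first, then the weight. -/
noncomputable def cellVal (F : ℕ → ℕ) (R : ℕ → ℝ) (c : ℕ) : ℤ ×ₗ ℝ := toLex ((F c : ℤ), R c)

/-- The value of row `i` and column `j` in the product matrix. -/
noncomputable def prodVal (s : State) (c : ℕ) : ℤ ×ₗ ℝ := cellVal (s.arr aFlagC) (s.real rC) c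

/-- The value of the path from `i` over `l` to `j`. -/
noncomputable def pathVal (n : ℕ) (s : State) (i l j : ℕ) : ℤ ×ₗ ℝ :=
  cellVal (s.arr aFlagA) (s.real rA) (n * i + l) + cellVal (s.arr aFlagB) (s.real rWt) (n * l + j)

/-- The factors of the product are the same in both states. -/
structure SameFactors (s₀ s : State) : Prop where
  flagA : s.arr aFlagA = s₀.arr aFlagA
  codeA : s.arr aCodeA = s₀.arr aCodeA
  flagB : s.arr aFlagB = s₀.arr aFlagB
  realA : s.real rA = s₀.real rA
  realB : s.real rWt = s₀.real rWt

theorem SameFactors.of_frame {p : Program} {s₀ s s' : State} (h : SameFactors s₀ s)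
    (hf : Frame p s s') (ha : aFlagA ∉ p.modArrs ∧ aCodeA ∉ p.modArrs ∧ aFlagB ∉ p.modArrs)
    (hr : rA ∉ p.modReals ∧ rWt ∉ p.modReals) : SameFactors s₀ s' :=
  ⟨(hf.arr _ ha.1).trans h.flagA, (hf.arr _ ha.2.1).trans h.codeA, (hf.arr _ ha.2.2).trans h.flagB,
    (hf.real _ hr.1).trans h.realA, (hf.real _ hr.2).trans h.realB⟩

/-- Every cell of the product matrix holds the value and the code of some path. -/
def IsCandidate (n : ℕ) (s₀ s : State) : Prop :=
  ∀ i < n, ∀ j < n, ∃ l < n, prodVal s (n * i + j) = pathVal n s₀ i l j ∧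
    s.arr aCodeC (n * i + j) = s₀.arr aCodeA (n * i + l) * n + l

/-- The words that occur in the computation of a product do not overflow. -/
structure FactorBound (n w : ℕ) (s₀ : State) : Prop where
  flagA : ∀ i < n, ∀ l < n, 2 * s₀.arr aFlagA (n * i + l) < 2 ^ w
  flagB : ∀ l < n, ∀ j < n, 2 * s₀.arr aFlagB (n * l + j) < 2 ^ w
  code : ∀ i < n, ∀ l < n, s₀.arr aCodeA (n * i + l) * n + n < 2 ^ w

theorem cell_lt {n i j : ℕ} (hi : i < n) (hj : j < n) : n * i + j < n * n := by
  have := Nat.mul_le_mul_left n (Nat.succ_le_of_lt hi)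
  rw [Nat.mul_succ] at this
  omega

theorem cell_inj {n i j i' j' : ℕ} (hj : j < n) (hj' : j' < n) (h : n * i + j = n * i' + j') :
    i = i' ∧ j = j' := by
  have h1 : (n * i + j) / n = (n * i' + j') / n := by rw [h]
  rw [Nat.mul_add_div (by omega), Nat.mul_add_div (by omega), Nat.div_eq_of_lt hj,
    Nat.div_eq_of_lt hj'] at h1
  obtain rfl : i = i' := by omega
  exact ⟨rfl, by omega⟩

/-- A cell always holds the value of an actual path (`IsCandidate`), so it can never exceed the
optimum. For a correct product it is then enough that cells never decrease and that each is offered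
a best midpoint. -/
theorem updateCell_runs {s s₀ : State} {n i j l : ℕ} (hn : s.var vNum = n) (hi : s.var vRow = i)
    (hj : s.var vCol = j) (hl : s.var vMid = l) (hi' : i < n) (hj' : j < n) (hl' : l < n)
    (hw : n * n < 2 ^ w) (hsame : SameFactors s₀ s) (hb : FactorBound n w s₀)
    (hc : IsCandidate n s₀ s) :
    Runs w ω updateCell s 120 fun s' => IsCandidate n s₀ s' ∧
      (∀ i < n, ∀ j < n, prodVal s (n * i + j) ≤ prodVal s' (n * i + j)) ∧
      pathVal n s₀ i l j ≤ prodVal s' (n * i + j) := by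
  have c1 := cell_lt hi' hl'
  have c2 := cell_lt hl' hj'
  have c3 := cell_lt hi' hj'
  have b1 := hb.flagA i hi' l hl'
  have b1' := hb.flagB l hl' j hj'
  have b2 := hb.code i hi' l hl'
  have hval : pathVal n s₀ i l j = toLex (((s₀.arr aFlagA (n * i + l) + s₀.arr aFlagB (n * l + j) : ℕ)
      : ℤ), s₀.real rA (n * i + l) + s₀.real rWt (n * l + j)) := by
    simp [pathVal, cellVal, ← toLex_add]
  refine (Runs.seq (T := 20) (Q := fun s' =>
      s'.var vFlag = s₀.arr aFlagA (n * i + l) + s₀.arr aFlagB (n * l + j) ∧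
      s'.var vElt = n * i + j) ?_ fun s1 h1 hf1 => Runs.ite (T := 40)
    (fun hb' => (Runs.of_loopFree rfl ?_).mono (by decide) fun _ _ h => h)
    (fun hb' => (Runs.of_loopFree rfl ?_).mono (by decide) fun _ _ h => h)).mono
      (by simp only [Test.cost, IntExpr.cost, RealExpr.cost]; omega) fun _ _ h => h
  · refine (Runs.of_loopFree rfl ?_).mono (by decide) fun _ _ h => h
    simp (disch := omega) [hn, hi, hj, hl, hsame.flagA, hsame.flagB, Nat.mod_eq_of_lt]
  all_goals
    have hn1 : s1.var vNum = n := (hf1.var _ (by decide)).trans hn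
    have hi1 : s1.var vRow = i := (hf1.var _ (by decide)).trans hi
    have hj1 : s1.var vCol = j := (hf1.var _ (by decide)).trans hj
    have hl1 : s1.var vMid = l := (hf1.var _ (by decide)).trans hl
    have hs1 : SameFactors s₀ s1 := hsame.of_frame hf1 (by decide) (by decide)
    have hFC : s1.arr aFlagC = s.arr aFlagC := hf1.arr _ (by decide)
    have hCC : s1.arr aCodeC = s.arr aCodeC := hf1.arr _ (by decide)
    have hRC : s1.real rC = s.real rC := hf1.real _ (by decide)
    simp (disch := omega) only [Test.Holds, IntExpr.eval, RealExpr.eval, h1.1, h1.2, hn1, hi1, hj1,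
      hl1, hs1.realA, hs1.realB, hFC, hRC, Nat.mod_eq_of_lt, not_le] at hb'
    -- The test of the program is the lexicographic comparison of flag and weight.
    have hiff : prodVal s (n * i + j) < pathVal n s₀ i l j ↔
        s.arr aFlagC (n * i + j) < s₀.arr aFlagA (n * i + l) + s₀.arr aFlagB (n * l + j) ∨
        s.arr aFlagC (n * i + j) = s₀.arr aFlagA (n * i + l) + s₀.arr aFlagB (n * l + j) ∧
        s.real rC (n * i + j) < s₀.real rA (n * i + l) + s₀.real rWt (n * l + j) := by
      rw [hval, prodVal, cellVal, Prod.Lex.toLex_lt_toLex]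
      simp only [Nat.cast_lt, Nat.cast_inj]
    rw [← hiff] at hb'
  · have hoff : ∀ c, c ≠ n * i + j → prodVal (Program.step w ω (.store aFlagC (.var vElt) (.var vFlag) ;;
        .realStore rC (.var vElt) (.add (.get rA (.add (.mul (.var vNum) (.var vRow)) (.var vMid)))
          (.get rWt (.add (.mul (.var vNum) (.var vMid)) (.var vCol)))) ;;
        .store aCodeC (.var vElt) (.add (.mul (.get aCodeA
          (.add (.mul (.var vNum) (.var vRow)) (.var vMid))) (.var vNum)) (.var vMid))) s1) c
          = prodVal s c := by
      intro c hc
      simp [prodVal, cellVal, h1.2, Function.update_of_ne hc, hFC, hRC]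
    have hon : prodVal (Program.step w ω (.store aFlagC (.var vElt) (.var vFlag) ;;
        .realStore rC (.var vElt) (.add (.get rA (.add (.mul (.var vNum) (.var vRow)) (.var vMid)))
          (.get rWt (.add (.mul (.var vNum) (.var vMid)) (.var vCol)))) ;;
        .store aCodeC (.var vElt) (.add (.mul (.get aCodeA
          (.add (.mul (.var vNum) (.var vRow)) (.var vMid))) (.var vNum)) (.var vMid))) s1)
          (n * i + j) = pathVal n s₀ i l j := by
      rw [hval]
      simp (disch := omega) [prodVal, cellVal, h1.1, h1.2, hn1, hi1, hj1, hl1, hs1.realA, hs1.realB,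
        Nat.mod_eq_of_lt]
    refine ⟨fun i' hi2 j' hj2 => ?_, fun i' hi2 j' hj2 => ?_, hon.ge⟩
    · by_cases h : n * i' + j' = n * i + j
      · obtain ⟨rfl, rfl⟩ := cell_inj hj2 hj' h
        refine ⟨l, hl', hon, ?_⟩
        simp (disch := omega) [h1.2, hn1, hi1, hl1, hs1.codeA, Nat.mod_eq_of_lt]
      · obtain ⟨l2, hl2, e1, e2⟩ := hc i' hi2 j' hj2
        refine ⟨l2, hl2, (hoff _ h).trans e1, ?_⟩
        simp [h1.2, Function.update_of_ne h, hCC, e2]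
    · by_cases h : n * i' + j' = n * i + j
      · rw [h, hon]; exact hb'.le
      · exact (hoff _ h).ge
  · have hs : ∀ c, prodVal (Program.step w ω .skip s1) c = prodVal s c := by
      intro c
      simp [prodVal, hFC, hRC]
    refine ⟨fun i' hi2 j' hj2 => ?_, fun i' hi2 j' hj2 => (hs _).ge, ?_⟩
    · obtain ⟨l2, hl2, e1, e2⟩ := hc i' hi2 j' hj2
      refine ⟨l2, hl2, (hs _).trans e1, ?_⟩
      simp only [Program.step, hCC, e2]
    · rw [hs]; exact not_lt.1 hb'

/-- The members of group `g` among the first `y` elements. -/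
def members (L : ℕ → List ℕ) (g y : ℕ) : List ℕ := (List.range y).filter fun e => g ∈ L e

theorem members_succ (L : ℕ → List ℕ) (g y : ℕ) :
    members L g (y + 1) = members L g y ++ if g ∈ L y then [y] else [] := by
  rw [members, List.range_succ, List.filter_append, ← members]
  by_cases h : g ∈ L y <;> simp [h]

theorem members_length {L : ℕ → List ℕ} {N g y : ℕ} (hL : ∀ e < N, (L e).Nodup) (hy : y ≤ N) :
    (members L g y).length = occ L id y g := by
  induction y with
  | zero => simp [members, occ]
  | succ y ih =>
    rw [members_succ, List.length_append, ih (by omega), occ, occ, Finset.sum_range_succ]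
    by_cases h : g ∈ L y
    · simp [h, List.count_eq_one_of_mem (hL y (by omega)) h]
    · simp [h, List.count_eq_zero_of_not_mem h]

theorem mem_members {L : ℕ → List ℕ} {g y e : ℕ} : e ∈ members L g y ↔ e < y ∧ g ∈ L e := by
  simp [members]

/-- Inside the outer step of `e`, a bucket already contains `e` if its group is among the part of `L
e` that has been read. -/
theorem emitReds_runs {s : State} {n N lo hi top W : ℕ} {L : ℕ → List ℕ} {D : ℕ → ℕ → Prop}
    (hnN : n ≤ N) (hfam : IsFamily n N L lo hi D W) (hs : HoldsGroups s L N lo hi top)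
    (hn : s.var vNum = n) (hoff : ∀ g, lo ≤ g → g < hi →
      s.arr aOff g = offset L N lo hi g ∧ s.arr aCount g = 0)
    (hw : 2 * (hi + W + N + 2) < 2 ^ w) (htop : top + 1 < 2 ^ w) :
    Runs w ω emitReds s (W * 40 + n * 40 + 20) fun s' => s'.var vIdx = n ∧ ∀ g, lo ≤ g → g < hi →
      s'.arr aCount g = (members L g n).length ∧
      slice (s'.arr aSlot) (offset L N lo hi g) (offset L N lo hi g + s'.arr aCount g)
        = members L g n := by
  have hid : ∀ e < N, id e < N ∧ id (id e) = e := fun e he => ⟨he, rfl⟩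
  have hle := hfam.le
  have hhi2W : offset L N lo hi hi ≤ hi + W := by
    have := hfam.sum_groupSize_le
    rw [offset]; omega
  have hlen : ∑ e ∈ Finset.range n, (L e).length ≤ W :=
    (Finset.sum_le_sum_of_subset (Finset.range_subset_range.2 hnN)).trans hfam.sum_length_le
  have hslot : ∀ e < N, ∀ g ∈ L e, (members L g e).length < groupSize L N g ∧
      offset L N lo hi g + groupSize L N g ≤ hi + W := by
    intro e he g hg
    have hgr := hfam.mem_range _ he g hg
    have hb := offset_mono (L := L) (N := N) (lo := lo) (hi := hi) (Nat.succ_le_of_lt hgr.2)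
    rw [Nat.succ_eq_add_one, offset_succ hgr.1] at hb
    rw [members_length hfam.nodup he.le]
    exact ⟨occ_lt hid hid he hg, by omega⟩
  have hmem_le : ∀ y ≤ N, ∀ g, (members L g y).length ≤ groupSize L N g := by
    intro y hy g
    rw [members_length hfam.nodup hy]
    exact Finset.sum_le_sum_of_subset (Finset.range_subset_range.2 hy)
  refine (Runs.seq (T := 2) (Q := fun s' => s'.var vIdx = 0)
    ((Runs.of_loopFree rfl (by simp)).mono (by decide) fun _ _ h => h)
    fun s1 h1 hf1 => Runs.loop n (fun y s' => s'.var vIdx = y ∧ ∀ g, lo ≤ g → g < hi →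
      s'.arr aCount g = (members L g y).length ∧
      slice (s'.arr aSlot) (offset L N lo hi g) (offset L N lo hi g + s'.arr aCount g)
        = members L g y) (fun y => (L y).length * 40 + 30) ⟨h1, ?_⟩ ?_ ?_).mono ?_
      fun _ _ h => h
  · intro g hg hg'
    rw [hf1.arr _ (by decide), (hoff g hg hg').2]
    simp [members, slice_self]
  · rintro e he s2 ⟨k1, k2⟩ hf2
    have ev : ∀ x, x ∉ emitReds.modVars → s2.var x = s.var x := fun x hx =>
      (hf1.seq_left.trans (hf2.mono (q := emitReds) (by decide) (by decide) (by decide)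
        (by decide))).var x hx
    have ea : ∀ x, x ∉ emitReds.modArrs → s2.arr x = s.arr x := fun x hx =>
      (hf1.seq_left.trans (hf2.mono (q := emitReds) (by decide) (by decide) (by decide)
        (by decide))).arr x hx
    have hn2 : s2.var vNum = n := by rw [ev _ (by decide), hn]
    have heN : e < N := by omega
    have hst := hs.stop_le e heN
    have hse := hs.start_le e heN
    have hl := hs.list e heN
    have hlen : (L e).length = s.arr aStop e - s.arr aStart e := by rw [← hl, slice_length]
    refine ⟨by simp only [Test.Holds, IntExpr.eval, k1, hn2]; omega, ?_⟩
    refine (Runs.seq (T := 6) (Q := fun s' => s'.var vPtr = s.arr aStart e)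
      ((Runs.of_loopFree rfl (by simp [k1, ea aStart (by decide)])).mono (by decide) fun _ _ h => h)
      fun s3 h3 hf3 => Runs.seq (Runs.loop_const (L e).length (fun x s' =>
        s'.var vPtr = s.arr aStart e + x ∧ ∀ g, lo ≤ g → g < hi →
        s'.arr aCount g = (members L g e ++ if g ∈ (L e).take x then [e] else []).length ∧
        slice (s'.arr aSlot) (offset L N lo hi g) (offset L N lo hi g + s'.arr aCount g)
          = members L g e ++ if g ∈ (L e).take x then [e] else []) 30 ⟨by simpa using h3, ?_⟩ ?_ ?_)
        (T' := 6) fun s4 h4 hf4 => (Runs.of_loopFree rfl ?_).mono (by decide) fun _ _ h => h).mono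
        ?_ fun _ _ h => h
    · intro g hg hg'
      rw [hf3.arr _ (by decide), hf3.arr _ (by decide)]
      simpa using k2 g hg hg'
    · rintro x hx s4 ⟨m1, m2⟩ hf4
      have ev4 : ∀ x, x ∉ emitRed.modVars → s4.var x = s2.var x := fun x hx =>
        (hf3.seq_left.trans (hf4.mono (q := emitRed) (by decide) (by decide) (by decide)
          (by decide))).var x hx
      have ea4 : ∀ x, x ∉ emitReds.modArrs → s4.arr x = s.arr x := fun x hx => by
        rw [← ea x hx]
        exact ((hf3.mono (q := emitReds) (by decide) (by decide) (by decide) (by decide)).trans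
          (hf4.mono (by decide) (by decide) (by decide) (by decide))).arr x hx
      have hi4 : s4.var vIdx = e := by
        rw [hf4.var _ (by decide), hf3.var _ (by decide), k1]
      have hfin : s4.arr aStop = s.arr aStop := ea4 _ (by decide)
      have hoff4 : s4.arr aOff = s.arr aOff := ea4 _ (by decide)
      have hgx : s4.arr aPool (s.arr aStart e + x) = (L e)[x] := by
        rw [ea4 _ (by decide)]
        exact slice_getElem hl hx
      have hgm : (L e)[x] ∈ L e := List.getElem_mem hx
      obtain ⟨g1, g2⟩ := hfam.mem_range e heN _ hgm
      have hnt : (L e)[x] ∉ (L e).take x :=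
        List.count_eq_zero.1 (count_take_of_nodup (hfam.nodup e heN) hx)
      have hsl := hslot e heN _ hgm
      have hcx := (m2 _ g1 g2).1
      rw [if_neg hnt, List.append_nil] at hcx
      have hox : s4.arr aOff (L e)[x] = offset L N lo hi (L e)[x] := by
        rw [hoff4, (hoff _ g1 g2).1]
      refine ⟨by simp only [Test.Holds, IntExpr.eval, hi4, m1, hfin]; omega, ?_⟩
      refine (Runs.of_loopFree rfl ?_).mono (by decide) fun _ _ h => h
      have hstep : emitRedStep.step w ω s4 = (((s4.setVar vGrp (L e)[x]).setArr aSlot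
          (offset L N lo hi (L e)[x] + (members L (L e)[x] e).length) e).setArr aCount (L e)[x]
          ((members L (L e)[x] e).length + 1)).setVar vPtr (s.arr aStart e + x + 1) := by
        simp (disch := omega) [emitRedStep, m1, hgx, hox, hcx, hi4, Nat.mod_eq_of_lt]
      rw [hstep]
      refine ⟨by simp [add_assoc], fun g hg hg' => ?_⟩
      simp only [State.arr_setVar, State.arr_setArr, reduceIte, Nat.reduceEqDiff]
      by_cases hgg : g = (L e)[x]
      · subst hgg
        rw [Function.update_self, if_pos (by
            rw [List.take_succ_eq_append_getElem hx, List.mem_append]; exact Or.inr (by simp)),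
          ← add_assoc, slice_concat _ (by omega), Function.update_self,
          slice_congr (B := s4.arr aSlot) (fun y _ hy => Function.update_of_ne (by omega) _ _),
          ← hcx, (m2 _ g1 g2).2, if_neg hnt]
        simp [hcx]
      · have hiff : g ∈ (L e).take (x + 1) ↔ g ∈ (L e).take x := by
          rw [List.take_succ_eq_append_getElem hx, List.mem_append, List.mem_singleton]
          simp only [hgg, or_false]
        simp only [hiff]
        rw [Function.update_of_ne hgg]
        obtain ⟨q1, q2⟩ := m2 g hg hg'
        refine ⟨q1, ?_⟩
        rw [← q2]
        refine slice_congr fun y hy hy' => Function.update_of_ne (fun hc => ?_) _ _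
        -- A bucket never outgrows its segment, so writing to the bucket of another group cannot
        -- change it.
        have hle2 : s4.arr aCount g ≤ groupSize L N g := by
          refine le_trans ?_ (hmem_le (e + 1) (by omega) g)
          rw [q1, members_succ, List.length_append, List.length_append]
          by_cases hgt : g ∈ (L e).take x
          · rw [if_pos hgt, if_pos (List.mem_of_mem_take hgt)]
          · rw [if_neg hgt]; simp
        exact hgg (offset_add_inj (c := y - offset L N lo hi g) hg g1 (by omega) hsl.1
          (by rw [← hc]; omega)).1
    · rintro s4 ⟨m1, -⟩ hf4
      have hi4 : s4.var vIdx = e := by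
        rw [hf4.var _ (by decide), hf3.var _ (by decide), k1]
      have hfin : s4.arr aStop = s.arr aStop := by
        rw [hf4.arr _ (by decide), hf3.arr _ (by decide), ea _ (by decide)]
      simp only [Test.Holds, IntExpr.eval, hi4, m1, hfin]; omega
    · have hi4 : s4.var vIdx = e := by
        rw [hf4.var _ (by decide), hf3.var _ (by decide), k1]
      refine ⟨by simp (disch := omega) [hi4, Nat.mod_eq_of_lt], fun g hg hg' => ?_⟩
      rw [members_succ]
      simpa using h4.2 g hg hg'
    · simp only [Test.cost, IntExpr.cost]; omega
  · rintro s2 ⟨k1, -⟩ hf2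
    have hn2 : s2.var vNum = n := by
      rw [hf2.var _ (by decide), hf1.var _ (by decide), hn]
    simp only [Test.Holds, IntExpr.eval, k1, hn2]; omega
  · have e1 : ∑ y ∈ Finset.range n, ((L y).length * 40 + 30 + (Test.lt (.var vIdx) (.var vNum)).cost + 1)
        = (∑ y ∈ Finset.range n, (L y).length) * 40 + n * 34 := by
      simp only [add_assoc, Test.cost, IntExpr.cost]
      rw [Finset.sum_add_distrib, ← Finset.sum_mul]
      simp
    rw [e1]
    simp only [Test.cost, IntExpr.cost]
    omega

end WordRAM


/-! ### Visiting the related pairs. -/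

namespace WordRAM
open Dominance

variable {w : ℕ} {ω : ℕ → Bool}

/-- The values in the product matrix do not decrease. -/
def Improves (n : ℕ) (s s' : State) : Prop :=
  ∀ i < n, ∀ j < n, prodVal s (n * i + j) ≤ prodVal s' (n * i + j)

theorem Improves.trans {n : ℕ} {s s' s'' : State} (h : Improves n s s') (h' : Improves n s' s'') :
    Improves n s s'' := fun i hi j hj => (h i hi j hj).trans (h' i hi j hj)

theorem prodVal_congr {s s' : State} (h : s'.arr aFlagC = s.arr aFlagC) (h' : s'.real rC = s.real rC)
    (c : ℕ) : prodVal s' c = prodVal s c := by rw [prodVal, prodVal, h, h']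

theorem Improves.of_frame {p : Program} {s s' : State} (hf : Frame p s s')
    (ha : aFlagC ∉ p.modArrs) (hr : rC ∉ p.modReals) (n : ℕ) : Improves n s s' :=
  fun _ _ _ _ => (prodVal_congr (hf.arr _ ha) (hf.real _ hr) _).ge

theorem IsCandidate.of_frame {p : Program} {n : ℕ} {s₀ s s' : State} (h : IsCandidate n s₀ s)
    (hf : Frame p s s') (ha : aFlagC ∉ p.modArrs ∧ aCodeC ∉ p.modArrs) (hr : rC ∉ p.modReals) :
    IsCandidate n s₀ s' := by
  intro i hi j hj
  rw [prodVal_congr (hf.arr _ ha.1) (hf.real _ hr), hf.arr _ ha.2]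
  exact h i hi j hj

theorem HoldsGroups.of_frame {p : Program} {s s' : State} {L : ℕ → List ℕ} {N lo hi top : ℕ}
    (h : HoldsGroups s L N lo hi top) (hf : Frame p s s')
    (hv : vGrpLo ∉ p.modVars ∧ vGrpHi ∉ p.modVars ∧ vTop ∉ p.modVars)
    (ha : aPool ∉ p.modArrs ∧ aStart ∉ p.modArrs ∧ aStop ∉ p.modArrs ∧ aSize ∉ p.modArrs) :
    HoldsGroups s' L N lo hi top := by
  have h1 := hf.arr _ ha.1
  have h2 := hf.arr _ ha.2.1
  have h3 := hf.arr _ ha.2.2.1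
  have h4 := hf.arr _ ha.2.2.2
  exact ⟨(hf.var _ hv.1).trans h.lo_eq, (hf.var _ hv.2.1).trans h.hi_eq,
    (hf.var _ hv.2.2).trans h.top_eq, by rw [h1, h2, h3]; exact h.list,
    by rw [h2, h3]; exact h.start_le, by rw [h3]; exact h.stop_le, by rw [h4]; exact h.size⟩

theorem emitBlueStep_runs {s s₀ : State} {n j l g o : ℕ} {M : List ℕ} (hn : s.var vNum = n)
    (hj : s.var vCol = j) (hl : s.var vMid = l) (hj' : j < n) (hl' : l < n)
    (hg : s.arr aPool (s.var vPtr) = g) (ho : s.arr aOff g = o) (hM : s.arr aCount g = M.length)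
    (hslot : slice (s.arr aSlot) o (o + M.length) = M) (hMn : ∀ i ∈ M, i < n)
    (hw : n * n < 2 ^ w) (how : o + M.length + 1 < 2 ^ w) (hp : s.var vPtr + 1 < 2 ^ w)
    (hsame : SameFactors s₀ s) (hb : FactorBound n w s₀) (hc : IsCandidate n s₀ s) :
    Runs w ω emitBlueStep s (M.length * 150 + 40) fun s' => s'.var vPtr = s.var vPtr + 1 ∧
      IsCandidate n s₀ s' ∧ Improves n s s' ∧
      ∀ i ∈ M, pathVal n s₀ i l j ≤ prodVal s' (n * i + j) := by
  refine (Runs.seq (T := 20) (Q := fun s' => s'.var vPos = o ∧ s'.var vQuo = o + M.length)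
    ((Runs.of_loopFree rfl (by simp (disch := omega) [hg, ho, hM, Nat.mod_eq_of_lt])).mono
      (by decide) fun _ _ h => h)
    fun s1 h1 hf1 => Runs.seq (Runs.loop_const M.length (fun x s' => s'.var vPos = o + x ∧
      IsCandidate n s₀ s' ∧ Improves n s s' ∧
      ∀ i ∈ M.take x, pathVal n s₀ i l j ≤ prodVal s' (n * i + j)) 140
      ⟨h1.1, hc.of_frame hf1 (by decide) (by decide), .of_frame hf1 (by decide) (by decide) n,
        by simp⟩ ?_ ?_)
      (T' := 6) fun s2 h2 hf2 => (Runs.of_loopFree rfl ?_).mono (by decide) fun _ _ h => h).mono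
      ?_ fun _ _ h => h
  · rintro x hx s2 ⟨k1, k2, k3, k4⟩ hf2
    have hn2 : s2.var vNum = n := ((hf2.var _ (by decide)).trans (hf1.var _ (by decide))).trans hn
    have hj2 : s2.var vCol = j := ((hf2.var _ (by decide)).trans (hf1.var _ (by decide))).trans hj
    have hl2 : s2.var vMid = l := ((hf2.var _ (by decide)).trans (hf1.var _ (by decide))).trans hl
    have hq2 : s2.var vQuo = o + M.length := (hf2.var _ (by decide)).trans h1.2
    have hs2 : s2.arr aSlot (o + x) = M[x] := by
      rw [hf2.arr _ (by decide), hf1.arr _ (by decide)]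
      exact slice_getElem hslot hx
    refine ⟨by simp only [Test.Holds, IntExpr.eval, k1, hq2]; omega, ?_⟩
    refine (Runs.seq (T := 4) (Q := fun s' => s'.var vRow = M[x])
      ((Runs.of_loopFree rfl (by simp [k1, hs2])).mono (by decide) fun _ _ h => h)
      fun s3 h3 hf3 => Runs.seq (updateCell_runs (s := s3) (s₀ := s₀) (n := n) (i := M[x]) (j := j)
        (l := l) ((hf3.var _ (by decide)).trans hn2) h3 ((hf3.var _ (by decide)).trans hj2)
        ((hf3.var _ (by decide)).trans hl2) (hMn _ (List.getElem_mem hx)) hj' hl' hw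
        (((hsame.of_frame hf1 (by decide) (by decide)).of_frame hf2 (by decide) (by decide)).of_frame
          hf3 (by decide) (by decide)) hb (k2.of_frame hf3 (by decide) (by decide)))
        (T' := 6) fun s4 h4 hf4 => (Runs.of_loopFree rfl ?_).mono (by decide) fun _ _ h => h).mono
        (by omega) fun _ _ h => h
    obtain ⟨m1, m2, m3⟩ := h4
    have hp4 : s4.var vPos = o + x := by
      rw [hf4.var _ (by decide), hf3.var _ (by decide), k1]
    have hF : Frame (.assign vPos (.add (.var vPos) (.const 1))) s4
        (Program.step w ω (.assign vPos (.add (.var vPos) (.const 1))) s4) := by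
      obtain ⟨t, ht, -⟩ := Exec.of_loopFree (w := w) (ω := ω)
        (p := .assign vPos (.add (.var vPos) (.const 1))) rfl s4
      exact .of_exec ht
    have hI3 : Improves n s2 s3 := .of_frame hf3 (by decide) (by decide) n
    have hI4 : Improves n s4 _ := .of_frame hF (by decide) (by decide) n
    refine ⟨by simp (disch := omega) [hp4, Nat.mod_eq_of_lt, add_assoc],
      m1.of_frame hF (by decide) (by decide), ((k3.trans hI3).trans m2).trans hI4, ?_⟩
    intro i hi
    rw [List.take_succ_eq_append_getElem hx, List.mem_append, List.mem_singleton] at hi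
    have hin : i < n := by
      rcases hi with hi | rfl
      · exact hMn _ (List.mem_of_mem_take hi)
      · exact hMn _ (List.getElem_mem hx)
    refine le_trans ?_ (hI4 i hin j hj')
    rcases hi with hi | rfl
    · exact (k4 i hi).trans ((hI3.trans m2) i hin j hj')
    · exact m3
  · rintro s2 ⟨k1, -⟩ hf2
    have hq2 : s2.var vQuo = o + M.length := (hf2.var _ (by decide)).trans h1.2
    simp only [Test.Holds, IntExpr.eval, k1, hq2]; omega
  · obtain ⟨-, k2, k3, k4⟩ := h2
    rw [List.take_length] at k4
    have hp2 : s2.var vPtr = s.var vPtr := by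
      rw [hf2.var _ (by decide), hf1.var _ (by decide)]
    have hF : Frame (.assign vPtr (.add (.var vPtr) (.const 1))) s2
        (Program.step w ω (.assign vPtr (.add (.var vPtr) (.const 1))) s2) := by
      obtain ⟨t, ht, -⟩ := Exec.of_loopFree (w := w) (ω := ω)
        (p := .assign vPtr (.add (.var vPtr) (.const 1))) rfl s2
      exact .of_exec ht
    have hI : Improves n s2 _ := .of_frame hF (by decide) (by decide) n
    exact ⟨by simp (disch := omega) [hp2, Nat.mod_eq_of_lt], k2.of_frame hF (by decide) (by decide),
      k3.trans hI, fun i hi => (k4 i hi).trans (hI i (hMn i hi) j hj')⟩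
  · simp only [Test.cost, IntExpr.cost]; omega

/-- The rule for loops wants a cost for every index; the default `0` of `getD` is never used. -/
theorem sum_getD (l : List ℕ) (f : ℕ → ℕ) :
    ∑ x ∈ Finset.range l.length, f (l.getD x 0) = (l.map f).sum := by
  induction l with
  | nil => simp
  | cons a l ih =>
    rw [List.length_cons, Finset.sum_range_succ', List.map_cons, List.sum_cons, ← ih, add_comm]
    simp

open Classical in
/-- The number of red elements that are related to `e`. -/
noncomputable def relatedCount (n : ℕ) (D : ℕ → ℕ → Prop) (e : ℕ) : ℕ :=
  ((Finset.range n).filter fun i => D i e).card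

/-- By `IsFamily.unique` no red element occurs in two buckets of the same blue element. So the time
of the reporting is proportional to the number of related pairs, not merely to the sizes of the
groups. -/
theorem sum_members_length_le {n N lo hi W : ℕ} {L : ℕ → List ℕ} {D : ℕ → ℕ → Prop}
    (hfam : IsFamily n N L lo hi D W) {e : ℕ} (he : n ≤ e) (heN : e < N) :
    ((L e).map fun g => (members L g n).length).sum ≤ relatedCount n D e := by
  classical
  rw [← List.length_flatMap, relatedCount]
  have hnd : ((L e).flatMap fun g => members L g n).Nodup := by
    rw [List.nodup_flatMap]
    refine ⟨fun g _ => List.Nodup.filter _ List.nodup_range, (hfam.nodup e heN).imp_of_mem ?_⟩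
    intro g g' hg hg' hne i hi hi'
    rw [mem_members] at hi hi'
    exact hne (hfam.unique i hi.1 e he heN g g' hi.2 hg hi'.2 hg')
  rw [← List.toFinset_card_of_nodup hnd]
  refine Finset.card_le_card fun i hi => ?_
  simp only [List.mem_toFinset, List.mem_flatMap, mem_members] at hi
  obtain ⟨g, hg, hi, hgi⟩ := hi
  exact Finset.mem_filter.2 ⟨Finset.mem_range.2 hi, (hfam.common i hi e he heN).1 ⟨g, hgi, hg⟩⟩

theorem emitBlues_runs {s s₀ : State} {n N l lo hi top W : ℕ} {L : ℕ → List ℕ} {D : ℕ → ℕ → Prop}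
    (hnN : N = n + n) (hfam : IsFamily n N L lo hi D W) (hs : HoldsGroups s L N lo hi top)
    (hn : s.var vNum = n) (hN : s.var vElts = N) (hl : s.var vMid = l) (hl' : l < n)
    (hidx : s.var vIdx = n)
    (hoff : ∀ g, lo ≤ g → g < hi → s.arr aOff g = offset L N lo hi g)
    (hmem : ∀ g, lo ≤ g → g < hi → s.arr aCount g = (members L g n).length ∧
      slice (s.arr aSlot) (offset L N lo hi g) (offset L N lo hi g + s.arr aCount g)
        = members L g n)
    (hw : 2 * (hi + W + N + 2) < 2 ^ w) (htop : top + 1 < 2 ^ w) (hnn : n * n < 2 ^ w)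
    (hsame : SameFactors s₀ s) (hb : FactorBound n w s₀) (hc : IsCandidate n s₀ s) :
    Runs w ω emitBlues s (W * 60 + n * 60 + (∑ j ∈ Finset.range n, relatedCount n D (n + j)) * 150 + 4)
      fun s' => IsCandidate n s₀ s' ∧ Improves n s s' ∧
      ∀ i < n, ∀ j < n, D i (n + j) → pathVal n s₀ i l j ≤ prodVal s' (n * i + j) := by
  have hhi2W : offset L N lo hi hi ≤ hi + W := by
    have := hfam.sum_groupSize_le
    rw [offset]; omega
  have hlensum : ∑ j ∈ Finset.range n, (L (n + j)).length ≤ W := by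
    have h1 := hfam.sum_length_le
    rw [hnN, Finset.sum_range_add] at h1
    omega
  refine (Runs.loop n (fun y s' => s'.var vIdx = n + y ∧ IsCandidate n s₀ s' ∧ Improves n s s' ∧
      ∀ j < y, ∀ i < n, D i (n + j) → pathVal n s₀ i l j ≤ prodVal s' (n * i + j))
      (fun y => (L (n + y)).length * 60 + 40 + relatedCount n D (n + y) * 150)
      ⟨hidx, hc, fun _ _ _ _ => le_rfl, fun _ h => absurd h (Nat.not_lt_zero _)⟩ ?_ ?_).mono ?_ ?_
  · rintro j hj s1 ⟨k1, k2, k3, k4⟩ hf1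
    have hs1 := hs.of_frame hf1 (by decide) (by decide)
    have hn1 : s1.var vNum = n := (hf1.var _ (by decide)).trans hn
    have hN1 : s1.var vElts = N := (hf1.var _ (by decide)).trans hN
    have hl1 : s1.var vMid = l := (hf1.var _ (by decide)).trans hl
    have heN : n + j < N := by omega
    have hst := hs1.stop_le _ heN
    have hse := hs1.start_le _ heN
    have hlist := hs1.list _ heN
    have hlen : (L (n + j)).length = s1.arr aStop (n + j) - s1.arr aStart (n + j) := by
      rw [← hlist, slice_length]
    refine ⟨by simp only [Test.Holds, IntExpr.eval, k1, hN1]; omega, ?_⟩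
    refine (Runs.seq (T := 12) (Q := fun s' => s'.var vCol = j ∧
        s'.var vPtr = s1.arr aStart (n + j)) ((Runs.of_loopFree rfl ?_).mono (by decide)
        fun _ _ h => h) fun s2 h2 hf2 => Runs.seq (Runs.loop (L (n + j)).length (fun x s' =>
        s'.var vPtr = s1.arr aStart (n + j) + x ∧ IsCandidate n s₀ s' ∧ Improves n s1 s' ∧
        ∀ g ∈ (L (n + j)).take x, ∀ i ∈ members L g n,
          pathVal n s₀ i l j ≤ prodVal s' (n * i + j))
        (fun x => (members L ((L (n + j)).getD x 0) n).length * 150 + 40) ⟨h2.2,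
          k2.of_frame hf2 (by decide) (by decide), .of_frame hf2 (by decide) (by decide) n, by simp⟩
          ?_ ?_)
        (T' := 6) fun s3 h3 hf3 => (Runs.of_loopFree rfl ?_).mono (by decide) fun _ _ h => h).mono ?_
        fun _ _ h => h
    · simp (disch := omega) [k1, hn1, Nat.mod_eq_of_lt]
    · rintro x hx s3 ⟨m1, m2, m3, m4⟩ hf3
      have hs3 := (hs1.of_frame hf2 (by decide) (by decide)).of_frame hf3 (by decide) (by decide)
      have hi3 : s3.var vIdx = n + j := by
        rw [hf3.var _ (by decide), hf2.var _ (by decide), k1]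
      have hfin : s3.arr aStop = s1.arr aStop := by
        rw [hf3.arr _ (by decide), hf2.arr _ (by decide)]
      have hgm : (L (n + j))[x] ∈ L (n + j) := List.getElem_mem hx
      obtain ⟨g1, g2⟩ := hfam.mem_range _ heN _ hgm
      have ea : ∀ x, x ∉ emitBlues.modArrs → s3.arr x = s.arr x := fun x hx =>
        ((Frame.trans (hf1.mono (q := emitBlues) (by decide) (by decide) (by decide) (by decide))
          (hf2.mono (by decide) (by decide) (by decide) (by decide))).trans
          (hf3.mono (by decide) (by decide) (by decide) (by decide))).arr x hx
      obtain ⟨q1, q2⟩ := hmem _ g1 g2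
      have hgx : s3.arr aPool (s3.var vPtr) = (L (n + j))[x] := by
        rw [m1]
        have := slice_getElem (A := s1.arr aPool) hlist hx
        rw [hf3.arr _ (by decide), hf2.arr _ (by decide), this]
      have hoM : offset L N lo hi (L (n + j))[x] + (members L (L (n + j))[x] n).length ≤ hi + W := by
        have hb := offset_mono (L := L) (N := N) (lo := lo) (hi := hi) (Nat.succ_le_of_lt g2)
        rw [Nat.succ_eq_add_one, offset_succ g1] at hb
        have : (members L (L (n + j))[x] n).length ≤ groupSize L N (L (n + j))[x] := by
          rw [members_length hfam.nodup (by omega)]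
          exact Finset.sum_le_sum_of_subset (Finset.range_subset_range.2 (by omega))
        omega
      refine ⟨by simp only [Test.Holds, IntExpr.eval, hi3, m1, hfin]; omega, ?_⟩
      refine (emitBlueStep_runs (s := s3) (s₀ := s₀) (n := n) (j := j) (l := l)
        (o := offset L N lo hi (L (n + j))[x]) (M := members L (L (n + j))[x] n) ?_ ?_ ?_ hj hl' hgx ?_ ?_ ?_
        (fun i hi => (mem_members.1 hi).1) hnn (by omega) (by omega) ?_ hb m2).mono ?_ ?_
      · rw [hf3.var _ (by decide), hf2.var _ (by decide), hn1]
      · rw [hf3.var _ (by decide), h2.1]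
      · rw [hf3.var _ (by decide), hf2.var _ (by decide), hl1]
      · rw [ea _ (by decide), hoff _ g1 g2]
      · rw [ea _ (by decide), q1]
      · rw [ea _ (by decide), ← q1, q2]
      · exact ((hsame.of_frame hf1 (by decide) (by decide)).of_frame hf2 (by decide)
          (by decide)).of_frame hf3 (by decide) (by decide)
      · rw [List.getD_eq_getElem _ _ hx]
      · rintro s4 - ⟨r1, r2, r3, r4⟩
        refine ⟨by rw [r1, m1, add_assoc], r2, m3.trans r3, fun g hg i hi => ?_⟩
        rw [List.take_succ_eq_append_getElem hx, List.mem_append, List.mem_singleton] at hg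
        rcases hg with hg | rfl
        · exact (m4 g hg i hi).trans (r3 i (mem_members.1 hi).1 j hj)
        · exact r4 i hi
    · rintro s3 ⟨m1, -⟩ hf3
      have hi3 : s3.var vIdx = n + j := by
        rw [hf3.var _ (by decide), hf2.var _ (by decide), k1]
      have hfin : s3.arr aStop = s1.arr aStop := by
        rw [hf3.arr _ (by decide), hf2.arr _ (by decide)]
      simp only [Test.Holds, IntExpr.eval, hi3, m1, hfin]; omega
    · obtain ⟨-, m2, m3, m4⟩ := h3
      rw [List.take_length] at m4
      have hi3 : s3.var vIdx = n + j := by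
        rw [hf3.var _ (by decide), hf2.var _ (by decide), k1]
      have hF : Frame (.assign vIdx (.add (.var vIdx) (.const 1))) s3
          (Program.step w ω (.assign vIdx (.add (.var vIdx) (.const 1))) s3) := by
        obtain ⟨t, ht, -⟩ := Exec.of_loopFree (w := w) (ω := ω)
          (p := .assign vIdx (.add (.var vIdx) (.const 1))) rfl s3
        exact .of_exec ht
      have hI : Improves n s3 _ := .of_frame hF (by decide) (by decide) n
      refine ⟨by simp (disch := omega) [hi3, Nat.mod_eq_of_lt, add_assoc],
        m2.of_frame hF (by decide) (by decide), (k3.trans m3).trans hI, fun j' hj' i hi hD => ?_⟩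
      rcases Nat.lt_succ_iff_lt_or_eq.1 hj' with hlt | rfl
      · exact (k4 j' hlt i hi hD).trans ((m3.trans hI) i hi j' (by omega))
      · obtain ⟨g, hgi, hge⟩ := (hfam.common i hi _ (by omega) heN).2 hD
        exact (m4 g hge i (mem_members.2 ⟨hi, hgi⟩)).trans (hI i hi j' hj)
    · have e1 : ∑ x ∈ Finset.range (L (n + j)).length, ((members L ((L (n + j)).getD x 0) n).length
          * 150 + 40 + (Test.lt (.var vPtr) (.get aStop (.var vIdx))).cost + 1)
          = ((L (n + j)).map fun g => (members L g n).length).sum * 150 + (L (n + j)).length * 45 := by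
        rw [← sum_getD]
        simp only [add_assoc, Test.cost, IntExpr.cost]
        rw [Finset.sum_add_distrib, ← Finset.sum_mul]
        simp
      have e2 := Nat.mul_le_mul_right 150 (sum_members_length_le hfam (by omega) heN)
      rw [e1]
      simp only [Test.cost, IntExpr.cost]
      omega
  · rintro s1 ⟨k1, -⟩ hf1
    have hN1 : s1.var vElts = N := (hf1.var _ (by decide)).trans hN
    simp only [Test.Holds, IntExpr.eval, k1, hN1]; omega
  · have e1 : ∑ y ∈ Finset.range n, ((L (n + y)).length * 60 + 40 + relatedCount n D (n + y) * 150
        + (Test.lt (.var vIdx) (.var vElts)).cost + 1)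
        = (∑ y ∈ Finset.range n, (L (n + y)).length) * 60
          + (∑ y ∈ Finset.range n, relatedCount n D (n + y)) * 150 + n * 44 := by
      rw [Finset.sum_mul, Finset.sum_mul, ← Finset.sum_add_distrib]
      have : n * 44 = ∑ y ∈ Finset.range n, 44 := by simp
      rw [this, ← Finset.sum_add_distrib]
      refine Finset.sum_congr rfl fun y _ => ?_
      simp only [Test.cost, IntExpr.cost]
      omega
    rw [e1]
    simp only [Test.cost, IntExpr.cost]
    omega
  · rintro s1 - ⟨-, k2, k3, k4⟩
    exact ⟨k2, k3, fun i hi j hj hD => k4 j hj i hi hD⟩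

/-- Here `initOffsets` is reused only to lay out the buckets and to reset the counters. -/
theorem emitPairs_runs {s s₀ : State} {n N l lo hi top W : ℕ} {L : ℕ → List ℕ} {D : ℕ → ℕ → Prop}
    (hnN : N = n + n) (hfam : IsFamily n N L lo hi D W) (hs : HoldsGroups s L N lo hi top)
    (hn : s.var vNum = n) (hN : s.var vElts = N) (hl : s.var vMid = l) (hl' : l < n)
    (hw : 2 * (hi + W + N + 2) < 2 ^ w) (htop : top + 1 < 2 ^ w) (hnn : n * n < 2 ^ w)
    (hsame : SameFactors s₀ s) (hb : FactorBound n w s₀) (hc : IsCandidate n s₀ s) :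
    Runs w ω emitPairs s
      (W * 130 + n * 100 + (∑ j ∈ Finset.range n, relatedCount n D (n + j)) * 150 + 50)
      fun s' => IsCandidate n s₀ s' ∧ Improves n s s' ∧
      ∀ i < n, ∀ j < n, D i (n + j) → pathVal n s₀ i l j ≤ prodVal s' (n * i + j) := by
  have hhi2W : offset L N lo hi hi ≤ hi + W := by
    have := hfam.sum_groupSize_le
    rw [offset]; omega
  have hcard := hfam.card_le
  refine (Runs.seq (initOffsets_runs hs.lo_eq hs.hi_eq hfam.le hs.size (by omega))
    fun s1 h1 hf1 => Runs.seq (emitReds_runs (n := n) (W := W) (by omega) hfam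
      (hs.of_frame hf1 (by decide) (by decide)) ((hf1.var _ (by decide)).trans hn) h1.2.2 hw
      htop) fun s2 h2 hf2 => (emitBlues_runs (s₀ := s₀) (l := l) hnN hfam
        ((hs.of_frame hf1 (by decide) (by decide)).of_frame hf2 (by decide) (by decide)) ?_ ?_ ?_ hl'
        h2.1 ?_ h2.2 hw htop hnn ?_ hb ?_).mono le_rfl
        (Q' := fun s' => IsCandidate n s₀ s' ∧ Improves n s s' ∧
          ∀ i < n, ∀ j < n, D i (n + j) → pathVal n s₀ i l j ≤ prodVal s' (n * i + j)) ?_).mono ?_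
        fun _ _ h => h
  · rw [hf2.var _ (by decide), hf1.var _ (by decide), hn]
  · rw [hf2.var _ (by decide), hf1.var _ (by decide), hN]
  · rw [hf2.var _ (by decide), hf1.var _ (by decide), hl]
  · intro g hg hg'
    rw [hf2.arr _ (by decide), (h1.2.2 g hg hg').1]
  · exact (hsame.of_frame hf1 (by decide) (by decide)).of_frame hf2 (by decide) (by decide)
  · exact (hc.of_frame hf1 (by decide) (by decide)).of_frame hf2 (by decide) (by decide)
  · rintro s3 - ⟨k1, k2, k3⟩
    exact ⟨k1, ((Improves.of_frame hf1 (by decide) (by decide) n).trans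
      (.of_frame hf2 (by decide) (by decide) n)).trans k2, k3⟩
  · omega

end WordRAM


namespace WordRAM
open Dominance

/-! ### The keys of one comparison -/

/-- Fredman's trick: `A i l' + B l' j < A i l + B l j` means `A i l' - A i l < B l j - B l' j`,
where the left side depends on the row and the right side on the column. Subtraction of reals is not
available, so both terms of a difference are stored. The third key breaks ties: `0` or `2` for rows
against `1` for columns puts the row first exactly if `l < l'`. -/
def setRedKey : Program :=
  .store aKeyPos (.var vIdx) (.get aFlagA (.add (.mul (.var vNum) (.var vIdx)) (.var vAlt))) ;;
  .store aKeyNeg (.var vIdx) (.get aFlagA (.add (.mul (.var vNum) (.var vIdx)) (.var vMid))) ;;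
  .realStore rKeyPos (.var vIdx) (.get rA (.add (.mul (.var vNum) (.var vIdx)) (.var vAlt))) ;;
  .realStore rKeyNeg (.var vIdx) (.get rA (.add (.mul (.var vNum) (.var vIdx)) (.var vMid))) ;;
  .ite (.lt (.var vMid) (.var vAlt)) (.store aKeyTie (.var vIdx) (.const 0))
    (.store aKeyTie (.var vIdx) (.const 2))

def setBlueKey : Program :=
  .assign vCol (.sub (.var vIdx) (.var vNum)) ;;
  .store aKeyPos (.var vIdx) (.get aFlagB (.add (.mul (.var vNum) (.var vMid)) (.var vCol))) ;;
  .store aKeyNeg (.var vIdx) (.get aFlagB (.add (.mul (.var vNum) (.var vAlt)) (.var vCol))) ;;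
  .realStore rKeyPos (.var vIdx) (.get rWt (.add (.mul (.var vNum) (.var vMid)) (.var vCol))) ;;
  .realStore rKeyNeg (.var vIdx) (.get rWt (.add (.mul (.var vNum) (.var vAlt)) (.var vCol))) ;;
  .store aKeyTie (.var vIdx) (.const 1)

def setKey : Program :=
  .ite (.lt (.var vIdx) (.var vNum)) setRedKey setBlueKey ;;
  .store aOrd (.var vIdx) (.var vIdx) ;;
  .assign vIdx (.add (.var vIdx) (.const 1))

def initKeys : Program :=
  .assign vIdx (.const 0) ;; .while (.lt (.var vIdx) (.var vElts)) setKey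

variable {w : ℕ} {ω : ℕ → Bool}

/-- The state holds the keys of element `e` for the comparison of `l` with `l'`. -/
structure HoldsKey (n : ℕ) (s₀ : State) (l l' : ℕ) (s : State) (e : ℕ) : Prop where
  ord : s.arr aOrd e = e
  bound : 2 * s.arr aKeyPos e < 2 ^ w ∧ 2 * s.arr aKeyNeg e < 2 ^ w
  red : e < n →
    cellVal (s.arr aKeyPos) (s.real rKeyPos) e = cellVal (s₀.arr aFlagA) (s₀.real rA) (n * e + l') ∧
    cellVal (s.arr aKeyNeg) (s.real rKeyNeg) e = cellVal (s₀.arr aFlagA) (s₀.real rA) (n * e + l) ∧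
    s.arr aKeyTie e = if l < l' then 0 else 2
  blue : ∀ j, e = n + j →
    cellVal (s.arr aKeyPos) (s.real rKeyPos) e = cellVal (s₀.arr aFlagB) (s₀.real rWt) (n * l + j) ∧
    cellVal (s.arr aKeyNeg) (s.real rKeyNeg) e = cellVal (s₀.arr aFlagB) (s₀.real rWt) (n * l' + j) ∧
    s.arr aKeyTie e = 1

theorem HoldsKey.congr {n l l' e : ℕ} {s₀ s s' : State} (h : HoldsKey (w := w) n s₀ l l' s e)
    (h1 : s'.arr aOrd e = s.arr aOrd e) (h2 : s'.arr aKeyPos e = s.arr aKeyPos e)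
    (h3 : s'.arr aKeyNeg e = s.arr aKeyNeg e) (h4 : s'.arr aKeyTie e = s.arr aKeyTie e)
    (h5 : s'.real rKeyPos e = s.real rKeyPos e) (h6 : s'.real rKeyNeg e = s.real rKeyNeg e) :
    HoldsKey (w := w) n s₀ l l' s' e := by
  obtain ⟨a1, a2, a3, a4⟩ := h
  simp only [cellVal] at a3 a4
  constructor
  · rw [h1, a1]
  · rw [h2, h3]; exact a2
  · simp only [cellVal, h2, h3, h4, h5, h6]; exact a3
  · simp only [cellVal, h2, h3, h4, h5, h6]; exact a4

theorem initKeys_runs {s s₀ : State} {n N l l' : ℕ} (hnN : N = n + n) (hn : s.var vNum = n)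
    (hN : s.var vElts = N) (hl : s.var vMid = l) (hl' : s.var vAlt = l') (hln : l < n) (hln' : l' < n)
    (hw : 2 * N + 2 < 2 ^ w) (hnn : n * n < 2 ^ w) (hsame : SameFactors s₀ s)
    (hb : FactorBound n w s₀) :
    Runs w ω initKeys s (N * 100 + 10) fun s' => ∀ e < N, HoldsKey (w := w) n s₀ l l' s' e := by
  refine (Runs.seq (T := 2) (Q := fun s' => s'.var vIdx = 0)
    ((Runs.of_loopFree rfl (by simp)).mono (by decide) fun _ _ h => h)
    fun s1 h1 hf1 => Runs.loop_const N (fun y s' => s'.var vIdx = y ∧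
      ∀ e < y, HoldsKey (w := w) n s₀ l l' s' e) 90 ⟨h1, by simp⟩ ?_ ?_).mono ?_ fun _ _ h => h.2
  · rintro e he s2 ⟨k1, k2⟩ hf2
    have hn2 : s2.var vNum = n := ((hf2.var _ (by decide)).trans (hf1.var _ (by decide))).trans hn
    have hN2 : s2.var vElts = N := ((hf2.var _ (by decide)).trans (hf1.var _ (by decide))).trans hN
    have hl2 : s2.var vMid = l := ((hf2.var _ (by decide)).trans (hf1.var _ (by decide))).trans hl
    have hl2' : s2.var vAlt = l' := ((hf2.var _ (by decide)).trans (hf1.var _ (by decide))).trans hl'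
    have hs2 := (hsame.of_frame hf1 (by decide) (by decide)).of_frame hf2 (by decide) (by decide)
    refine ⟨by simp only [Test.Holds, IntExpr.eval, k1, hN2]; omega, ?_⟩
    refine (Runs.of_loopFree rfl ?_).mono (by decide) fun _ _ h => h
    by_cases her : e < n
    · have c1 := cell_lt her hln
      have c2 := cell_lt her hln'
      have hstep : setKey.step w ω s2 = (((((((s2.setArr aKeyPos e (s₀.arr aFlagA (n * e + l'))).setArr
          aKeyNeg e (s₀.arr aFlagA (n * e + l))).setReal rKeyPos e (s₀.real rA (n * e + l'))).setReal
          rKeyNeg e (s₀.real rA (n * e + l))).setArr aKeyTie e (if l < l' then 0 else 2)).setArr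
          aOrd e e).setVar vIdx (e + 1)) := by
        by_cases hll : l < l' <;>
        simp (disch := omega) [setKey, setRedKey, k1, hn2, hl2, hl2', her, hll, hs2.flagA, hs2.realA,
          Nat.mod_eq_of_lt]
      rw [hstep]
      refine ⟨by simp, fun e' he' => ?_⟩
      rcases Nat.lt_succ_iff_lt_or_eq.1 he' with hlt | rfl
      · have hne : e' ≠ e := by omega
        exact (k2 e' hlt).congr (by simp [hne]) (by simp [hne]) (by simp [hne]) (by simp [hne])
          (by simp [hne]) (by simp [hne])
      · refine ⟨by simp, by simpa using ⟨hb.flagA e' her l' hln', hb.flagA e' her l hln⟩,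
          fun _ => by simp [cellVal], fun j hj => by omega⟩
    · obtain ⟨j, rfl⟩ := Nat.exists_eq_add_of_le (not_lt.1 her)
      have hj : j < n := by omega
      have c1 := cell_lt hln hj
      have c2 := cell_lt hln' hj
      have hstep : setKey.step w ω s2 = ((((((((s2.setVar vCol j).setArr aKeyPos (n + j)
          (s₀.arr aFlagB (n * l + j))).setArr
          aKeyNeg (n + j) (s₀.arr aFlagB (n * l' + j))).setReal rKeyPos (n + j)
          (s₀.real rWt (n * l + j))).setReal
          rKeyNeg (n + j) (s₀.real rWt (n * l' + j))).setArr aKeyTie (n + j) 1).setArr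
          aOrd (n + j) (n + j)).setVar vIdx (n + j + 1)) := by
        simp (disch := omega) [setKey, setBlueKey, k1, hn2, hl2, hl2', hs2.flagB, hs2.realB,
          Nat.mod_eq_of_lt]
      rw [hstep]
      refine ⟨by simp, fun e' he' => ?_⟩
      rcases Nat.lt_succ_iff_lt_or_eq.1 he' with hlt | rfl
      · have hne : e' ≠ n + j := by omega
        exact (k2 e' hlt).congr (by simp [hne]) (by simp [hne]) (by simp [hne]) (by simp [hne])
          (by simp [hne]) (by simp [hne])
      · refine ⟨by simp, by simpa using ⟨hb.flagB l hln j hj, hb.flagB l' hln' j hj⟩,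
          fun h => by omega, fun j' hj' => ?_⟩
        obtain rfl : j = j' := by omega
        simp [cellVal]
  · rintro s2 ⟨k1, -⟩ hf2
    have hN2 : s2.var vElts = N := ((hf2.var _ (by decide)).trans (hf1.var _ (by decide))).trans hN
    simp only [Test.Holds, IntExpr.eval, k1, hN2]; omega
  · simp only [Test.cost, IntExpr.cost]; omega

/-- The sort key of an element. -/
noncomputable def sortKey (s : State) (e : ℕ) : (ℤ ×ₗ ℝ) ×ₗ ℕ :=
  toLex (cellVal (s.arr aKeyPos) (s.real rKeyPos) e - cellVal (s.arr aKeyNeg) (s.real rKeyNeg) e,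
    s.arr aKeyTie e)

open Classical in
/-- The order by sort keys. -/
noncomputable def sortLe (s : State) (e f : ℕ) : Bool := decide (sortKey s e ≤ sortKey s f)

/-- In the ordered group `ℤ ×ₗ ℝ` the subtrahends can be moved across, which turns a comparison of
differences into one of sums. -/
theorem keyLe_holds {s : State} {e f : IntExpr}
    (hw1 : s.arr aKeyPos (e.eval w s) + s.arr aKeyNeg (f.eval w s) < 2 ^ w)
    (hw2 : s.arr aKeyPos (f.eval w s) + s.arr aKeyNeg (e.eval w s) < 2 ^ w) :
    (keyLe e f).Holds w s ↔ sortKey s (e.eval w s) ≤ sortKey s (f.eval w s) := by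
  rw [sortKey, sortKey, Prod.Lex.toLex_le_toLex, sub_lt_sub_iff, sub_eq_sub_iff_add_eq_add]
  simp only [keyLe, Test.Holds, IntExpr.eval, RealExpr.eval, Nat.mod_eq_of_lt hw1,
    Nat.mod_eq_of_lt hw2, cellVal, ← toLex_add, Prod.mk_add_mk, Prod.Lex.toLex_lt_toLex,
    toLex_inj, Prod.mk.injEq, ← Nat.cast_add, Nat.cast_lt, Nat.cast_inj, not_le, not_lt]
  constructor
  · rintro (h | ⟨h1, h2, h3 | h3⟩)
    · exact Or.inl (Or.inl h)
    · exact Or.inl (Or.inr ⟨h1, h3⟩)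
    · rcases h2.lt_or_eq with h2 | h2
      · exact Or.inl (Or.inr ⟨h1, h2⟩)
      · exact Or.inr ⟨⟨h1, h2⟩, h3⟩
  · rintro ((h | ⟨h1, h2⟩) | ⟨⟨h1, h2⟩, h3⟩)
    · exact Or.inl h
    · exact Or.inr ⟨h1, h2.le, Or.inl h2⟩
    · exact Or.inr ⟨h1, h2.le, Or.inr h3⟩

/-- Of the paths from `i` to `j`, the one over `l` is better than the one over `l'`; ties are broken in
favour of the smaller midpoint. -/
def Beats (n : ℕ) (s₀ : State) (l l' i j : ℕ) : Prop :=
  pathVal n s₀ i l' j < pathVal n s₀ i l j ∨ pathVal n s₀ i l' j = pathVal n s₀ i l j ∧ l < l'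

/-- A surjection of a finite set onto itself is injective, so a choice of preimages is a two-sided
inverse. -/
theorem exists_pos_of_perm {N : ℕ} {A : ℕ → ℕ} (h : (slice A 0 N).Perm (List.range N)) :
    ∃ pos : ℕ → ℕ, (∀ e < N, pos e < N ∧ A (pos e) = e) ∧ ∀ q < N, A q < N ∧ pos (A q) = q := by
  have h1 : ∀ q < N, A q < N := fun q hq =>
    List.mem_range.1 (h.subset (mem_slice.2 ⟨q, by omega, hq, rfl⟩))
  have h2 : ∀ e, ∃ q, e < N → q < N ∧ A q = e := by
    intro e
    by_cases he : e < N
    · obtain ⟨q, -, hq, e'⟩ := mem_slice.1 (h.symm.subset (List.mem_range.2 he))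
      exact ⟨q, fun _ => ⟨hq, e'⟩⟩
    · exact ⟨0, fun h => absurd h he⟩
  choose pos hpos using h2
  have hinj : Set.InjOn A (Finset.range N) := by
    refine Finset.injOn_of_surjOn_of_card_le A (t := Finset.range N) ?_ ?_ le_rfl
    · intro q hq; simpa using h1 q (by simpa using hq)
    · intro e he
      obtain ⟨q1, q2⟩ := hpos e (by simpa using he)
      exact ⟨pos e, by simpa using q1, q2⟩
  refine ⟨pos, hpos, fun q hq => ⟨h1 q hq, ?_⟩⟩
  obtain ⟨q1, q2⟩ := hpos (A q) (h1 q hq)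
  exact hinj (by simpa using q1) (by simpa using hq) q2

theorem pairwise_slice {R : ℕ → ℕ → Prop} {N : ℕ} {A : ℕ → ℕ} (h : (slice A 0 N).Pairwise R)
    {q q' : ℕ} (hq : q < q') (hq' : q' < N) : R (A q) (A q') := by
  rw [List.pairwise_iff_getElem] at h
  have := h q q' (by rw [slice_length]; omega) (by rw [slice_length]; omega) hq
  simpa [slice] using this

/-- Rows and columns never have equal keys, since their third keys differ. Their relative order in
the sorted list is therefore forced, and by the choice of the keys it says which midpoint is better.
-/
theorem keySort_runs {s s₀ : State} {n N l l' : ℕ} (hnN : N = n + n) (hn : s.var vNum = n)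
    (hN : s.var vElts = N) (hl : s.var vMid = l) (hl' : s.var vAlt = l') (hln : l < n) (hln' : l' < n)
    (hw : 4 * N + 4 < 2 ^ w) (hnn : n * n < 2 ^ w) (hsame : SameFactors s₀ s)
    (hb : FactorBound n w s₀) :
    Runs w ω (initKeys ;; mergeSort) s (Nat.clog 2 N * (N * 480 + 60) + N * 100 + 30) fun s' =>
      ∃ pos : ℕ → ℕ, (∀ e < N, pos e < N ∧ s'.arr aOrd (pos e) = e) ∧
        (∀ q < N, s'.arr aOrd q < N ∧ pos (s'.arr aOrd q) = q) ∧
        ∀ i < n, ∀ j < n, (pos i < pos (n + j) ↔ Beats n s₀ l l' i j) := by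
  refine (Runs.seq (initKeys_runs hnN hn hN hl hl' hln hln' (by omega) hnn hsame hb)
    fun s1 h1 hf1 => (mergeSort_runs (w := w) (N := N) (le := sortLe s1) (by omega) (by omega) ?_ ?_ ?_
      (fun q hq => (h1 q hq).ord) ((hf1.var _ (by decide)).trans hN)).mono le_rfl ?_).mono (by omega)
      fun _ _ h => h
  · intro a b c hab hbc
    simp only [sortLe, decide_eq_true_eq] at *
    exact hab.trans hbc
  · intro a b
    simp only [sortLe, Bool.or_eq_true, decide_eq_true_eq]
    exact le_total _ _
  · intro s' hf e f he hf'
    have hp : s'.arr aKeyPos = s1.arr aKeyPos := hf.arr _ (by decide)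
    have hq : s'.arr aKeyNeg = s1.arr aKeyNeg := hf.arr _ (by decide)
    have ht : s'.arr aKeyTie = s1.arr aKeyTie := hf.arr _ (by decide)
    have hr : s'.real = s1.real := funext fun x => hf.real x (by simp [Program.modReals, mergeSort,
      mergePass, copyBack, mergeRun, mergeSetup, mergeLoop, mergeStep])
    have b1 := (h1 _ he).bound
    have b2 := (h1 _ hf').bound
    rw [keyLe_holds (by rw [hp, hq]; omega) (by rw [hp, hq]; omega), sortLe, decide_eq_true_eq,
      sortKey, sortKey, sortKey, sortKey, hp, hq, ht, hr]
  · rintro s2 hf2 ⟨hperm, hsorted⟩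
    obtain ⟨pos, hpos, hpos'⟩ := exists_pos_of_perm hperm
    refine ⟨pos, hpos, hpos', fun i hi j hj => ?_⟩
    have hle : ∀ e < N, ∀ f < N, pos e < pos f → sortKey s1 e ≤ sortKey s1 f := by
      intro e he f hf h
      have := pairwise_slice hsorted h (hpos f hf).1
      rw [(hpos e he).2, (hpos f hf).2] at this
      simpa [sortLe] using this
    have hlt : sortKey s1 i < sortKey s1 (n + j) ↔ Beats n s₀ l l' i j := by
      obtain ⟨r1, r2, r3⟩ := (h1 i (by omega)).red hi
      obtain ⟨b1, b2, b3⟩ := (h1 (n + j) (by omega)).blue j rfl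
      rw [sortKey, sortKey, Prod.Lex.toLex_lt_toLex, r1, r2, r3, b1, b2, b3, Beats, pathVal, pathVal,
        sub_lt_sub_iff, sub_eq_sub_iff_add_eq_add]
      by_cases hll : l < l' <;> simp [hll, add_comm (cellVal (s₀.arr aFlagB) _ (n * l + j))]
    have hne : sortKey s1 i ≠ sortKey s1 (n + j) := by
      obtain ⟨r1, r2, r3⟩ := (h1 i (by omega)).red hi
      obtain ⟨b1, b2, b3⟩ := (h1 (n + j) (by omega)).blue j rfl
      intro h
      have := congrArg (fun x => (ofLex x).2) h
      simp only [sortKey, ofLex_toLex, r3, b3] at this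
      split at this <;> omega
    rw [← hlt]
    constructor
    · exact fun h => lt_of_le_of_ne (hle _ (by omega) _ (by omega) h) hne
    · intro h
      by_contra hc
      rcases (not_lt.1 hc).lt_or_eq with h' | h'
      · exact absurd (hle _ (by omega) _ (by omega) h') (not_le.2 h)
      · have e1 := (hpos i (by omega)).2
        rw [← h', (hpos (n + j) (by omega)).2] at e1
        omega

end WordRAM


namespace Dominance

theorem IsFamily.congr {n N lo hi W W' : ℕ} {L : ℕ → List ℕ} {D D' : ℕ → ℕ → Prop}
    (h : IsFamily n N L lo hi D W) (hD : ∀ i < n, ∀ j, n ≤ j → j < N → (D i j ↔ D' i j))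
    (hW : W ≤ W') : IsFamily n N L lo hi D' W' :=
  ⟨h.le, h.mem_range, h.nodup, fun i hi j hj hj' => (h.common i hi j hj hj').trans (hD i hi j hj hj'),
    h.unique, h.weight.trans hW⟩

end Dominance

namespace WordRAM
open Dominance

/-! ### All comparisons of one midpoint -/

/-- The midpoint is not compared with itself; that index leaves the groups as they are. -/
def refineDim : Program :=
  .ite (.eq (.var vAlt) (.var vMid)) .skip ((initKeys ;; mergeSort) ;; refineGroups) ;;
  .assign vAlt (.add (.var vAlt) (.const 1))

def refineDims : Program :=
  .assign vAlt (.var vLo) ;; .while (.lt (.var vAlt) (.var vHi)) refineDim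

def initGroups : Program :=
  .assign vElt (.const 0) ;;
  .while (.lt (.var vElt) (.var vElts))
    (.store aStart (.var vElt) (.const 0) ;;
     .store aStop (.var vElt) (.const 1) ;;
     .assign vElt (.add (.var vElt) (.const 1))) ;;
  .store aPool (.const 0) (.const 0) ;;
  .store aSize (.const 0) (.var vElts) ;;
  .assign vGrpLo (.const 0) ;;
  .assign vGrpHi (.const 1) ;;
  .assign vTop (.const 1)

def processMid : Program :=
  initGroups ;; refineDims ;; emitPairs

variable {w : ℕ} {ω : ℕ → Bool}

theorem initGroups_runs {s : State} {N : ℕ} (hN : s.var vElts = N) (hw : N + 2 < 2 ^ w) :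
    Runs w ω initGroups s (N * 20 + 30) fun s' =>
      HoldsGroups s' (fun _ => [0]) N 0 1 1 := by
  refine (Runs.seq (T := 2) (Q := fun s' => s'.var vElt = 0)
    ((Runs.of_loopFree rfl (by simp)).mono (by decide) fun _ _ h => h)
    fun s1 h1 hf1 => Runs.seq (Runs.loop_const N (fun y s' => s'.var vElt = y ∧
      ∀ e < y, s'.arr aStart e = 0 ∧ s'.arr aStop e = 1) 12 ⟨h1, by simp⟩ ?_ ?_)
      (T' := 15) fun s2 h2 hf2 => (Runs.of_loopFree rfl ?_).mono (by decide) fun _ _ h => h).mono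
      ?_ fun _ _ h => h
  · rintro e he s2 ⟨k1, k2⟩ hf2
    have hN2 : s2.var vElts = N := ((hf2.var _ (by decide)).trans (hf1.var _ (by decide))).trans hN
    refine ⟨by simp only [Test.Holds, IntExpr.eval, k1, hN2]; omega, ?_⟩
    refine (Runs.of_loopFree rfl ?_).mono (by decide) fun _ _ h => h
    simp (disch := omega) only [Program.step, IntExpr.eval, k1, Nat.mod_eq_of_lt, State.var_setVar,
      State.var_setArr, if_true, State.arr_setVar, State.arr_setArr, reduceIte, Nat.reduceEqDiff,
      true_and]
    intro e' he'
    rcases Nat.lt_succ_iff_lt_or_eq.1 he' with hlt | rfl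
    · simpa [hlt.ne] using k2 e' hlt
    · simp
  · rintro s2 ⟨k1, -⟩ hf2
    have hN2 : s2.var vElts = N := ((hf2.var _ (by decide)).trans (hf1.var _ (by decide))).trans hN
    simp only [Test.Holds, IntExpr.eval, k1, hN2]; omega
  · have hN2 : s2.var vElts = N := ((hf2.var _ (by decide)).trans (hf1.var _ (by decide))).trans hN
    obtain ⟨k1, k2⟩ := h2
    constructor
    · simp
    · simp (disch := omega) [Nat.mod_eq_of_lt]
    · simp (disch := omega) [Nat.mod_eq_of_lt]
    · intro e he
      simp [(k2 e he).1, (k2 e he).2, slice, Nat.mod_eq_of_lt (show 1 < 2 ^ w by omega)]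
    · intro e he
      simp [(k2 e he).1, (k2 e he).2]
    · intro e he
      simp [(k2 e he).2]
    · intro g _ hg
      obtain rfl : g = 0 := by omega
      simp [groupSize, hN2]
  · simp only [Test.cost, IntExpr.cost]; omega

/-- Of the paths from `i` to `e - n`, the one over `l` beats those over the first `y` other
midpoints from `l₀` on. -/
def BeatsFirst (n : ℕ) (s₀ : State) (l l₀ y i e : ℕ) : Prop :=
  ∀ l', l₀ ≤ l' → l' < l₀ + y → l' ≠ l → Beats n s₀ l l' i (e - n)

/-- The state after the first `y` comparisons of a midpoint. -/
structure HoldsDims (n N E : ℕ) (s₀ : State) (l l₀ y : ℕ) (s : State) (L : ℕ → List ℕ)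
    (lo hi : ℕ) : Prop where
  fam : IsFamily n N L lo hi (BeatsFirst n s₀ l l₀ y) (3 ^ y * 3 ^ Nat.clog 2 N)
  groups : HoldsGroups s L N lo hi (s.var vTop)
  hi_le : hi ≤ 1 + y * E
  top_le : s.var vTop ≤ 1 + y * E

theorem HoldsDims.of_frame {p : Program} {n N E l l₀ y lo hi : ℕ} {s₀ s s' : State} {L : ℕ → List ℕ}
    (h : HoldsDims n N E s₀ l l₀ y s L lo hi) (hf : Frame p s s')
    (hv : vGrpLo ∉ p.modVars ∧ vGrpHi ∉ p.modVars ∧ vTop ∉ p.modVars)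
    (ha : aPool ∉ p.modArrs ∧ aStart ∉ p.modArrs ∧ aStop ∉ p.modArrs ∧ aSize ∉ p.modArrs) :
    HoldsDims n N E s₀ l l₀ y s' L lo hi :=
  ⟨h.fam, by rw [hf.var _ hv.2.2]; exact h.groups.of_frame hf hv ha, h.hi_le,
    by rw [hf.var _ hv.2.2]; exact h.top_le⟩

theorem beatsFirst_succ {n l l₀ y i e : ℕ} {s₀ : State} :
    BeatsFirst n s₀ l l₀ (y + 1) i e ↔
      BeatsFirst n s₀ l l₀ y i e ∧ (l₀ + y ≠ l → Beats n s₀ l (l₀ + y) i (e - n)) := by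
  constructor
  · exact fun h => ⟨fun l' h1 h2 h3 => h l' h1 (by omega) h3, fun h3 => h _ (by omega) (by omega) h3⟩
  · rintro ⟨h, h'⟩ l' h1 h2 h3
    by_cases h4 : l' < l₀ + y
    · exact h l' h1 h4 h3
    · obtain rfl : l' = l₀ + y := by omega
      exact h' h3

/-- `E` bounds the weight after the step. It also bounds the new names and the new pool entries; old
ones are not reclaimed, so after `y` steps both counters are at most `1 + y * E`. -/
theorem refineDim_runs {s s₀ : State} {n N d E l l₀ y lo hi : ℕ} {L : ℕ → List ℕ} (hnN : N = n + n)
    (hn : s.var vNum = n) (hN : s.var vElts = N) (hl : s.var vMid = l) (hy : s.var vAlt = l₀ + y)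
    (hln : l < n) (hyn : l₀ + y < n) (hyd : y < d) (hE : 3 ^ (y + 1) * 3 ^ Nat.clog 2 N ≤ E)
    (hw : 2 * ((d + 1) * E) + 4 * N + 20 < 2 ^ w) (hnn : n * n < 2 ^ w)
    (hsame : SameFactors s₀ s) (hb : FactorBound n w s₀)
    (hs : HoldsDims n N E s₀ l l₀ y s L lo hi) :
    Runs w ω refineDim s (E * (Nat.clog 2 N * 700 + 700)) fun s' =>
      s'.var vAlt = l₀ + (y + 1) ∧ ∃ L lo hi, HoldsDims n N E s₀ l l₀ (y + 1) s' L lo hi := by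
  have hNE : N ≤ 3 ^ y * 3 ^ Nat.clog 2 N :=
    (le_three_pow_clog N).trans (Nat.le_mul_of_pos_left _ (by positivity))
  have hyE : (y + 1) * E ≤ d * E := Nat.mul_le_mul_right _ hyd
  obtain ⟨hfam, hgr, hhi, htop⟩ := hs
  -- `W` is the weight bound before the step and `3 * W` the one after it.
  obtain ⟨W, hW⟩ : ∃ W, 3 ^ y * 3 ^ Nat.clog 2 N = W := ⟨_, rfl⟩
  have hpow1 : 3 ^ (y + 1) * 3 ^ Nat.clog 2 N = 3 * W := by rw [← hW]; ring
  rw [hpow1] at hE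
  rw [hW] at hNE hfam
  rw [add_mul, one_mul] at hw hyE
  have hEpos : 0 < E := by
    have : 0 < W := by rw [← hW]; positivity
    omega
  have hsucc : (y + 1) * E = y * E + E := by ring
  refine (Runs.seq (T := E * (Nat.clog 2 N * 700 + 640)) (Q := fun s' => s'.var vAlt = l₀ + y ∧
      ∃ L lo hi, HoldsDims n N E s₀ l l₀ (y + 1) s' L lo hi)
    ((Runs.ite (T := E * (Nat.clog 2 N * 700 + 630)) (fun htest => ?_) fun htest => ?_).mono ?_
      fun _ _ h => h)
    fun s1 h1 hf1 => (Runs.of_loopFree rfl ?_).mono (show _ ≤ 10 by decide) fun _ _ h => h).mono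
    ?_ fun _ _ h => h
  · have hyl : l₀ + y = l := by simpa [hy, hl] using htest
    refine (Runs.of_loopFree rfl ?_).mono (le_trans (show _ ≤ 1 by decide) ?_) fun _ _ h => h
    · refine ⟨hy, L, lo, hi, hfam.congr (fun i _ j _ _ => ?_) (by omega), hgr, ?_, ?_⟩
      · rw [beatsFirst_succ]; simp [hyl]
      · omega
      · simp only [Program.step]; omega
    · exact Nat.mul_pos hEpos (by omega)
  · have hyl : l₀ + y ≠ l := by simpa [hy, hl] using htest
    refine (Runs.seq (keySort_runs hnN hn hN hl hy hln hyn (by omega) hnn hsame hb)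
      fun s1 ⟨pos, hpos, hpos', hbeat⟩ hf1 => (refineGroups_runs (ord := s1.arr aOrd) hpos hpos'
        (n := n) (by omega) hfam
        (hgr.of_frame hf1 (by decide) (by decide)) ((hf1.var _ (by decide)).trans hn)
        ((hf1.var _ (by decide)).trans hN) (fun q _ => rfl) (by omega) (by omega)).mono le_rfl
        (Q' := fun s' => ∃ L lo hi, HoldsDims n N E s₀ l l₀ (y + 1) s' L lo hi) ?_).mono ?_
        (Q' := fun s' => s'.var vAlt = l₀ + y ∧
          ∃ L lo hi, HoldsDims n N E s₀ l l₀ (y + 1) s' L lo hi)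
        fun s' hf h => ⟨(hf.var _ (by decide)).trans hy, h⟩
    · rintro s2 hf2 ⟨k1, k2⟩
      have hfam' := (hfam.split hpos hpos' (by omega)).congr
        (D' := BeatsFirst n s₀ l l₀ (y + 1)) (W' := 3 * W) (fun i hi j hj hj' => ?_) le_rfl
      · refine ⟨_, _, _, by rw [hpow1]; exact hfam', k1, ?_, ?_⟩
        · have := hfam'.card_le
          omega
        · omega
      · obtain ⟨j, rfl⟩ := Nat.exists_eq_add_of_le hj
        rw [beatsFirst_succ, hbeat i hi j (by omega)]
        simp [hyl]
    · have h1 : W * (Nat.clog 2 N * 70 + 200) ≤ E * (Nat.clog 2 N * 70 + 200) :=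
        Nat.mul_le_mul_right _ (by omega)
      have h2 : Nat.clog 2 N * (N * 480 + 60) ≤ Nat.clog 2 N * (E * 480 + E * 60) :=
        Nat.mul_le_mul_left _ (by omega)
      nlinarith
  · simp only [Test.cost, IntExpr.cost]
    nlinarith
  · obtain ⟨k1, L, lo, hi, k2⟩ := h1
    have hf := Frame.of_exec (Exec.of_loopFree (w := w) (ω := ω)
      (p := .assign vAlt (.add (.var vAlt) (.const 1))) rfl s1).choose_spec.1
    refine ⟨?_, L, lo, hi, k2.of_frame hf (by decide) (by decide)⟩
    simp (disch := omega) [k1, Nat.mod_eq_of_lt, add_assoc]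
  · nlinarith

theorem refineDims_runs {s s₀ : State} {n N d m E l l₀ : ℕ} (hnN : N = n + n)
    (hn : s.var vNum = n) (hN : s.var vElts = N) (hl : s.var vMid = l) (hlo : s.var vLo = l₀)
    (hhi : s.var vHi = l₀ + m) (hln : l < n) (hmn : l₀ + m ≤ n) (hmd : m ≤ d)
    (hE : 3 ^ d * 3 ^ Nat.clog 2 N ≤ E)
    (hw : 2 * ((d + 1) * E) + 4 * N + 20 < 2 ^ w) (hnn : n * n < 2 ^ w)
    (hsame : SameFactors s₀ s) (hb : FactorBound n w s₀)
    (hs : HoldsGroups s (fun _ => [0]) N 0 1 1) :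
    Runs w ω refineDims s (d * (E * (Nat.clog 2 N * 700 + 710)) + 10) fun s' =>
      ∃ L lo hi, HoldsDims n N E s₀ l l₀ m s' L lo hi := by
  have hE1 : 0 < E := lt_of_lt_of_le (by positivity) hE
  refine (Runs.seq (T := 2) (Q := fun s' => s'.var vAlt = l₀)
    ((Runs.of_loopFree rfl (by simp [hlo])).mono (by decide) fun _ _ h => h)
    fun s1 h1 hf1 => Runs.loop_const m (fun y s' => s'.var vAlt = l₀ + y ∧
      ∃ L lo hi, HoldsDims n N E s₀ l l₀ y s' L lo hi) (E * (Nat.clog 2 N * 700 + 700))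
      ⟨h1, (fun _ => [0]), 0, 1, ?_⟩ ?_ ?_).mono ?_ fun _ _ h => h.2
  · have hs1 := hs.of_frame hf1 (by decide) (by decide)
    have htop := hs1.top_eq
    refine ⟨(isFamily_init n N).congr (fun i _ j _ _ => ?_) (by simp), by rwa [htop], by simp,
      by simp [htop]⟩
    simp only [BeatsFirst, true_iff]
    intro l' _ _; omega
  · rintro y hy s2 ⟨k1, L, lo, hi, k2⟩ hf2
    have hhi2 : s2.var vHi = l₀ + m := ((hf2.var _ (by decide)).trans (hf1.var _ (by decide))).trans hhi
    refine ⟨by simp only [Test.Holds, IntExpr.eval, k1, hhi2]; omega, ?_⟩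
    exact refineDim_runs (d := d) hnN
      (((hf2.var _ (by decide)).trans (hf1.var _ (by decide))).trans hn)
      (((hf2.var _ (by decide)).trans (hf1.var _ (by decide))).trans hN)
      (((hf2.var _ (by decide)).trans (hf1.var _ (by decide))).trans hl) k1 hln (by omega) (by omega)
      ((Nat.mul_le_mul_right _ (Nat.pow_le_pow_right (by norm_num) (by omega))).trans hE) hw hnn
      ((hsame.of_frame hf1 (by decide) (by decide)).of_frame hf2 (by decide) (by decide)) hb k2
  · rintro s2 ⟨k1, -⟩ hf2
    have hhi2 : s2.var vHi = l₀ + m := ((hf2.var _ (by decide)).trans (hf1.var _ (by decide))).trans hhi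
    simp only [Test.Holds, IntExpr.eval, k1, hhi2]; omega
  · have h2 : m * (E * (Nat.clog 2 N * 700 + 700) + (Test.lt (.var vAlt) (.var vHi)).cost + 1)
        ≤ d * (E * (Nat.clog 2 N * 700 + 710)) := by
      refine Nat.mul_le_mul hmd ?_
      simp only [Test.cost, IntExpr.cost]
      nlinarith
    simp only [Test.cost, IntExpr.cost] at h2 ⊢
    omega

/-- Two kinds of cost are kept apart: the comparisons, bounded through `E` for each midpoint, and
the reported pairs, which are only bounded after summation over the block. -/
theorem processMid_runs {s s₀ : State} {n N d m E l l₀ : ℕ} (hnN : N = n + n)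
    (hn : s.var vNum = n) (hN : s.var vElts = N) (hl : s.var vMid = l) (hlo : s.var vLo = l₀)
    (hhi : s.var vHi = l₀ + m) (hln : l < n) (hmn : l₀ + m ≤ n) (hmd : m ≤ d)
    (hE : 3 ^ d * 3 ^ Nat.clog 2 N ≤ E)
    (hw : 2 * ((d + 2) * E) + 4 * N + 20 < 2 ^ w) (hnn : n * n < 2 ^ w)
    (hsame : SameFactors s₀ s) (hb : FactorBound n w s₀) (hc : IsCandidate n s₀ s) :
    Runs w ω processMid s ((d + 1) * (E * (Nat.clog 2 N * 700 + 1100)) +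
      (∑ j ∈ Finset.range n, relatedCount n (BeatsFirst n s₀ l l₀ m) (n + j)) * 150) fun s' =>
      IsCandidate n s₀ s' ∧ Improves n s s' ∧
      ∀ i < n, ∀ j < n, BeatsFirst n s₀ l l₀ m i (n + j) →
        pathVal n s₀ i l j ≤ prodVal s' (n * i + j) := by
  have hE1 : 0 < E := lt_of_lt_of_le (by positivity) hE
  have hNE : N ≤ E := (le_three_pow_clog N).trans
    ((Nat.le_mul_of_pos_left _ (by positivity)).trans hE)
  have hWE : 3 ^ m * 3 ^ Nat.clog 2 N ≤ E :=
    (Nat.mul_le_mul_right _ (Nat.pow_le_pow_right (by norm_num) hmd)).trans hE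
  have hmE : m * E ≤ d * E := Nat.mul_le_mul_right _ hmd
  have hw' : 2 * ((d + 1) * E) + 2 * E + 4 * N + 20 < 2 ^ w := by linarith
  refine (Runs.seq (initGroups_runs hN (by omega)) fun s1 h1 hf1 => Runs.seq
    (refineDims_runs (d := d) hnN ((hf1.var _ (by decide)).trans hn) ((hf1.var _ (by decide)).trans hN)
      ((hf1.var _ (by decide)).trans hl) ((hf1.var _ (by decide)).trans hlo)
      ((hf1.var _ (by decide)).trans hhi) hln hmn hmd hE (by omega) hnn
      (hsame.of_frame hf1 (by decide) (by decide)) hb h1)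
    (T' := E * 130 + n * 100 +
      (∑ j ∈ Finset.range n, relatedCount n (BeatsFirst n s₀ l l₀ m) (n + j)) * 150 + 50)
    fun s2 ⟨L, lo, hi, h2⟩ hf2 => (emitPairs_runs hnN (h2.fam.congr (fun _ _ _ _ _ => Iff.rfl) hWE)
      h2.groups (((hf2.var _ (by decide)).trans (hf1.var _ (by decide))).trans hn)
      (((hf2.var _ (by decide)).trans (hf1.var _ (by decide))).trans hN)
      (((hf2.var _ (by decide)).trans (hf1.var _ (by decide))).trans hl) hln ?_ ?_ hnn
      ((hsame.of_frame hf1 (by decide) (by decide)).of_frame hf2 (by decide) (by decide)) hb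
      ((hc.of_frame hf1 (by decide) (by decide)).of_frame hf2 (by decide) (by decide))).mono le_rfl
      fun s3 hf3 ⟨k1, k2, k3⟩ => ⟨k1, ?_, k3⟩).mono ?_ fun _ _ h => h
  · have := h2.hi_le
    rw [add_mul, one_mul] at hw'
    omega
  · have := h2.top_le
    rw [add_mul, one_mul] at hw'
    omega
  · have h3 : d * (E * (Nat.clog 2 N * 700 + 710)) ≤ d * (E * (Nat.clog 2 N * 700 + 1100)) :=
      Nat.mul_le_mul_left _ (Nat.mul_le_mul_left _ (by omega))
    have h4 : E * 1100 ≤ E * (Nat.clog 2 N * 700 + 1100) := Nat.mul_le_mul_left _ (by omega)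
    rw [add_mul, one_mul]
    omega
  · exact ((Improves.of_frame hf1 (by decide) (by decide) n).trans
      (Improves.of_frame hf2 (by decide) (by decide) n)).trans k2

end WordRAM


namespace WordRAM
open Dominance

/-! ### The product of two matrices -/

def processBlock : Program :=
  .assign vMid (.var vLo) ;;
  .while (.lt (.var vMid) (.var vHi)) (processMid ;; .assign vMid (.add (.var vMid) (.const 1)))

def processBlocks : Program :=
  .assign vLo (.const 0) ;;
  .while (.lt (.var vLo) (.var vNum))
    (.ite (.lt (.add (.var vLo) (.var vBlock)) (.var vNum))
        (.assign vHi (.add (.var vLo) (.var vBlock))) (.assign vHi (.var vNum)) ;;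
      processBlock ;; .assign vLo (.var vHi))

/-- Each cell starts with the path over midpoint `0`, so no value `-∞` is needed. `vRow` is the
index of cell `(i, 0)` of the left factor, and `vCol` that of cell `(0, j)` of the right one. -/
def initProduct : Program :=
  .assign vIdx (.const 0) ;;
  .while (.lt (.var vIdx) (.mul (.var vNum) (.var vNum)))
    (.assign vRow (.mul (.var vNum) (.div (.var vIdx) (.var vNum))) ;;
     .assign vCol (.mod (.var vIdx) (.var vNum)) ;;
     .store aFlagC (.var vIdx) (.add (.get aFlagA (.var vRow)) (.get aFlagB (.var vCol))) ;;
     .realStore rC (.var vIdx) (.add (.get rA (.var vRow)) (.get rWt (.var vCol))) ;;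
     .store aCodeC (.var vIdx) (.mul (.get aCodeA (.var vRow)) (.var vNum)) ;;
     .assign vIdx (.add (.var vIdx) (.const 1)))

def copyProduct : Program :=
  .assign vIdx (.const 0) ;;
  .while (.lt (.var vIdx) (.mul (.var vNum) (.var vNum)))
    (.store aFlagA (.var vIdx) (.get aFlagC (.var vIdx)) ;;
     .realStore rA (.var vIdx) (.get rC (.var vIdx)) ;;
     .store aCodeA (.var vIdx) (.get aCodeC (.var vIdx)) ;;
     .assign vIdx (.add (.var vIdx) (.const 1)))

def multiply : Program := initProduct ;; processBlocks ;; copyProduct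

variable {w : ℕ} {ω : ℕ → Bool}

theorem Beats.asymm {n l l' i j : ℕ} {s₀ : State} (h : Beats n s₀ l l' i j) :
    ¬ Beats n s₀ l' l i j := by
  rintro (h' | ⟨h1', h2'⟩) <;> rcases h with h | ⟨h1, h2⟩
  · exact lt_asymm h h'
  · exact (h1 ▸ h').false
  · exact (h1' ▸ h).false
  · omega

/-- By asymmetry at most one midpoint of a block beats all others for a given pair. So a block
reports at most `n * n` pairs, however many midpoints it has; this is where the product saves a
factor `d`. -/
theorem sum_relatedCount_le (n : ℕ) (s₀ : State) (l₀ m : ℕ) :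
    ∑ x ∈ Finset.range m, ∑ j ∈ Finset.range n,
      relatedCount n (BeatsFirst n s₀ (l₀ + x) l₀ m) (n + j) ≤ n * n := by
  classical
  rw [Finset.sum_comm]
  calc _ ≤ ∑ j ∈ Finset.range n, n := Finset.sum_le_sum fun j _ => ?_
    _ = n * n := by simp
  have hdisj : ((Finset.range m : Finset ℕ) : Set ℕ).PairwiseDisjoint fun x =>
      (Finset.range n).filter fun i => BeatsFirst n s₀ (l₀ + x) l₀ m i (n + j) := by
    intro x hx y hy hxy
    rw [Function.onFun, Finset.disjoint_filter]
    intro i _ h1 h2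
    simp only [Finset.coe_range, Set.mem_Iio] at hx hy
    exact (h1 (l₀ + y) (by omega) (by omega) (by omega)).asymm
      (h2 (l₀ + x) (by omega) (by omega) (by omega))
  have := Finset.card_biUnion hdisj
  have hle : ((Finset.range m).biUnion fun x => (Finset.range n).filter fun i =>
      BeatsFirst n s₀ (l₀ + x) l₀ m i (n + j)).card ≤ n :=
    (Finset.card_le_card (Finset.biUnion_subset.2 fun x _ => Finset.filter_subset _ _)).trans
      (Finset.card_range n).le
  rw [this] at hle
  simpa [relatedCount] using hle

/-- The winner has the largest value and, among those, the smallest index. The order dual in the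
second component expresses this tie-break. -/
theorem exists_beatsFirst (n : ℕ) (s₀ : State) (l₀ i j : ℕ) {m : ℕ} (hm : 0 < m) :
    ∃ x < m, BeatsFirst n s₀ (l₀ + x) l₀ m i (n + j) ∧
      ∀ x' < m, pathVal n s₀ i (l₀ + x') j ≤ pathVal n s₀ i (l₀ + x) j := by
  obtain ⟨x, hx, hmax⟩ := Finset.exists_max_image (Finset.range m)
    (fun x => toLex (pathVal n s₀ i (l₀ + x) j, OrderDual.toDual x)) ⟨0, by simpa using hm⟩
  simp only [Finset.mem_range, Prod.Lex.toLex_le_toLex, OrderDual.toDual_le_toDual] at hx hmax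
  refine ⟨x, hx, fun l' h1 h2 h3 => ?_, fun x' hx' => ?_⟩
  · obtain ⟨x', rfl⟩ := Nat.exists_eq_add_of_le h1
    rcases hmax x' (by omega) with h | ⟨h, h'⟩
    · exact Or.inl (by simpa using h)
    · exact Or.inr ⟨by simpa using h, by omega⟩
  · rcases hmax x' hx' with h | ⟨h, -⟩
    · exact h.le
    · exact h.le

theorem processBlock_runs {s s₀ : State} {n N d m E l₀ : ℕ} (hnN : N = n + n)
    (hn : s.var vNum = n) (hN : s.var vElts = N) (hlo : s.var vLo = l₀)
    (hhi : s.var vHi = l₀ + m) (hmn : l₀ + m ≤ n) (hmd : m ≤ d)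
    (hE : 3 ^ d * 3 ^ Nat.clog 2 N ≤ E)
    (hw : 2 * ((d + 2) * E) + 4 * N + 20 < 2 ^ w) (hnn : n * n < 2 ^ w)
    (hsame : SameFactors s₀ s) (hb : FactorBound n w s₀) (hc : IsCandidate n s₀ s) :
    Runs w ω processBlock s
      (d * ((d + 1) * (E * (Nat.clog 2 N * 700 + 1100)) + 10) + n * n * 150 + 10) fun s' =>
      IsCandidate n s₀ s' ∧ Improves n s s' ∧
      ∀ i < n, ∀ j < n, ∀ l, l₀ ≤ l → l < l₀ + m → pathVal n s₀ i l j ≤ prodVal s' (n * i + j) := by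
  refine (Runs.seq (T := 2) (Q := fun s' => s'.var vMid = l₀)
    ((Runs.of_loopFree rfl (by simp [hlo])).mono (by decide) fun _ _ h => h)
    fun s1 h1 hf1 => Runs.loop m (fun y s' => s'.var vMid = l₀ + y ∧ IsCandidate n s₀ s' ∧
      Improves n s s' ∧ ∀ i < n, ∀ j < n, ∀ x < y, BeatsFirst n s₀ (l₀ + x) l₀ m i (n + j) →
        pathVal n s₀ i (l₀ + x) j ≤ prodVal s' (n * i + j))
      (fun x => (d + 1) * (E * (Nat.clog 2 N * 700 + 1100)) + (∑ j ∈ Finset.range n,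
        relatedCount n (BeatsFirst n s₀ (l₀ + x) l₀ m) (n + j)) * 150 + 4)
      ⟨h1, hc.of_frame hf1 (by decide) (by decide), .of_frame hf1 (by decide) (by decide) n,
        by simp⟩ ?_ ?_).mono ?_ fun s2 hf2 ⟨k1, k2, k3, k4⟩ => ⟨k2, k3, ?_⟩
  · rintro y hy s2 ⟨k1, k2, k3, k4⟩ hf2
    have hhi2 : s2.var vHi = l₀ + m := ((hf2.var _ (by decide)).trans (hf1.var _ (by decide))).trans hhi
    refine ⟨by simp only [Test.Holds, IntExpr.eval, k1, hhi2]; omega, ?_⟩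
    refine (Runs.seq (processMid_runs (d := d) hnN
      (((hf2.var _ (by decide)).trans (hf1.var _ (by decide))).trans hn)
      (((hf2.var _ (by decide)).trans (hf1.var _ (by decide))).trans hN) k1
      (((hf2.var _ (by decide)).trans (hf1.var _ (by decide))).trans hlo) hhi2 (by omega) hmn hmd hE
      hw hnn ((hsame.of_frame hf1 (by decide) (by decide)).of_frame hf2 (by decide) (by decide)) hb k2)
      (T' := 4) fun s3 ⟨m1, m2, m3⟩ hf3 => (Runs.of_loopFree rfl ?_).mono (by decide) fun _ _ h => h).mono
      le_rfl fun _ _ h => h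
    have hmid : s3.var vMid = l₀ + y := (hf3.var _ (by decide)).trans k1
    have hf4 := Frame.of_exec (Exec.of_loopFree (w := w) (ω := ω)
      (p := .assign vMid (.add (.var vMid) (.const 1))) rfl s3).choose_spec.1
    have hi4 : Improves n s3 _ := .of_frame hf4 (by decide) (by decide) n
    refine ⟨by simp (disch := omega) [hmid, Nat.mod_eq_of_lt, add_assoc],
      m1.of_frame hf4 (by decide) (by decide), (k3.trans m2).trans hi4, fun i hi j hj x hx hbeat => ?_⟩
    rcases Nat.lt_succ_iff_lt_or_eq.1 hx with hlt | rfl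
    · exact (k4 i hi j hj x hlt hbeat).trans ((m2.trans hi4) i hi j hj)
    · exact (m3 i hi j hj hbeat).trans (hi4 i hi j hj)
  · rintro s2 ⟨k1, -⟩ hf2
    have hhi2 : s2.var vHi = l₀ + m := ((hf2.var _ (by decide)).trans (hf1.var _ (by decide))).trans hhi
    simp only [Test.Holds, IntExpr.eval, k1, hhi2]; omega
  · have h1 := sum_relatedCount_le n s₀ l₀ m
    have h2 : m * ((d + 1) * (E * (Nat.clog 2 N * 700 + 1100)) + 10) ≤
        d * ((d + 1) * (E * (Nat.clog 2 N * 700 + 1100)) + 10) := Nat.mul_le_mul_right _ hmd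
    generalize (d + 1) * (E * (Nat.clog 2 N * 700 + 1100)) = Z at *
    simp only [Test.cost, IntExpr.cost, Finset.sum_add_distrib, ← Finset.sum_mul, Finset.sum_const,
      Finset.card_range, smul_eq_mul]
    rw [mul_add] at h2
    omega
  · intro i hi j hj l hl1 hl2
    obtain ⟨x, hx, hx1, hx2⟩ := exists_beatsFirst n s₀ l₀ i j (m := m) (by omega)
    obtain ⟨x', rfl⟩ := Nat.exists_eq_add_of_le hl1
    exact (hx2 x' (by omega)).trans (k4 i hi j hj x hx hx1)

/-- The blocks number `n / d`, rounded up. Each costs `O(n * n)` for the reported pairs and the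
comparisons of its at most `d` midpoints. -/
theorem processBlocks_runs {s s₀ : State} {n N d E : ℕ} (hnN : N = n + n)
    (hn : s.var vNum = n) (hN : s.var vElts = N) (hd : s.var vBlock = d) (hd0 : 0 < d)
    (hE : 3 ^ d * 3 ^ Nat.clog 2 N ≤ E)
    (hw : 2 * ((d + 2) * E) + 4 * N + 20 < 2 ^ w) (hnn : n * n < 2 ^ w)
    (hsame : SameFactors s₀ s) (hb : FactorBound n w s₀) (hc : IsCandidate n s₀ s) :
    Runs w ω processBlocks s ((n + d - 1) / d *
      (d * ((d + 1) * (E * (Nat.clog 2 N * 700 + 1100)) + 10) + n * n * 150 + 40) + 10) fun s' =>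
      IsCandidate n s₀ s' ∧
      ∀ i < n, ∀ j < n, ∀ l < n, pathVal n s₀ i l j ≤ prodVal s' (n * i + j) := by
  have hdw : d + n < 2 ^ w := by
    have : (d + 2) * 1 ≤ (d + 2) * E := Nat.mul_le_mul_left _ (lt_of_lt_of_le (by positivity) hE)
    omega
  have hceil : ∀ y, y < (n + d - 1) / d ↔ y * d < n := by
    intro y
    rw [Nat.lt_iff_add_one_le, Nat.le_div_iff_mul_le hd0, add_mul]
    omega
  refine (Runs.seq (T := 2) (Q := fun s' => s'.var vLo = 0)
    ((Runs.of_loopFree rfl (by simp)).mono (by decide) fun _ _ h => h)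
    fun s1 h1 hf1 => Runs.loop_const ((n + d - 1) / d) (fun y s' => s'.var vLo = min (y * d) n ∧
      IsCandidate n s₀ s' ∧ ∀ i < n, ∀ j < n, ∀ l < min (y * d) n,
        pathVal n s₀ i l j ≤ prodVal s' (n * i + j))
      (d * ((d + 1) * (E * (Nat.clog 2 N * 700 + 1100)) + 10) + n * n * 150 + 30)
      ⟨by simp [h1], hc.of_frame hf1 (by decide) (by decide), by simp⟩ ?_ ?_).mono ?_
      fun s2 hf2 ⟨k1, k2, k3⟩ => ⟨k2, ?_⟩
  · rintro y hy s2 ⟨k1, k2, k3⟩ hf2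
    have hn2 : s2.var vNum = n := ((hf2.var _ (by decide)).trans (hf1.var _ (by decide))).trans hn
    have hd2 : s2.var vBlock = d := ((hf2.var _ (by decide)).trans (hf1.var _ (by decide))).trans hd
    have hyn : y * d < n := (hceil y).1 hy
    have hys : (y + 1) * d = y * d + d := by ring
    rw [min_eq_left hyn.le] at k1 k3
    refine ⟨by simp only [Test.Holds, IntExpr.eval, k1, hn2]; omega, ?_⟩
    refine (Runs.seq (T := 12) (Q := fun s' => s'.var vHi = min ((y + 1) * d) n)
      ((Runs.of_loopFree rfl ?_).mono (by decide) fun _ _ h => h)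
      fun s3 h3 hf3 => Runs.seq (processBlock_runs (d := d) (m := min ((y + 1) * d) n - y * d) hnN
        ((hf3.var _ (by decide)).trans hn2)
        ((hf3.var _ (by decide)).trans (((hf2.var _ (by decide)).trans (hf1.var _ (by decide))).trans hN))
        ((hf3.var _ (by decide)).trans k1) (by omega) (by omega) (by omega) hE hw hnn
        (((hsame.of_frame hf1 (by decide) (by decide)).of_frame hf2 (by decide) (by decide)).of_frame
          hf3 (by decide) (by decide)) hb (k2.of_frame hf3 (by decide) (by decide)))
        (T' := 4) fun s4 ⟨m1, m2, m3⟩ hf4 =>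
          (Runs.of_loopFree rfl ?_).mono (by decide) fun _ _ h => h).mono ?_ fun _ _ h => h
    · by_cases hlt : y * d + d < n
      · simp (disch := omega) [k1, hd2, hn2, Nat.mod_eq_of_lt, hlt, hys]
      · simp (disch := omega) [k1, hd2, hn2, Nat.mod_eq_of_lt, hlt, hys]
    · have hhi : s4.var vHi = min ((y + 1) * d) n := (hf4.var _ (by decide)).trans h3
      have hf5 := Frame.of_exec (Exec.of_loopFree (w := w) (ω := ω)
        (p := .assign vLo (.var vHi)) rfl s4).choose_spec.1
      have hi5 : Improves n s4 _ := .of_frame hf5 (by decide) (by decide) n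
      refine ⟨by simp [hhi], m1.of_frame hf5 (by decide) (by decide), fun i hi j hj l hl => ?_⟩
      by_cases hlt : l < y * d
      · exact (k3 i hi j hj l hlt).trans ((((Improves.of_frame hf3 (by decide) (by decide) n).trans
          m2).trans hi5) i hi j hj)
      · exact (m3 i hi j hj l (by omega) (by omega)).trans (hi5 i hi j hj)
    · omega
  · rintro s2 ⟨k1, -⟩ hf2
    have hn2 : s2.var vNum = n := ((hf2.var _ (by decide)).trans (hf1.var _ (by decide))).trans hn
    have := (hceil ((n + d - 1) / d)).not.1 (lt_irrefl _)
    simp only [Test.Holds, IntExpr.eval, k1, hn2]; omega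
  · simp only [Test.cost, IntExpr.cost]
    rw [show ∀ x, x + 30 + (1 + 1 + 1) + 1 = x + 34 by intro x; omega]
    have := Nat.mul_le_mul_left ((n + d - 1) / d) (show
      d * ((d + 1) * (E * (Nat.clog 2 N * 700 + 1100)) + 10) + n * n * 150 + 34 ≤
      d * ((d + 1) * (E * (Nat.clog 2 N * 700 + 1100)) + 10) + n * n * 150 + 40 by omega)
    omega
  · have := (hceil ((n + d - 1) / d)).not.1 (lt_irrefl _)
    intro i hi j hj l hl
    exact k3 i hi j hj l (by omega)

theorem initProduct_runs {s : State} {n : ℕ} (hn : s.var vNum = n) (hn0 : 0 < n)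
    (hnn : n * n + 1 < 2 ^ w) (hb : FactorBound n w s) :
    Runs w ω initProduct s (n * n * 60 + 10) fun s' => IsCandidate n s s' := by
  have hnnn : n ≤ n * n := Nat.le_mul_of_pos_left _ hn0
  refine (Runs.seq (T := 2) (Q := fun s' => s'.var vIdx = 0)
    ((Runs.of_loopFree rfl (by simp)).mono (by decide) fun _ _ h => h)
    fun s1 h1 hf1 => Runs.loop_const (n * n) (fun y s' => s'.var vIdx = y ∧
      ∀ i < n, ∀ j < n, n * i + j < y → prodVal s' (n * i + j) = pathVal n s i 0 j ∧
        s'.arr aCodeC (n * i + j) = s.arr aCodeA (n * i) * n) 45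
      ⟨h1, by simp⟩ ?_ ?_).mono ?_
      fun s2 hf2 ⟨k1, k2⟩ i hi j hj => ⟨0, hn0, by simpa using k2 i hi j hj (cell_lt hi hj)⟩
  · rintro y hy s2 ⟨k1, k2⟩ hf2
    have hn2 : s2.var vNum = n := ((hf2.var _ (by decide)).trans (hf1.var _ (by decide))).trans hn
    have hFA : s2.arr aFlagA = s.arr aFlagA := (hf2.arr _ (by decide)).trans (hf1.arr _ (by decide))
    have hFB : s2.arr aFlagB = s.arr aFlagB := (hf2.arr _ (by decide)).trans (hf1.arr _ (by decide))
    have hCA : s2.arr aCodeA = s.arr aCodeA := (hf2.arr _ (by decide)).trans (hf1.arr _ (by decide))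
    have hRA : s2.real rA = s.real rA := (hf2.real _ (by decide)).trans (hf1.real _ (by decide))
    have hRB : s2.real rWt = s.real rWt := (hf2.real _ (by decide)).trans (hf1.real _ (by decide))
    refine ⟨by simp (disch := omega) only [Test.Holds, IntExpr.eval, k1, hn2, Nat.mod_eq_of_lt]; omega, ?_⟩
    refine (Runs.of_loopFree rfl ?_).mono (by decide) fun _ _ h => h
    have hi : y / n < n := Nat.div_lt_of_lt_mul hy
    have hj : y % n < n := Nat.mod_lt _ hn0
    have hij : n * (y / n) + y % n = y := Nat.div_add_mod y n
    generalize hci : y / n = i at *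
    generalize hcj : y % n = j at *
    have b1 := hb.flagA i hi 0 hn0
    have b2 := hb.flagB 0 hn0 j hj
    have b3 := hb.code i hi 0 hn0
    simp only [mul_zero, zero_add, add_zero] at b1 b2 b3
    refine ⟨by simp (disch := omega) [k1, hn2, Nat.mod_eq_of_lt], fun i' hi' j' hj' hlt => ?_⟩
    simp (disch := omega) [prodVal, pathVal, cellVal, k1, hn2, hci, hcj, hFA, hFB, hCA, hRA, hRB,
      Nat.mod_eq_of_lt]
    rcases Nat.lt_succ_iff_lt_or_eq.1 hlt with hlt | he
    · simpa [hlt.ne, prodVal, pathVal, cellVal] using k2 i' hi' j' hj' hlt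
    · obtain ⟨rfl, rfl⟩ := cell_inj hj' hj (he.trans hij.symm)
      simp [he, ← toLex_add]
  · rintro s2 ⟨k1, -⟩ hf2
    have hn2 : s2.var vNum = n := ((hf2.var _ (by decide)).trans (hf1.var _ (by decide))).trans hn
    simp (disch := omega) only [Test.Holds, IntExpr.eval, k1, hn2, Nat.mod_eq_of_lt]; omega
  · simp only [Test.cost, IntExpr.cost]; omega

theorem copyProduct_runs {s : State} {n : ℕ} (hn : s.var vNum = n) (hnn : n * n + 1 < 2 ^ w) :
    Runs w ω copyProduct s (n * n * 30 + 10) fun s' => ∀ c < n * n,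
      s'.arr aFlagA c = s.arr aFlagC c ∧ s'.arr aCodeA c = s.arr aCodeC c ∧
      s'.real rA c = s.real rC c := by
  have hnnn : n ≤ n * n := Nat.le_mul_self n
  refine (Runs.seq (T := 2) (Q := fun s' => s'.var vIdx = 0)
    ((Runs.of_loopFree rfl (by simp)).mono (by decide) fun _ _ h => h)
    fun s1 h1 hf1 => Runs.loop_const (n * n) (fun y s' => s'.var vIdx = y ∧
      ∀ c < y, s'.arr aFlagA c = s.arr aFlagC c ∧ s'.arr aCodeA c = s.arr aCodeC c ∧
      s'.real rA c = s.real rC c) 20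
      ⟨h1, by simp⟩ ?_ ?_).mono ?_ fun _ _ h => h.2
  · rintro y hy s2 ⟨k1, k2⟩ hf2
    have hn2 : s2.var vNum = n := ((hf2.var _ (by decide)).trans (hf1.var _ (by decide))).trans hn
    have hFC : s2.arr aFlagC = s.arr aFlagC := (hf2.arr _ (by decide)).trans (hf1.arr _ (by decide))
    have hCC : s2.arr aCodeC = s.arr aCodeC := (hf2.arr _ (by decide)).trans (hf1.arr _ (by decide))
    have hRC : s2.real rC = s.real rC := (hf2.real _ (by decide)).trans (hf1.real _ (by decide))
    refine ⟨by simp (disch := omega) only [Test.Holds, IntExpr.eval, k1, hn2, Nat.mod_eq_of_lt]; omega, ?_⟩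
    refine (Runs.of_loopFree rfl ?_).mono (by decide) fun _ _ h => h
    refine ⟨by simp (disch := omega) [k1, Nat.mod_eq_of_lt], fun c hc => ?_⟩
    simp (disch := omega) [k1, hFC, hCC, hRC]
    rcases Nat.lt_succ_iff_lt_or_eq.1 hc with hlt | rfl
    · simpa [hlt.ne] using k2 c hlt
    · simp
  · rintro s2 ⟨k1, -⟩ hf2
    have hn2 : s2.var vNum = n := ((hf2.var _ (by decide)).trans (hf1.var _ (by decide))).trans hn
    simp (disch := omega) only [Test.Holds, IntExpr.eval, k1, hn2, Nat.mod_eq_of_lt]; omega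
  · simp only [Test.cost, IntExpr.cost]; omega

/-- A bound for the time of one multiplication. -/
def multiplyTime (n d : ℕ) : ℕ :=
  (n + d - 1) / d * (d * ((d + 1) * (3 ^ d * 3 ^ Nat.clog 2 (n + n) *
    (Nat.clog 2 (n + n) * 700 + 1100)) + 10) + n * n * 150 + 40) + n * n * 90 + 30

theorem multiply_runs {s : State} {n d : ℕ} (hn : s.var vNum = n) (hN : s.var vElts = n + n)
    (hd : s.var vBlock = d) (hd0 : 0 < d) (hn0 : 0 < n)
    (hw : 2 * ((d + 2) * (3 ^ d * 3 ^ Nat.clog 2 (n + n))) + 4 * (n + n) + 20 < 2 ^ w)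
    (hnn : n * n + 1 < 2 ^ w) (hb : FactorBound n w s) :
    Runs w ω multiply s (multiplyTime n d) fun s' => ∀ i < n, ∀ j < n,
      (∃ l < n, cellVal (s'.arr aFlagA) (s'.real rA) (n * i + j) = pathVal n s i l j ∧
        s'.arr aCodeA (n * i + j) = s.arr aCodeA (n * i + l) * n + l) ∧
      ∀ l < n, pathVal n s i l j ≤ cellVal (s'.arr aFlagA) (s'.real rA) (n * i + j) := by
  refine (Runs.seq (initProduct_runs hn hn0 hnn hb) fun s1 h1 hf1 =>
    Runs.seq (processBlocks_runs (s₀ := s) rfl ((hf1.var _ (by decide)).trans hn)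
      ((hf1.var _ (by decide)).trans hN) ((hf1.var _ (by decide)).trans hd) hd0 le_rfl hw (by omega)
      (SameFactors.of_frame ⟨rfl, rfl, rfl, rfl, rfl⟩ hf1 (by decide) (by decide)) hb h1)
      fun s2 ⟨h2, h2'⟩ hf2 => (copyProduct_runs
        (((hf2.var _ (by decide)).trans (hf1.var _ (by decide))).trans hn) hnn).mono le_rfl
      fun s3 _ h3 i hi j hj => ?_).mono ?_ fun _ _ h => h
  · obtain ⟨k1, k2, k3⟩ := h3 _ (cell_lt hi hj)
    have hval : cellVal (s3.arr aFlagA) (s3.real rA) (n * i + j) = prodVal s2 (n * i + j) := by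
      rw [prodVal, cellVal, cellVal, k1, k3]
    rw [hval, k2]
    exact ⟨h2 i hi j hj, h2' i hi j hj⟩
  · rw [multiplyTime]; omega

end WordRAM


namespace WordRAM
open Dominance

/-- The length of the cycle. -/
notation "vCyc" => (37 : ℕ)
/-- The number of trials in a round. -/
notation "vTrials" => (38 : ℕ)

/-! ### One trial -/

/-- The colors are not uniform. It suffices that each color below `K` is forced by some pattern of
the `K` coins. -/
def countHeads : Program :=
  .assign vFlag (.const 0) ;; .assign vStep (.const 0) ;;
  .while (.lt (.var vStep) (.var vCyc))
    (.flip vCoin ;; .assign vFlag (.add (.var vFlag) (.var vCoin)) ;;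
      .assign vStep (.add (.var vStep) (.const 1)))

def colorVertices : Program :=
  .assign vRow (.const 0) ;;
  .while (.lt (.var vRow) (.var vNum))
    (countHeads ;; (.store aColor (.var vRow) (.var vFlag) ;;
      .assign vRow (.add (.var vRow) (.const 1))))

/-- The edge with the index `vIdx` leads from color `vStep` to the next one. -/
def isLayerEdge : Test :=
  .and (.eq (.get aAdj (.var vIdx)) (.const 1))
    (.and (.eq (.get aColor (.div (.var vIdx) (.var vNum))) (.var vStep))
      (.eq (.get aColor (.mod (.var vIdx) (.var vNum))) (.add (.var vStep) (.const 1))))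

/-- The code of a path omits its last vertex, which is known from the column. A single edge from `i`
therefore has code `i`. -/
def initPaths : Program :=
  (.assign vStep (.const 0) ;; .assign vIdx (.const 0)) ;;
  .while (.lt (.var vIdx) (.mul (.var vNum) (.var vNum)))
    (.ite isLayerEdge (.store aFlagA (.var vIdx) (.const 1)) (.store aFlagA (.var vIdx) (.const 0)) ;;
     .realStore rA (.var vIdx) (.get rWt (.var vIdx)) ;;
     .store aCodeA (.var vIdx) (.div (.var vIdx) (.var vNum)) ;;
     .assign vIdx (.add (.var vIdx) (.const 1)))

def initLayer : Program :=
  .assign vIdx (.const 0) ;;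
  .while (.lt (.var vIdx) (.mul (.var vNum) (.var vNum)))
    (.ite isLayerEdge (.store aFlagB (.var vIdx) (.const 1)) (.store aFlagB (.var vIdx) (.const 0)) ;;
     .assign vIdx (.add (.var vIdx) (.const 1)))

/-- The loop ends with paths of `vCyc - 1` edges; the last edge of the cycle is added by
`closeCycle`. -/
def extendPaths : Program :=
  .assign vStep (.const 1) ;;
  .while (.lt (.add (.var vStep) (.const 1)) (.var vCyc))
    (initLayer ;; multiply ;; .assign vStep (.add (.var vStep) (.const 1)))

/-- `vIdx` is the cell of a path from `vRow` to `vCol`, and `vElt` the transposed cell, that of the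
closing edge. -/
def closeCycle : Program :=
  (.assign vRow (.div (.var vIdx) (.var vNum)) ;;
   .assign vCol (.mod (.var vIdx) (.var vNum)) ;;
   .assign vElt (.add (.mul (.var vNum) (.var vCol)) (.var vRow)) ;;
   .ite (.and (.eq (.get aAdj (.var vElt)) (.const 1))
     (.eq (.add (.get aColor (.var vCol)) (.const 1)) (.var vCyc)))
     (.assign vFlag (.add (.get aFlagA (.var vIdx)) (.const 1)))
     (.assign vFlag (.get aFlagA (.var vIdx)))) ;;
  .ite (.or (.lt (.var vBestFlag) (.var vFlag))
      (.and (.eq (.var vBestFlag) (.var vFlag))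
        (.not (.realLe (.add (.get rA (.var vIdx)) (.get rWt (.var vElt))) (.get rBest (.const 0))))))
    (.assign vBestFlag (.var vFlag) ;;
     .assign vBestCode (.add (.mul (.get aCodeA (.var vIdx)) (.var vNum)) (.var vCol)) ;;
     .realStore rBest (.const 0) (.add (.get rA (.var vIdx)) (.get rWt (.var vElt))))
    .skip ;;
  .assign vIdx (.add (.var vIdx) (.const 1))

def closeCycles : Program :=
  .assign vIdx (.const 0) ;;
  .while (.lt (.var vIdx) (.mul (.var vNum) (.var vNum))) closeCycle

def trial : Program := colorVertices ;; initPaths ;; extendPaths ;; closeCycles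

variable {w : ℕ} {ω : ℕ → Bool}

/-- The number of heads among the `k` flips from number `c` on. -/
def heads (ω : ℕ → Bool) (c k : ℕ) : ℕ := ∑ b ∈ Finset.range k, if ω (c + b) then 1 else 0

theorem heads_le (c k : ℕ) : heads ω c k ≤ k := by
  calc heads ω c k ≤ ∑ b ∈ Finset.range k, 1 := Finset.sum_le_sum fun b _ => by split <;> simp
    _ = k := by simp

theorem countHeads_runs {s : State} {k : ℕ} (hk : s.var vCyc = k) (hw : k + 1 < 2 ^ w) :
    Runs w ω countHeads s (k * 20 + 10) fun s' =>
      s'.var vFlag = heads ω s.coins k ∧ s'.coins = s.coins + k := by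
  refine (Runs.seq (T := 2) (Q := fun s' => s'.var vFlag = 0)
    ((Runs.of_loopFree rfl (by simp)).mono (by decide) fun _ _ h => h)
    fun s1 h1 hf1 => Runs.seq (T := 2) (Q := fun s' => s'.var vFlag = 0 ∧ s'.var vStep = 0)
    ((Runs.of_loopFree rfl (by simp [h1])).mono (by decide) fun _ _ h => h)
    fun s2 h2 hf2 => Runs.loop_const k (fun y s' => s'.var vStep = y ∧
      s'.var vFlag = heads ω s.coins y ∧ s'.coins = s.coins + y) 14
      ⟨h2.2, by simp [h2.1, heads], by rw [hf2.coins rfl, hf1.coins rfl, add_zero]⟩ ?_ ?_).mono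
      ?_ fun _ _ h => h.2
  · rintro y hy s3 ⟨k1, k2, k3⟩ hf3
    have hk3 : s3.var vCyc = k :=
      (((hf3.var _ (by decide)).trans (hf2.var _ (by decide))).trans (hf1.var _ (by decide))).trans hk
    have hle := heads_le (ω := ω) s.coins y
    refine ⟨by simp only [Test.Holds, IntExpr.eval, k1, hk3]; omega, ?_⟩
    refine (Runs.of_loopFree rfl ?_).mono (by decide) fun _ _ h => h
    have hs : heads ω s.coins (y + 1) = heads ω s.coins y + if ω (s.coins + y) then 1 else 0 := by
      rw [heads, heads, Finset.sum_range_succ]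
    rw [hs]
    by_cases hc : ω (s.coins + y)
    · simp (disch := omega) [k1, k2, k3, hc, Nat.mod_eq_of_lt, add_assoc]
    · simp (disch := omega) [k1, k2, k3, hc, Nat.mod_eq_of_lt, add_assoc]
  · rintro s3 ⟨k1, -⟩ hf3
    have hk3 : s3.var vCyc = k :=
      (((hf3.var _ (by decide)).trans (hf2.var _ (by decide))).trans (hf1.var _ (by decide))).trans hk
    simp only [Test.Holds, IntExpr.eval, k1, hk3]; omega
  · simp only [Test.cost, IntExpr.cost]; omega

theorem colorVertices_runs {s : State} {n k : ℕ} (hn : s.var vNum = n) (hk : s.var vCyc = k)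
    (hw : k + 1 < 2 ^ w) (hnw : n + 1 < 2 ^ w) :
    Runs w ω colorVertices s (n * (k * 20 + 30) + 10) fun s' =>
      (∀ v < n, s'.arr aColor v = heads ω (s.coins + v * k) k) ∧ s'.coins = s.coins + n * k := by
  refine (Runs.seq (T := 2) (Q := fun s' => s'.var vRow = 0)
    ((Runs.of_loopFree rfl (by simp)).mono (by decide) fun _ _ h => h)
    fun s1 h1 hf1 => Runs.loop_const n (fun y s' => s'.var vRow = y ∧
      (∀ v < y, s'.arr aColor v = heads ω (s.coins + v * k) k) ∧ s'.coins = s.coins + y * k)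
      (k * 20 + 20) ⟨h1, by simp, by rw [hf1.coins rfl]; simp⟩ ?_ ?_).mono
      ?_ fun _ _ h => h.2
  · rintro y hy s2 ⟨k1, k2, k3⟩ hf2
    have hn2 : s2.var vNum = n := ((hf2.var _ (by decide)).trans (hf1.var _ (by decide))).trans hn
    have hk2 : s2.var vCyc = k := ((hf2.var _ (by decide)).trans (hf1.var _ (by decide))).trans hk
    refine ⟨by simp only [Test.Holds, IntExpr.eval, k1, hn2]; omega, ?_⟩
    refine (Runs.seq (countHeads_runs hk2 hw) (T' := 10) fun s3 ⟨h3, h3'⟩ hf3 =>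
      (Runs.of_loopFree rfl ?_).mono (by decide) fun _ _ h => h).mono (by omega) fun _ _ h => h
    have hr : s3.var vRow = y := (hf3.var _ (by decide)).trans k1
    have hc : s3.arr aColor = s2.arr aColor := hf3.arr _ (by decide)
    refine ⟨by simp (disch := omega) [hr, Nat.mod_eq_of_lt], fun v hv => ?_, ?_⟩
    · rcases Nat.lt_succ_iff_lt_or_eq.1 hv with hlt | rfl
      · simpa [hr, hlt.ne, hc] using k2 v hlt
      · simp [hr, h3, k3]
    · simp [h3', k3]; ring
  · rintro s2 ⟨k1, -⟩ hf2
    have hn2 : s2.var vNum = n := ((hf2.var _ (by decide)).trans (hf1.var _ (by decide))).trans hn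
    simp only [Test.Holds, IntExpr.eval, k1, hn2]; omega
  · simp only [Test.cost, IntExpr.cost]
    rw [show k * 20 + 20 + (1 + 1 + 1) + 1 = k * 20 + 24 by omega]
    have : n * (k * 20 + 24) ≤ n * (k * 20 + 30) := Nat.mul_le_mul_left _ (by omega)
    omega

open Classical in
/-- The value of the edge from `a` to `b` as the edge number `t` of a colorful path: does it lead from
color `t` to color `t + 1`, and what is its weight? -/
noncomputable def edgeVal (n : ℕ) (adj : ℕ → ℕ) (wt : ℕ → ℝ) (col : ℕ → ℕ) (t a b : ℕ) : ℤ ×ₗ ℝ :=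
  toLex (if adj (n * a + b) = 1 ∧ col a = t ∧ col b = t + 1 then 1 else 0, wt (n * a + b))

/-- The value of the path `x 0, …, x m`. -/
noncomputable def chainVal (n : ℕ) (adj : ℕ → ℕ) (wt : ℕ → ℝ) (col : ℕ → ℕ) (m : ℕ) (x : ℕ → ℕ) :
    ℤ ×ₗ ℝ :=
  ∑ t ∈ Finset.range m, edgeVal n adj wt col t (x t) (x (t + 1))

/-- The vertices `x 0, …, x (m - 1)` as digits of a number. -/
def chainCode (n : ℕ) (x : ℕ → ℕ) : ℕ → ℕ
  | 0 => 0
  | m + 1 => chainCode n x m * n + x m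

theorem chainCode_congr {n m : ℕ} {x y : ℕ → ℕ} (h : ∀ t < m, x t = y t) :
    chainCode n x m = chainCode n y m := by
  induction m with
  | zero => rfl
  | succ m ih => rw [chainCode, chainCode, ih fun t ht => h t (by omega), h m (by omega)]

theorem chainVal_congr {n m : ℕ} {adj : ℕ → ℕ} {wt : ℕ → ℝ} {col : ℕ → ℕ} {x y : ℕ → ℕ}
    (h : ∀ t ≤ m, x t = y t) : chainVal n adj wt col m x = chainVal n adj wt col m y :=
  Finset.sum_congr rfl fun t ht => by
    have := Finset.mem_range.1 ht
    rw [h t (by omega), h (t + 1) (by omega)]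

theorem chainCode_lt {n m : ℕ} {x : ℕ → ℕ} (h : ∀ t < m, x t < n) : chainCode n x m < n ^ m := by
  induction m with
  | zero => simp [chainCode]
  | succ m ih =>
    have h1 := ih fun t ht => h t (by omega)
    have h2 := h m (by omega)
    rw [chainCode, pow_succ]
    calc _ < chainCode n x m * n + n := by omega
      _ = (chainCode n x m + 1) * n := by ring
      _ ≤ n ^ m * n := Nat.mul_le_mul_right _ h1

/-- The path matrix holds the best colorful paths with `m` edges. -/
def HoldsPaths (n : ℕ) (adj : ℕ → ℕ) (wt : ℕ → ℝ) (col : ℕ → ℕ) (m : ℕ) (s : State) : Prop :=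
  ∀ i < n, ∀ j < n,
    (∃ x : ℕ → ℕ, (∀ t ≤ m, x t < n) ∧ x 0 = i ∧ x m = j ∧
      cellVal (s.arr aFlagA) (s.real rA) (n * i + j) = chainVal n adj wt col m x ∧
      s.arr aCodeA (n * i + j) = chainCode n x m) ∧
    ∀ x : ℕ → ℕ, (∀ t ≤ m, x t < n) → x 0 = i → x m = j →
      chainVal n adj wt col m x ≤ cellVal (s.arr aFlagA) (s.real rA) (n * i + j)

theorem isLayerEdge_holds {s : State} {n i j t : ℕ} (hn : s.var vNum = n) (ht : s.var vStep = t)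
    (hx : s.var vIdx = n * i + j) (hi : i < n) (hj : j < n) (hw : n * n < 2 ^ w)
    (htw : t + 1 < 2 ^ w) :
    isLayerEdge.Holds w s ↔
      s.arr aAdj (n * i + j) = 1 ∧ s.arr aColor i = t ∧ s.arr aColor j = t + 1 := by
  have h1 : (n * i + j) / n = i := by
    rw [Nat.mul_add_div (by omega), Nat.div_eq_of_lt hj, add_zero]
  have h2 : (n * i + j) % n = j := by rw [Nat.mul_add_mod, Nat.mod_eq_of_lt hj]
  have h3 := Nat.le_mul_self n
  simp (disch := omega) only [isLayerEdge, Test.Holds, IntExpr.eval, hn, ht, hx, h1, h2,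
    Nat.mod_eq_of_lt]

theorem initPaths_runs {s : State} {n : ℕ} (hn : s.var vNum = n) (hn0 : 0 < n)
    (hw : n * n + 1 < 2 ^ w) :
    Runs w ω initPaths s (n * n * 60 + 10) fun s' =>
      HoldsPaths n (s.arr aAdj) (s.real rWt) (s.arr aColor) 1 s' := by
  have h3 := Nat.le_mul_self n
  refine (Runs.seq (T := 4) (Q := fun s' => s'.var vStep = 0 ∧ s'.var vIdx = 0)
    ((Runs.of_loopFree rfl (by simp)).mono (by decide) fun _ _ h => h)
    fun s1 h1 hf1 => Runs.loop_const (n * n) (fun y s' => s'.var vIdx = y ∧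
      ∀ i < n, ∀ j < n, n * i + j < y →
        cellVal (s'.arr aFlagA) (s'.real rA) (n * i + j) =
          edgeVal n (s.arr aAdj) (s.real rWt) (s.arr aColor) 0 i j ∧
        s'.arr aCodeA (n * i + j) = i) 45
      ⟨h1.2, by simp⟩ ?_ ?_).mono ?_ fun s2 hf2 ⟨k1, k2⟩ i hi j hj => ?_
  · rintro y hy s2 ⟨k1, k2⟩ hf2
    have hn2 : s2.var vNum = n := ((hf2.var _ (by decide)).trans (hf1.var _ (by decide))).trans hn
    have hst : s2.var vStep = 0 := (hf2.var _ (by decide)).trans h1.1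
    have hA : s2.arr aAdj = s.arr aAdj := (hf2.arr _ (by decide)).trans (hf1.arr _ (by decide))
    have hC : s2.arr aColor = s.arr aColor := (hf2.arr _ (by decide)).trans (hf1.arr _ (by decide))
    have hR : s2.real rWt = s.real rWt := (hf2.real _ (by decide)).trans (hf1.real _ (by decide))
    refine ⟨by simp (disch := omega) only [Test.Holds, IntExpr.eval, k1, hn2, Nat.mod_eq_of_lt]; omega, ?_⟩
    refine (Runs.of_loopFree rfl ?_).mono (by decide) fun _ _ h => h
    have hi : y / n < n := Nat.div_lt_of_lt_mul hy
    have hj : y % n < n := Nat.mod_lt _ hn0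
    have hij : n * (y / n) + y % n = y := Nat.div_add_mod y n
    generalize hci : y / n = i at *
    generalize hcj : y % n = j at *
    have htest := isLayerEdge_holds (w := w) hn2 hst (k1.trans hij.symm) hi hj (by omega) (by omega)
    rw [hA, hC, hij] at htest
    refine ⟨?_, fun i' hi' j' hj' hlt => ?_⟩
    · by_cases ht : isLayerEdge.Holds w s2 <;>
      simp (disch := omega) [ht, k1, hn2, Nat.mod_eq_of_lt]
    · rcases Nat.lt_succ_iff_lt_or_eq.1 hlt with hlt | he
      · have := k2 i' hi' j' hj' hlt
        by_cases ht : isLayerEdge.Holds w s2 <;>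
        simpa [ht, k1, hlt.ne, cellVal] using this
      · obtain ⟨rfl, rfl⟩ := cell_inj hj' hj (he.trans hij.symm)
        by_cases ht : isLayerEdge.Holds w s2 <;>
        simp (disch := omega) [ht, k1, hn2, he, cellVal, edgeVal, hci, Nat.mod_eq_of_lt, hR,
          ← htest]
  · rintro s2 ⟨k1, -⟩ hf2
    have hn2 : s2.var vNum = n := ((hf2.var _ (by decide)).trans (hf1.var _ (by decide))).trans hn
    simp (disch := omega) only [Test.Holds, IntExpr.eval, k1, hn2, Nat.mod_eq_of_lt]; omega
  · simp only [Test.cost, IntExpr.cost]; omega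
  · obtain ⟨m1, m2⟩ := k2 i hi j hj (cell_lt hi hj)
    rw [m1, m2]
    refine ⟨⟨fun t => if t = 0 then i else j, fun t _ => by dsimp only; split <;> assumption, rfl, rfl,
      by simp [chainVal], by simp [chainCode]⟩, fun x hx h0 h1 => by simp [chainVal, h0, h1]⟩

theorem initLayer_runs {s : State} {n t : ℕ} (hn : s.var vNum = n) (ht : s.var vStep = t) (hn0 : 0 < n)
    (hw : n * n + 1 < 2 ^ w) (htw : t + 1 < 2 ^ w) :
    Runs w ω initLayer s (n * n * 50 + 10) fun s' => ∀ i < n, ∀ j < n,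
        cellVal (s'.arr aFlagB) (s'.real rWt) (n * i + j) =
          edgeVal n (s.arr aAdj) (s.real rWt) (s.arr aColor) t i j := by
  have h3 := Nat.le_mul_self n
  refine (Runs.seq (T := 4) (Q := fun s' => s'.var vIdx = 0)
    ((Runs.of_loopFree rfl (by simp)).mono (by decide) fun _ _ h => h)
    fun s1 h1 hf1 => Runs.loop_const (n * n) (fun y s' => s'.var vIdx = y ∧
      ∀ i < n, ∀ j < n, n * i + j < y →
        cellVal (s'.arr aFlagB) (s'.real rWt) (n * i + j) =
          edgeVal n (s.arr aAdj) (s.real rWt) (s.arr aColor) t i j) 35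
      ⟨h1, by simp⟩ ?_ ?_).mono ?_ fun s2 hf2 ⟨k1, k2⟩ i hi j hj => k2 i hi j hj (cell_lt hi hj)
  · rintro y hy s2 ⟨k1, k2⟩ hf2
    have hn2 : s2.var vNum = n := ((hf2.var _ (by decide)).trans (hf1.var _ (by decide))).trans hn
    have hst : s2.var vStep = t := ((hf2.var _ (by decide)).trans (hf1.var _ (by decide))).trans ht
    have hA : s2.arr aAdj = s.arr aAdj := (hf2.arr _ (by decide)).trans (hf1.arr _ (by decide))
    have hC : s2.arr aColor = s.arr aColor := (hf2.arr _ (by decide)).trans (hf1.arr _ (by decide))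
    have hR : s2.real rWt = s.real rWt := (hf2.real _ (by decide)).trans (hf1.real _ (by decide))
    refine ⟨by simp (disch := omega) only [Test.Holds, IntExpr.eval, k1, hn2, Nat.mod_eq_of_lt]; omega, ?_⟩
    refine (Runs.of_loopFree rfl ?_).mono (by decide) fun _ _ h => h
    have hi : y / n < n := Nat.div_lt_of_lt_mul hy
    have hj : y % n < n := Nat.mod_lt _ hn0
    have hij : n * (y / n) + y % n = y := Nat.div_add_mod y n
    generalize hci : y / n = i at *
    generalize hcj : y % n = j at *
    have htest := isLayerEdge_holds (w := w) hn2 hst (k1.trans hij.symm) hi hj (by omega) htw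
    rw [hA, hC, hij] at htest
    refine ⟨?_, fun i' hi' j' hj' hlt => ?_⟩
    · by_cases ht : isLayerEdge.Holds w s2 <;>
      simp (disch := omega) [ht, k1, Nat.mod_eq_of_lt]
    · rcases Nat.lt_succ_iff_lt_or_eq.1 hlt with hlt | he
      · have := k2 i' hi' j' hj' hlt
        by_cases ht : isLayerEdge.Holds w s2 <;>
        simpa [ht, k1, hlt.ne, cellVal] using this
      · obtain ⟨rfl, rfl⟩ := cell_inj hj' hj (he.trans hij.symm)
        by_cases ht : isLayerEdge.Holds w s2 <;>
        simp (disch := omega) [ht, k1, he, cellVal, edgeVal, Nat.mod_eq_of_lt, hR,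
          ← htest]
  · rintro s2 ⟨k1, -⟩ hf2
    have hn2 : s2.var vNum = n := ((hf2.var _ (by decide)).trans (hf1.var _ (by decide))).trans hn
    simp (disch := omega) only [Test.Holds, IntExpr.eval, k1, hn2, Nat.mod_eq_of_lt]; omega
  · simp only [Test.cost, IntExpr.cost]; omega

end WordRAM


/-! ### Extending and closing layered paths. -/

namespace WordRAM
open Dominance

variable {w : ℕ} {ω : ℕ → Bool}

/-- Every edge contributes at most `1`, so the first component can reach `m` only if all edges
respect the layers. -/
theorem fst_chainVal_le {n m : ℕ} {adj : ℕ → ℕ} {wt : ℕ → ℝ} {col x : ℕ → ℕ} :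
    (ofLex (chainVal n adj wt col m x)).1 ≤ m := by
  induction m with
  | zero => simp [chainVal]
  | succ m ih =>
    have h : chainVal n adj wt col (m + 1) x =
        chainVal n adj wt col m x + edgeVal n adj wt col m (x m) (x (m + 1)) :=
      Finset.sum_range_succ _ _
    rw [h, ofLex_add, Prod.fst_add, edgeVal, ofLex_toLex]
    push_cast
    split <;> omega

theorem HoldsPaths.flag_le {n m : ℕ} {adj : ℕ → ℕ} {wt : ℕ → ℝ} {col : ℕ → ℕ} {s : State}
    (h : HoldsPaths n adj wt col m s) {i j : ℕ} (hi : i < n) (hj : j < n) :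
    s.arr aFlagA (n * i + j) ≤ m := by
  obtain ⟨⟨x, -, -, -, h1, -⟩, -⟩ := h i hi j hj
  have h2 := fst_chainVal_le (n := n) (m := m) (adj := adj) (wt := wt) (col := col) (x := x)
  rw [← h1, cellVal, ofLex_toLex] at h2
  dsimp only at h2
  exact_mod_cast h2

theorem HoldsPaths.code_lt {n m : ℕ} {adj : ℕ → ℕ} {wt : ℕ → ℝ} {col : ℕ → ℕ} {s : State}
    (h : HoldsPaths n adj wt col m s) {i j : ℕ} (hi : i < n) (hj : j < n) :
    s.arr aCodeA (n * i + j) * n + n ≤ n ^ (m + 1) := by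
  obtain ⟨⟨x, h0, -, -, -, h1⟩, -⟩ := h i hi j hj
  have h2 := chainCode_lt (n := n) (m := m) (x := x) fun t ht => h0 t ht.le
  rw [h1, pow_succ]
  calc _ = (chainCode n x m + 1) * n := by ring
    _ ≤ n ^ m * n := Nat.mul_le_mul_right _ h2

theorem HoldsPaths.of_frame {p : Program} {n m : ℕ} {adj : ℕ → ℕ} {wt : ℕ → ℝ} {col : ℕ → ℕ}
    {s s' : State} (h : HoldsPaths n adj wt col m s) (hf : Frame p s s')
    (ha : aFlagA ∉ p.modArrs ∧ aCodeA ∉ p.modArrs) (hr : rA ∉ p.modReals) :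
    HoldsPaths n adj wt col m s' := by
  intro i hi j hj
  rw [hf.arr _ ha.1, hf.arr _ ha.2, hf.real _ hr]
  exact h i hi j hj

/-- Bellman's principle, valid because addition in `ℤ ×ₗ ℝ` is monotone. The optimum is over all
sequences of vertices; that vertices do not repeat will follow from their colors. -/
theorem HoldsPaths.succ {n m : ℕ} {adj : ℕ → ℕ} {wt : ℕ → ℝ} {col : ℕ → ℕ} {s s' : State}
    (h : HoldsPaths n adj wt col m s)
    (hB : ∀ i < n, ∀ j < n, cellVal (s.arr aFlagB) (s.real rWt) (n * i + j) =
      edgeVal n adj wt col m i j)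
    (h' : ∀ i < n, ∀ j < n,
      (∃ l < n, cellVal (s'.arr aFlagA) (s'.real rA) (n * i + j) = pathVal n s i l j ∧
        s'.arr aCodeA (n * i + j) = s.arr aCodeA (n * i + l) * n + l) ∧
      ∀ l < n, pathVal n s i l j ≤ cellVal (s'.arr aFlagA) (s'.real rA) (n * i + j)) :
    HoldsPaths n adj wt col (m + 1) s' := by
  intro i hi j hj
  obtain ⟨⟨l, hl, h1, h2⟩, h3⟩ := h' i hi j hj
  have hsucc : ∀ x : ℕ → ℕ, chainVal n adj wt col (m + 1) x =
        chainVal n adj wt col m x + edgeVal n adj wt col m (x m) (x (m + 1)) :=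
      fun x => Finset.sum_range_succ _ _
  constructor
  · obtain ⟨⟨x, k1, k2, k3, k4, k5⟩, -⟩ := h i hi l hl
    refine ⟨fun t => if t ≤ m then x t else j, fun t _ => ?_, by simpa using k2, by simp, ?_, ?_⟩
    · dsimp only
      split
      · exact k1 _ ‹_›
      · exact hj
    · rw [h1, pathVal, hB l hl j hj, k4, hsucc,
        chainVal_congr (x := fun t => if t ≤ m then x t else j) (y := x) fun t ht => by simp [ht]]
      simp [k3]
    · rw [h2, k5, chainCode, chainCode_congr (x := fun t => if t ≤ m then x t else j) (y := x) fun t ht => by simp [ht.le]]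
      simp [k3]
  · intro x k1 k2 k3
    have hxm := k1 m (by omega)
    have := (h i hi (x m) hxm).2 x (fun t ht => k1 t (by omega)) k2 rfl
    rw [hsucc, k3, ← hB _ hxm j hj]
    exact (add_le_add_left this _).trans (h3 _ hxm)

theorem extendPaths_runs {s : State} {n d k : ℕ} (hk : s.var vCyc = k + 2) (hn : s.var vNum = n)
    (hN : s.var vElts = n + n) (hd : s.var vBlock = d) (hd0 : 0 < d) (hn0 : 0 < n)
    (hw : 2 * ((d + 2) * (3 ^ d * 3 ^ Nat.clog 2 (n + n))) + 4 * (n + n) + 20 < 2 ^ w)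
    (hnn : n * n + 1 < 2 ^ w) (hnk : n ^ (k + 2) < 2 ^ w) (hkw : 2 * k + 10 < 2 ^ w)
    (h : HoldsPaths n (s.arr aAdj) (s.real rWt) (s.arr aColor) 1 s) :
    Runs w ω extendPaths s (k * (multiplyTime n d + n * n * 50 + 30) + 10) fun s' =>
      HoldsPaths n (s.arr aAdj) (s.real rWt) (s.arr aColor) (k + 1) s' := by
  refine (Runs.seq (T := 2) (Q := fun s' => s'.var vStep = 1)
    ((Runs.of_loopFree rfl (by simp (disch := omega) [Nat.mod_eq_of_lt])).mono (by decide) fun _ _ h => h)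
    fun s1 h1 hf1 => Runs.loop_const k (fun y s' => s'.var vStep = y + 1 ∧
      HoldsPaths n (s.arr aAdj) (s.real rWt) (s.arr aColor) (y + 1) s')
      (multiplyTime n d + n * n * 50 + 20)
      ⟨h1, h.of_frame hf1 (by decide) (by decide)⟩ ?_ ?_).mono ?_ fun s2 hf2 h => h.2
  · rintro y hy s2 ⟨k1, k2⟩ hf2
    have hk2 : s2.var vCyc = k + 2 := ((hf2.var _ (by decide)).trans (hf1.var _ (by decide))).trans hk
    have hn2 : s2.var vNum = n := ((hf2.var _ (by decide)).trans (hf1.var _ (by decide))).trans hn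
    have hN2 : s2.var vElts = n + n := ((hf2.var _ (by decide)).trans (hf1.var _ (by decide))).trans hN
    have hd2 : s2.var vBlock = d := ((hf2.var _ (by decide)).trans (hf1.var _ (by decide))).trans hd
    have hA : s2.arr aAdj = s.arr aAdj := (hf2.arr _ (by decide)).trans (hf1.arr _ (by decide))
    have hC : s2.arr aColor = s.arr aColor := (hf2.arr _ (by decide)).trans (hf1.arr _ (by decide))
    have hR : s2.real rWt = s.real rWt := (hf2.real _ (by decide)).trans (hf1.real _ (by decide))
    refine ⟨by simp (disch := omega) only [Test.Holds, IntExpr.eval, k1, hk2, Nat.mod_eq_of_lt]; omega, ?_⟩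
    refine (Runs.seq (initLayer_runs hn2 k1 hn0 hnn (by omega)) fun s3 h3 hf3 => Runs.seq
      (multiply_runs (d := d) ((hf3.var _ (by decide)).trans hn2) ((hf3.var _ (by decide)).trans hN2)
        ((hf3.var _ (by decide)).trans hd2) hd0 hn0 hw hnn ?_) (T' := 4) fun s4 h4 hf4 =>
      (Runs.of_loopFree rfl ?_).mono (by decide) fun _ _ h => h).mono (by omega) fun _ _ h => h
    · have k3 := k2.of_frame hf3 (by decide) (by decide)
      refine ⟨fun i hi j hj => ?_, fun i hi j hj => ?_, fun i hi j hj => ?_⟩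
      · have := k3.flag_le hi hj
        omega
      -- The flag of a single edge is `0` or `1`.
      · have := congrArg (fun x => (ofLex x).1) (h3 i hi j hj)
        simp only [cellVal, edgeVal, ofLex_toLex] at this
        have h5 : (s3.arr aFlagB (n * i + j) : ℤ) ≤ 1 := by rw [this]; split <;> simp
        have h6 : s3.arr aFlagB (n * i + j) ≤ 1 := by exact_mod_cast h5
        omega
      · exact ((k3.code_lt hi hj).trans (Nat.pow_le_pow_right hn0 (by omega))).trans_lt hnk
    · rw [hA, hC, hR] at h3
      have k3 := (k2.of_frame hf3 (by decide) (by decide)).succ h3 h4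
      have hst : s4.var vStep = y + 1 :=
        ((hf4.var _ (by decide)).trans (hf3.var _ (by decide))).trans k1
      have hf5 := Frame.of_exec (Exec.of_loopFree (w := w) (ω := ω)
        (p := .assign vStep (.add (.var vStep) (.const 1))) rfl s4).choose_spec.1
      exact ⟨by simp (disch := omega) [hst, Nat.mod_eq_of_lt], k3.of_frame hf5 (by decide) (by decide)⟩
  · rintro s2 ⟨k1, -⟩ hf2
    have hk2 : s2.var vCyc = k + 2 := ((hf2.var _ (by decide)).trans (hf1.var _ (by decide))).trans hk
    simp (disch := omega) only [Test.Holds, IntExpr.eval, k1, hk2, Nat.mod_eq_of_lt]; omega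
  · simp only [Test.cost, IntExpr.cost]
    rw [show multiplyTime n d + n * n * 50 + 20 + (1 + 1 + 1 + 1 + 1) + 1 =
      multiplyTime n d + n * n * 50 + 26 by omega]
    have : k * (multiplyTime n d + n * n * 50 + 26) ≤ k * (multiplyTime n d + n * n * 50 + 30) :=
      Nat.mul_le_mul_left _ (by omega)
    omega

open Classical in
/-- The value of the edge from `a` to `b` that closes a cycle with `m + 1` vertices. -/
noncomputable def closeVal (n : ℕ) (adj : ℕ → ℕ) (wt : ℕ → ℝ) (col : ℕ → ℕ) (m a b : ℕ) : ℤ ×ₗ ℝ :=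
  toLex (if adj (n * a + b) = 1 ∧ col a = m then 1 else 0, wt (n * a + b))

/-- The value of the closed path `x 0, …, x m, x 0`. -/
noncomputable def cycleVal (n : ℕ) (adj : ℕ → ℕ) (wt : ℕ → ℝ) (col : ℕ → ℕ) (m : ℕ) (x : ℕ → ℕ) :
    ℤ ×ₗ ℝ :=
  chainVal n adj wt col m x + closeVal n adj wt col m (x m) (x 0)

/-- The value of the best closed path so far. -/
noncomputable def bestVal (s : State) : ℤ ×ₗ ℝ := toLex ((s.var vBestFlag : ℤ), s.real rBest 0)

/-- The best value so far is that of a closed path, unless it is trivial. -/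
def IsAttained (n : ℕ) (adj : ℕ → ℕ) (wt : ℕ → ℝ) (m : ℕ) (s : State) : Prop :=
  s.var vBestFlag = 0 ∨ ∃ col x : ℕ → ℕ, (∀ t ≤ m, x t < n) ∧
    bestVal s = cycleVal n adj wt col m x ∧ s.var vBestCode = chainCode n x (m + 1)

theorem closeCycle_runs {s : State} {n m u v : ℕ} (hn : s.var vNum = n) (hk : s.var vCyc = m + 1)
    (hx : s.var vIdx = n * u + v) (hu : u < n) (hv : v < n) (hnn : n * n + 1 < 2 ^ w)
    (hF : s.arr aFlagA (n * u + v) + 1 < 2 ^ w)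
    (hcol : s.arr aColor v + 1 < 2 ^ w)
    (hC : s.arr aCodeA (n * u + v) * n + n < 2 ^ w) :
    Runs w ω closeCycle s 100 fun s' => s'.var vIdx = n * u + v + 1 ∧
      ((bestVal s' = bestVal s ∧ s'.var vBestFlag = s.var vBestFlag ∧
          s'.var vBestCode = s.var vBestCode ∧
          cellVal (s.arr aFlagA) (s.real rA) (n * u + v) +
            closeVal n (s.arr aAdj) (s.real rWt) (s.arr aColor) m v u ≤ bestVal s) ∨
        bestVal s ≤ bestVal s' ∧ bestVal s' = cellVal (s.arr aFlagA) (s.real rA) (n * u + v) +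
          closeVal n (s.arr aAdj) (s.real rWt) (s.arr aColor) m v u ∧
          s'.var vBestCode = s.arr aCodeA (n * u + v) * n + v) := by
  have h1 : (n * u + v) / n = u := by
    rw [Nat.mul_add_div (by omega), Nat.div_eq_of_lt hv, add_zero]
  have h2 : (n * u + v) % n = v := by rw [Nat.mul_add_mod, Nat.mod_eq_of_lt hv]
  have h3 := Nat.le_mul_self n
  have h4 := cell_lt hu hv
  have h5 := cell_lt hv hu
  obtain ⟨f, hf⟩ : ∃ f : ℕ, f = s.arr aFlagA (n * u + v) +
      if s.arr aAdj (n * v + u) = 1 ∧ s.arr aColor v = m then 1 else 0 := ⟨_, rfl⟩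
  have hval : cellVal (s.arr aFlagA) (s.real rA) (n * u + v) +
      closeVal n (s.arr aAdj) (s.real rWt) (s.arr aColor) m v u =
      toLex ((f : ℤ), s.real rA (n * u + v) + s.real rWt (n * v + u)) := by
    rw [cellVal, closeVal, ← toLex_add, Prod.mk_add_mk, hf]
    push_cast
    rfl
  rw [hval]
  refine (Runs.seq (T := 50) (Q := fun s' => s'.var vCol = v ∧ s'.var vElt = n * v + u ∧
      s'.var vFlag = f) ((Runs.of_loopFree rfl ?_).mono (by decide) fun _ _ h => h)
      fun s1 ⟨m1, m2, m3⟩ hf1 => (Runs.of_loopFree rfl ?_).mono (show _ ≤ 50 by decide)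
      fun _ _ h => h).mono (by omega) fun _ _ h => h
  · by_cases ha : s.arr aAdj (n * v + u) = 1
    · by_cases hc : s.arr aColor v = m
      · simp (disch := omega) [hx, hn, hk, h1, h2, ha, hc, hf, Nat.mod_eq_of_lt]
      · simp (disch := omega) [hx, hn, hk, h1, h2, ha, hc, hf, Nat.mod_eq_of_lt]
    · simp (disch := omega) [hx, hn, hk, h1, h2, ha, hf, Nat.mod_eq_of_lt]
  · have i1 : s1.var vIdx = n * u + v := (hf1.var _ (by decide)).trans hx
    have i2 : s1.var vNum = n := (hf1.var _ (by decide)).trans hn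
    have i3 : s1.var vBestFlag = s.var vBestFlag := hf1.var _ (by decide)
    have i4 : s1.var vBestCode = s.var vBestCode := hf1.var _ (by decide)
    have i5 : s1.real rA = s.real rA := hf1.real _ (by decide)
    have i6 : s1.real rWt = s.real rWt := hf1.real _ (by decide)
    have i7 : s1.real rBest = s.real rBest := hf1.real _ (by decide)
    have i8 : s1.arr aCodeA = s.arr aCodeA := hf1.arr _ (by decide)
    have i9 : s.arr aCodeA (n * u + v) * n + v < 2 ^ w := by omega
    by_cases hlt : s.var vBestFlag < f ∨ s.var vBestFlag = f ∧
        ¬ s.real rA (n * u + v) + s.real rWt (n * v + u) ≤ s.real rBest 0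
    · simp (disch := omega) [i1, i2, i3, i5, i6, i7, i8, m1, m2, m3, hlt, -not_le,
        bestVal, Nat.mod_eq_of_lt]
      right
      rw [Prod.Lex.toLex_le_toLex]
      rcases hlt with h | ⟨h, h'⟩
      · exact Or.inl (Nat.cast_lt.2 h)
      · exact Or.inr ⟨congrArg Nat.cast h, (not_le.1 h').le⟩
    · simp (disch := omega) [i1, i3, i4, i5, i6, i7, m2, m3, hlt, -not_le,
        bestVal, Nat.mod_eq_of_lt]
      left
      rw [Prod.Lex.toLex_le_toLex]
      by_cases h : s.var vBestFlag = f
      · exact Or.inr ⟨congrArg Nat.cast h.symm, by by_contra h'; exact hlt (Or.inr ⟨h, h'⟩)⟩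
      · have h' : ¬ s.var vBestFlag < f := fun h => hlt (Or.inl h)
        exact Or.inl (Nat.cast_lt.2 (by omega))

theorem bestVal_congr {s s' : State} (h : s'.var vBestFlag = s.var vBestFlag)
    (h' : s'.real rBest = s.real rBest) : bestVal s' = bestVal s := by
  rw [bestVal, bestVal, h, h']

theorem bestVal_of_frame {p : Program} {s s' : State} (hf : Frame p s s')
    (hv : vBestFlag ∉ p.modVars) (hr : rBest ∉ p.modReals) : bestVal s' = bestVal s :=
  bestVal_congr (hf.var _ hv) (hf.real _ hr)

theorem IsAttained.congr {n m : ℕ} {adj : ℕ → ℕ} {wt : ℕ → ℝ} {s s' : State}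
    (h : IsAttained n adj wt m s) (h1 : s'.var vBestFlag = s.var vBestFlag)
    (h2 : bestVal s' = bestVal s) (h3 : s'.var vBestCode = s.var vBestCode) :
    IsAttained n adj wt m s' := by
  rw [IsAttained, h1, h2, h3]; exact h

/-- A closed path `x` is dominated by the entry of the cell `(x 0, x m)` plus the closing edge, so
it is enough to run over the cells. -/
theorem closeCycles_runs {s : State} {n m : ℕ} (hn : s.var vNum = n) (hk : s.var vCyc = m + 1)
    (hn0 : 0 < n) (hnn : n * n + 1 < 2 ^ w) (hnk : n ^ (m + 1) < 2 ^ w) (hkw : m + 1 < 2 ^ w)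
    (hcol : ∀ v < n, s.arr aColor v + 1 < 2 ^ w)
    (h : HoldsPaths n (s.arr aAdj) (s.real rWt) (s.arr aColor) m s)
    (ha : IsAttained n (s.arr aAdj) (s.real rWt) m s) :
    Runs w ω closeCycles s (n * n * 120 + 10) fun s' =>
      IsAttained n (s.arr aAdj) (s.real rWt) m s' ∧ bestVal s ≤ bestVal s' ∧
      ∀ x : ℕ → ℕ, (∀ t ≤ m, x t < n) →
        cycleVal n (s.arr aAdj) (s.real rWt) (s.arr aColor) m x ≤ bestVal s' := by
  have hnn' := Nat.le_mul_self n
  refine (Runs.seq (T := 4) (Q := fun s' => s'.var vIdx = 0)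
    ((Runs.of_loopFree rfl (by simp)).mono (by decide) fun _ _ h => h)
    fun s1 h1 hf1 => Runs.loop_const (n * n) (fun y s' => s'.var vIdx = y ∧
      IsAttained n (s.arr aAdj) (s.real rWt) m s' ∧ bestVal s ≤ bestVal s' ∧
      ∀ u < n, ∀ v < n, n * u + v < y →
        cellVal (s.arr aFlagA) (s.real rA) (n * u + v) +
          closeVal n (s.arr aAdj) (s.real rWt) (s.arr aColor) m v u ≤ bestVal s') 100
      ⟨h1, ha.congr (hf1.var _ (by decide)) (bestVal_of_frame hf1 (by decide) (by decide))
        (hf1.var _ (by decide)), (bestVal_of_frame hf1 (by decide) (by decide)).ge, by simp⟩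
      ?_ ?_).mono ?_ fun s2 hf2 ⟨k1, k2, k3, k4⟩ => ⟨k2, k3, fun x hx => ?_⟩
  · rintro y hy s2 ⟨k1, k2, k3, k4⟩ hf2
    have hn2 : s2.var vNum = n := ((hf2.var _ (by decide)).trans (hf1.var _ (by decide))).trans hn
    have hc2 : s2.var vCyc = m + 1 := ((hf2.var _ (by decide)).trans (hf1.var _ (by decide))).trans hk
    have hA : s2.arr aAdj = s.arr aAdj := (hf2.arr _ (by decide)).trans (hf1.arr _ (by decide))
    have hC : s2.arr aColor = s.arr aColor := (hf2.arr _ (by decide)).trans (hf1.arr _ (by decide))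
    have hF : s2.arr aFlagA = s.arr aFlagA := (hf2.arr _ (by decide)).trans (hf1.arr _ (by decide))
    have hD : s2.arr aCodeA = s.arr aCodeA := (hf2.arr _ (by decide)).trans (hf1.arr _ (by decide))
    have hR : s2.real rWt = s.real rWt := (hf2.real _ (by decide)).trans (hf1.real _ (by decide))
    have hRA : s2.real rA = s.real rA := (hf2.real _ (by decide)).trans (hf1.real _ (by decide))
    refine ⟨by simp (disch := omega) only [Test.Holds, IntExpr.eval, k1, hn2, Nat.mod_eq_of_lt]; omega, ?_⟩
    have hu : y / n < n := Nat.div_lt_of_lt_mul hy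
    have hv : y % n < n := Nat.mod_lt _ hn0
    have huv : n * (y / n) + y % n = y := Nat.div_add_mod y n
    generalize y / n = u at *
    generalize y % n = v at *
    have hfl := h.flag_le hu hv
    refine (closeCycle_runs (m := m) hn2 hc2 (k1.trans huv.symm) hu hv hnn (by rw [hF]; omega)
      (by rw [hC]; exact hcol v hv) (by rw [hD]; exact (h.code_lt hu hv).trans_lt hnk)).mono le_rfl
      fun s3 hf3 ⟨m1, m2⟩ => ?_
    rw [hA, hC, hF, hD, hR, hRA] at m2
    have hnew : ∀ s', bestVal s2 ≤ bestVal s' → cellVal (s.arr aFlagA) (s.real rA) (n * u + v) +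
          closeVal n (s.arr aAdj) (s.real rWt) (s.arr aColor) m v u ≤ bestVal s' →
        ∀ u' < n, ∀ v' < n, n * u' + v' < y + 1 →
        cellVal (s.arr aFlagA) (s.real rA) (n * u' + v') +
          closeVal n (s.arr aAdj) (s.real rWt) (s.arr aColor) m v' u' ≤ bestVal s' := by
      intro s' h1 h2 u' hu' v' hv' hlt
      rcases Nat.lt_succ_iff_lt_or_eq.1 hlt with hlt | he
      · exact (k4 u' hu' v' hv' hlt).trans h1
      · obtain ⟨rfl, rfl⟩ := cell_inj hv' hv (he.trans huv.symm)
        exact h2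
    rcases m2 with ⟨e1, e2, e3, e4⟩ | ⟨e1, e2, e3⟩
    · exact ⟨by rw [m1, huv], k2.congr e2 e1 e3, by rwa [e1], hnew s3 e1.ge (by rwa [e1])⟩
    · refine ⟨by rw [m1, huv], Or.inr ?_, k3.trans e1, hnew s3 e1 e2.ge⟩
      obtain ⟨⟨x, p1, p2, p3, p4, p5⟩, -⟩ := h u hu v hv
      -- The coloring is part of the witness, because the record has to outlive it: later trials
      -- color the vertices anew.
      exact ⟨s.arr aColor, x, p1, by rw [e2, p4, cycleVal, p2, p3], by rw [e3, p5, chainCode, p3]⟩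
  · rintro s2 ⟨k1, -⟩ hf2
    have hn2 : s2.var vNum = n := ((hf2.var _ (by decide)).trans (hf1.var _ (by decide))).trans hn
    simp (disch := omega) only [Test.Holds, IntExpr.eval, k1, hn2, Nat.mod_eq_of_lt]; omega
  · simp only [Test.cost, IntExpr.cost]; omega
  · have h0 := hx 0 (by omega)
    have hm := hx m le_rfl
    exact (add_le_add_left ((h (x 0) h0 (x m) hm).2 x hx rfl rfl) _).trans
      (k4 _ h0 _ hm (cell_lt h0 hm))

/-- The assumptions on the word length. -/
structure WordBound (n d k w : ℕ) : Prop where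
  product : 2 * ((d + 2) * (3 ^ d * 3 ^ Nat.clog 2 (n + n))) + 4 * (n + n) + 20 < 2 ^ w
  square : n * n + 1 < 2 ^ w
  code : n ^ (k + 3) < 2 ^ w
  length : 2 * k + 20 < 2 ^ w

/-- A bound for the time of one trial. -/
def trialTime (n d k : ℕ) : ℕ :=
  n * (k * 20 + 100) + k * (multiplyTime n d + n * n * 50 + 30) + multiplyTime n d + n * n * 250 + 100

/-- The bound is stated for every function `col` that agrees with the coin counts on the vertices.
It thus refers to the coins alone, and stays meaningful when the color array is overwritten. -/
theorem trial_runs {s : State} {n d k : ℕ} (hk : s.var vCyc = k + 3) (hn : s.var vNum = n)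
    (hN : s.var vElts = n + n) (hd : s.var vBlock = d) (hd0 : 0 < d) (hn0 : 0 < n)
    (hw : WordBound n d k w) (ha : IsAttained n (s.arr aAdj) (s.real rWt) (k + 2) s) :
    Runs w ω trial s (trialTime n d k) fun s' => s'.coins = s.coins + n * (k + 3) ∧
      IsAttained n (s.arr aAdj) (s.real rWt) (k + 2) s' ∧ bestVal s ≤ bestVal s' ∧
      ∀ (col x : ℕ → ℕ), (∀ v < n, col v = heads ω (s.coins + v * (k + 3)) (k + 3)) →
        (∀ t ≤ k + 2, x t < n) →
        cycleVal n (s.arr aAdj) (s.real rWt) col (k + 2) x ≤ bestVal s' := by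
  obtain ⟨w1, w2, w3, w4⟩ := hw
  refine (Runs.seq (colorVertices_runs hn hk (by omega) (by omega)) fun s1 h1 hf1 =>
    Runs.seq (initPaths_runs ((hf1.var _ (by decide)).trans hn) hn0 w2) fun s2 h2 hf2 =>
    Runs.seq (extendPaths_runs (d := d) (k := k + 1) ?_ ?_ ?_ ?_ hd0 hn0 w1 w2 w3 (by omega) ?_)
      fun s3 h3 hf3 => (closeCycles_runs (n := n) (m := k + 2) ?_ ?_ hn0 w2 w3 (by omega) ?_ ?_ ?_).mono
      le_rfl (Q' := fun s' => s'.coins = s.coins + n * (k + 3) ∧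
      IsAttained n (s.arr aAdj) (s.real rWt) (k + 2) s' ∧ bestVal s ≤ bestVal s' ∧
      ∀ (col x : ℕ → ℕ), (∀ v < n, col v = heads ω (s.coins + v * (k + 3)) (k + 3)) →
        (∀ t ≤ k + 2, x t < n) →
        cycleVal n (s.arr aAdj) (s.real rWt) col (k + 2) x ≤ bestVal s')
      fun s4 hf4 ⟨h4, h5, h6⟩ => ?_).mono ?_ fun _ _ h => h
  · exact ((hf2.var _ (by decide)).trans (hf1.var _ (by decide))).trans hk
  · exact ((hf2.var _ (by decide)).trans (hf1.var _ (by decide))).trans hn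
  · exact ((hf2.var _ (by decide)).trans (hf1.var _ (by decide))).trans hN
  · exact ((hf2.var _ (by decide)).trans (hf1.var _ (by decide))).trans hd
  · rw [hf2.arr aAdj (by decide), hf2.real rWt (by decide), hf2.arr aColor (by decide)]; exact h2
  · exact (((hf3.var _ (by decide)).trans (hf2.var _ (by decide))).trans (hf1.var _ (by decide))).trans hn
  · exact (((hf3.var _ (by decide)).trans (hf2.var _ (by decide))).trans (hf1.var _ (by decide))).trans hk
  · intro v hv
    rw [hf3.arr aColor (by decide), hf2.arr aColor (by decide), h1.1 v hv]
    have := heads_le (ω := ω) (s.coins + v * (k + 3)) (k + 3)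
    omega
  · rw [hf3.arr aAdj (by decide), hf3.real rWt (by decide), hf3.arr aColor (by decide)]; exact h3
  · rw [hf3.arr aAdj (by decide), hf3.real rWt (by decide), hf2.arr aAdj (by decide),
      hf2.real rWt (by decide), hf1.arr aAdj (by decide), hf1.real rWt (by decide)]
    exact ((ha.congr (hf1.var _ (by decide)) (bestVal_of_frame hf1 (by decide) (by decide))
      (hf1.var _ (by decide))).congr (hf2.var _ (by decide))
      (bestVal_of_frame hf2 (by decide) (by decide)) (hf2.var _ (by decide))).congr
      (hf3.var _ (by decide)) (bestVal_of_frame hf3 (by decide) (by decide)) (hf3.var _ (by decide))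
  · rw [hf3.arr aAdj (by decide), hf3.real rWt (by decide), hf2.arr aAdj (by decide),
      hf2.real rWt (by decide), hf1.arr aAdj (by decide), hf1.real rWt (by decide)] at h4 h6
    rw [hf3.arr aColor (by decide), hf2.arr aColor (by decide)] at h6
    rw [bestVal_of_frame hf3 (by decide) (by decide), bestVal_of_frame hf2 (by decide) (by decide),
      bestVal_of_frame hf1 (by decide) (by decide)] at h5
    refine ⟨by rw [hf4.coins rfl, hf3.coins rfl, hf2.coins rfl, h1.2], h4, h5, fun col x hcol hx => ?_⟩
    refine le_trans (le_of_eq ?_) (h6 x hx)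
    have hval : ∀ t ≤ k + 2, col (x t) = s1.arr aColor (x t) := fun t ht => by
      rw [hcol _ (hx t ht), h1.1 _ (hx t ht)]
    rw [cycleVal, cycleVal, chainVal, chainVal, closeVal, closeVal, hval _ le_rfl]
    congr 1
    refine Finset.sum_congr rfl fun t ht => ?_
    have := Finset.mem_range.1 ht
    rw [edgeVal, edgeVal, hval t (by omega), hval (t + 1) (by omega)]
  · rw [trialTime]
    have e1 : n * ((k + 3) * 20 + 30) = n * (k * 20 + 100) - n * 10 := by
      rw [← Nat.mul_sub]; congr 1; omega
    have e2 : (k + 1) * (multiplyTime n d + n * n * 50 + 30) =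
      k * (multiplyTime n d + n * n * 50 + 30) + (multiplyTime n d + n * n * 50 + 30) := by ring
    have e3 : n * 10 ≤ n * (k * 20 + 100) := Nat.mul_le_mul_left _ (by omega)
    rw [e1, e2]
    have := Nat.le_mul_self n
    omega

end WordRAM


namespace WordRAM
open Dominance

/-! ### The algorithm -/

/-- The block length is one more than the logarithm of `n` to base `65536 = 2 ^ 16`, found by
repeated multiplication. -/
def initBlock : Program :=
  (.assign vElts (.add (.var vNum) (.var vNum)) ;;
   .assign vPow (.const 65536) ;; .assign vBlock (.const 1)) ;;
  .while (.not (.lt (.var vNum) (.var vPow)))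
    (.assign vPow (.mul (.var vPow) (.const 65536)) ;;
     .assign vBlock (.add (.var vBlock) (.const 1)))

def round : Program :=
  .assign vTrial (.const 0) ;;
  .while (.lt (.var vTrial) (.var vTrials)) (trial ;; .assign vTrial (.add (.var vTrial) (.const 1)))

/-- Two nested counters are used because the total number `r * 2 ^ (K * K)` of trials may not fit
into a word. -/
def rounds : Program :=
  .assign vRound (.const 0) ;;
  .while (.lt (.var vRound) (.var vConf)) (round ;; .assign vRound (.add (.var vRound) (.const 1)))

/-- The last digit of the code is the last vertex, so the cycle is written backwards. The graph is
undirected, so this does no harm. -/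
def writeCycle : Program :=
  .assign vIdx (.const 0) ;;
  .while (.lt (.var vIdx) (.var vCyc))
    (.store aOut (.var vIdx) (.mod (.var vBestCode) (.var vNum)) ;;
     .assign vBestCode (.div (.var vBestCode) (.var vNum)) ;;
     .assign vIdx (.add (.var vIdx) (.const 1))) ;;
  .assign vOut (.const 1)

def output : Program := .ite (.eq (.var vBestFlag) (.var vCyc)) writeCycle (.assign vOut (.const 0))

def search : Program := initBlock ;; rounds ;; output

/-- The algorithm for cycles with `k + 3` vertices. -/
def cycleProgram (k : ℕ) : Program :=
  (.assign vCyc (.const (k + 3)) ;; .assign vTrials (.const (2 ^ ((k + 3) * (k + 3))))) ;; search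

variable {w : ℕ} {ω : ℕ → Bool}

theorem initBlock_runs {s : State} {n : ℕ} (hn : s.var vNum = n) (hn0 : 0 < n)
    (hw : 65536 * n < 2 ^ w) :
    Runs w ω initBlock s (n * 20 + 20) fun s' =>
      s'.var vElts = n + n ∧ s'.var vBlock = Nat.log 65536 n + 1 := by
  have hiff : ∀ y, y < Nat.log 65536 n ↔ 65536 ^ (y + 1) ≤ n := fun y =>
    Nat.le_log_iff_pow_le (by norm_num) hn0.ne'
  have hlog : Nat.log 65536 n ≤ n := Nat.log_le_self _ _
  refine (Runs.seq (T := 10) (Q := fun s' => s'.var vElts = n + n ∧ s'.var vPow = 65536 ∧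
      s'.var vBlock = 1)
    ((Runs.of_loopFree rfl (by simp (disch := omega) [hn, Nat.mod_eq_of_lt])).mono (by decide)
      fun _ _ h => h)
    fun s1 h1 hf1 => Runs.loop_const (Nat.log 65536 n) (fun y s' => s'.var vElts = n + n ∧
      s'.var vPow = 65536 ^ (y + 1) ∧ s'.var vBlock = y + 1) 12
      ⟨h1.1, by simpa using h1.2.1, h1.2.2⟩ ?_ ?_).mono ?_ fun _ _ h => ⟨h.1, h.2.2⟩
  · rintro y hy s2 ⟨k1, k2, k3⟩ hf2
    have hn2 : s2.var vNum = n := ((hf2.var _ (by decide)).trans (hf1.var _ (by decide))).trans hn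
    have hle := (hiff y).1 hy
    have hs : 65536 ^ (y + 1 + 1) = 65536 ^ (y + 1) * 65536 := pow_succ _ _
    refine ⟨by simp only [Test.Holds, IntExpr.eval, k2, hn2]; omega, ?_⟩
    refine (Runs.of_loopFree rfl ?_).mono (by decide) fun _ _ h => h
    rw [hs]
    generalize 65536 ^ (y + 1) = p at *
    simp (disch := omega) [k1, k2, k3, Nat.mod_eq_of_lt]
  · rintro s2 ⟨k1, k2, k3⟩ hf2
    have hn2 : s2.var vNum = n := ((hf2.var _ (by decide)).trans (hf1.var _ (by decide))).trans hn
    have := (hiff (Nat.log 65536 n)).not.1 (lt_irrefl _)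
    simp only [Test.Holds, IntExpr.eval, k2, hn2]; omega
  · simp only [Test.cost, IntExpr.cost]; omega

/-- The parameters and the input are in place. -/
structure IsReady (n d k : ℕ) (adj : ℕ → ℕ) (wt : ℕ → ℝ) (s : State) : Prop where
  cyc : s.var vCyc = k + 3
  trials : s.var vTrials = 2 ^ ((k + 3) * (k + 3))
  num : s.var vNum = n
  elts : s.var vElts = n + n
  block : s.var vBlock = d
  adj_eq : s.arr aAdj = adj
  wt_eq : s.real rWt = wt

theorem IsReady.of_frame {p : Program} {n d k : ℕ} {adj : ℕ → ℕ} {wt : ℕ → ℝ} {s s' : State}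
    (h : IsReady n d k adj wt s) (hf : Frame p s s')
    (hv : vCyc ∉ p.modVars ∧ vTrials ∉ p.modVars ∧ vNum ∉ p.modVars ∧ vElts ∉ p.modVars ∧
      vBlock ∉ p.modVars) (ha : aAdj ∉ p.modArrs) (hr : rWt ∉ p.modReals) :
    IsReady n d k adj wt s' :=
  ⟨(hf.var _ hv.1).trans h.cyc, (hf.var _ hv.2.1).trans h.trials, (hf.var _ hv.2.2.1).trans h.num,
    (hf.var _ hv.2.2.2.1).trans h.elts, (hf.var _ hv.2.2.2.2).trans h.block,
    (hf.arr _ ha).trans h.adj_eq, (hf.real _ hr).trans h.wt_eq⟩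

/-- The state after `M` trials. -/
structure HoldsBest (n k : ℕ) (adj : ℕ → ℕ) (wt : ℕ → ℝ) (ω : ℕ → Bool) (M : ℕ) (s : State) :
    Prop where
  coins : s.coins = M * (n * (k + 3))
  attained : IsAttained n adj wt (k + 2) s
  tried : ∀ τ < M, ∀ col x : ℕ → ℕ,
    (∀ v < n, col v = heads ω (τ * (n * (k + 3)) + v * (k + 3)) (k + 3)) →
    (∀ t ≤ k + 2, x t < n) → cycleVal n adj wt col (k + 2) x ≤ bestVal s

theorem HoldsBest.of_frame {p : Program} {n k M : ℕ} {adj : ℕ → ℕ} {wt : ℕ → ℝ} {s s' : State}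
    (h : HoldsBest n k adj wt ω M s) (hf : Frame p s s')
    (hv : vBestFlag ∉ p.modVars ∧ vBestCode ∉ p.modVars) (hr : rBest ∉ p.modReals)
    (hc : p.flips = false) : HoldsBest n k adj wt ω M s' := by
  have hb := bestVal_of_frame hf hv.1 hr
  exact ⟨(hf.coins hc).trans h.coins, h.attained.congr (hf.var _ hv.1) hb (hf.var _ hv.2),
    by rw [hb]; exact h.tried⟩

theorem round_runs {s : State} {n d k M : ℕ} {adj : ℕ → ℕ} {wt : ℕ → ℝ}
    (hs : IsReady n d k adj wt s) (hd0 : 0 < d) (hn0 : 0 < n) (hw : WordBound n d k w)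
    (hT : 2 ^ ((k + 3) * (k + 3)) < 2 ^ w) (h : HoldsBest n k adj wt ω M s) :
    Runs w ω round s (2 ^ ((k + 3) * (k + 3)) * (trialTime n d k + 10) + 10)
      fun s' => HoldsBest n k adj wt ω (M + 2 ^ ((k + 3) * (k + 3))) s' := by
  have hT0 : 0 < 2 ^ ((k + 3) * (k + 3)) := by positivity
  obtain ⟨T, hTT⟩ : ∃ T, 2 ^ ((k + 3) * (k + 3)) = T := ⟨_, rfl⟩
  refine (Runs.seq (T := 2) (Q := fun s' => s'.var vTrial = 0)
    ((Runs.of_loopFree rfl (by simp)).mono (by decide) fun _ _ h => h)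
    fun s1 h1 hf1 => Runs.loop_const (2 ^ ((k + 3) * (k + 3))) (fun y s' => s'.var vTrial = y ∧
      HoldsBest n k adj wt ω (M + y) s') (trialTime n d k + 4)
      ⟨h1, h.of_frame hf1 (by decide) (by decide) rfl⟩ ?_ ?_).mono ?_ fun _ _ h => h.2
  · rintro y hy s2 ⟨k1, k2⟩ hf2
    have hs2 := (hs.of_frame hf1 (by decide) (by decide) (by decide)).of_frame hf2 (by decide)
      (by decide) (by decide)
    refine ⟨by simp only [Test.Holds, IntExpr.eval, k1, hs2.trials]; exact hy, ?_⟩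
    refine (Runs.seq (trial_runs (d := d) hs2.cyc hs2.num hs2.elts hs2.block hd0 hn0 hw
      (by rw [hs2.adj_eq, hs2.wt_eq]; exact k2.attained)) (T' := 4) fun s3 ⟨m1, m2, m3, m4⟩ hf3 =>
      (Runs.of_loopFree rfl ?_).mono (by decide) fun _ _ h => h).mono le_rfl fun _ _ h => h
    have ht : s3.var vTrial = y := (hf3.var _ (by decide)).trans k1
    rw [hs2.adj_eq, hs2.wt_eq] at m2 m4
    have hbest : HoldsBest n k adj wt ω (M + (y + 1)) s3 := by
      refine ⟨by rw [m1, k2.coins]; ring, m2, fun τ hτ col x hcol hx => ?_⟩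
      rcases Nat.lt_succ_iff_lt_or_eq.1 (show τ < M + y + 1 by omega) with hlt | rfl
      · exact (k2.tried τ hlt col x hcol hx).trans m3
      · exact m4 col x (by rw [k2.coins]; exact hcol) hx
    have hf4 := Frame.of_exec (Exec.of_loopFree (w := w) (ω := ω)
      (p := .assign vTrial (.add (.var vTrial) (.const 1))) rfl s3).choose_spec.1
    refine ⟨?_, hbest.of_frame hf4 (by decide) (by decide) rfl⟩
    rw [hTT] at hT hy
    simp (disch := omega) [ht, Nat.mod_eq_of_lt]
  · rintro s2 ⟨k1, -⟩ hf2
    have hs2 := (hs.of_frame hf1 (by decide) (by decide) (by decide)).of_frame hf2 (by decide)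
      (by decide) (by decide)
    simp only [Test.Holds, IntExpr.eval, k1, hs2.trials]; exact lt_irrefl _
  · simp only [Test.cost, IntExpr.cost]
    rw [show trialTime n d k + 4 + (1 + 1 + 1) + 1 = trialTime n d k + 8 by omega]
    have := Nat.mul_le_mul_left (2 ^ ((k + 3) * (k + 3))) (show trialTime n d k + 8 ≤
      trialTime n d k + 10 by omega)
    omega

theorem rounds_runs {s : State} {n d k r : ℕ} {adj : ℕ → ℕ} {wt : ℕ → ℝ}
    (hs : IsReady n d k adj wt s) (hr : s.var vConf = r) (hrw : r < 2 ^ w)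
    (hd0 : 0 < d) (hn0 : 0 < n) (hw : WordBound n d k w)
    (hT : 2 ^ ((k + 3) * (k + 3)) < 2 ^ w) (h : HoldsBest n k adj wt ω 0 s) :
    Runs w ω rounds s (r * (2 ^ ((k + 3) * (k + 3)) * (trialTime n d k + 10) + 20) + 10)
      fun s' => HoldsBest n k adj wt ω (r * 2 ^ ((k + 3) * (k + 3))) s' := by
  have hwl := hw.length
  refine (Runs.seq (T := 2) (Q := fun s' => s'.var vRound = 0)
    ((Runs.of_loopFree rfl (by simp)).mono (by decide) fun _ _ h => h)
    fun s1 h1 hf1 => Runs.loop_const r (fun y s' => s'.var vRound = y ∧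
      HoldsBest n k adj wt ω (y * 2 ^ ((k + 3) * (k + 3))) s')
      (2 ^ ((k + 3) * (k + 3)) * (trialTime n d k + 10) + 10 + 4)
      ⟨h1, by rw [zero_mul]; exact h.of_frame hf1 (by decide) (by decide) rfl⟩ ?_ ?_).mono ?_
      fun _ _ h => h.2
  · rintro y hy s2 ⟨k1, k2⟩ hf2
    have hs2 := (hs.of_frame hf1 (by decide) (by decide) (by decide)).of_frame hf2 (by decide)
      (by decide) (by decide)
    have hr2 : s2.var vConf = r := ((hf2.var _ (by decide)).trans (hf1.var _ (by decide))).trans hr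
    refine ⟨by simp only [Test.Holds, IntExpr.eval, k1, hr2]; exact hy, ?_⟩
    refine (Runs.seq (round_runs hs2 hd0 hn0 hw hT k2) (T' := 4) fun s3 h3 hf3 =>
      (Runs.of_loopFree rfl ?_).mono (by decide) fun _ _ h => h).mono le_rfl fun _ _ h => h
    have ht : s3.var vRound = y := (hf3.var _ (by decide)).trans k1
    have hf4 := Frame.of_exec (Exec.of_loopFree (w := w) (ω := ω)
      (p := .assign vRound (.add (.var vRound) (.const 1))) rfl s3).choose_spec.1
    refine ⟨by simp (disch := omega) [ht, Nat.mod_eq_of_lt], ?_⟩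
    rw [add_mul, one_mul]
    exact h3.of_frame hf4 (by decide) (by decide) rfl
  · rintro s2 ⟨k1, -⟩ hf2
    have hr2 : s2.var vConf = r := ((hf2.var _ (by decide)).trans (hf1.var _ (by decide))).trans hr
    simp only [Test.Holds, IntExpr.eval, k1, hr2]; exact lt_irrefl _
  · simp only [Test.cost, IntExpr.cost]
    generalize 2 ^ ((k + 3) * (k + 3)) * (trialTime n d k + 10) = X
    have := Nat.mul_le_mul_left r (show X + 10 + 4 + (1 + 1 + 1) + 1 ≤ X + 20 by omega)
    omega

theorem writeCycle_runs {s : State} {n k c : ℕ} (hn : s.var vNum = n) (hk : s.var vCyc = k)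
    (hc : s.var vBestCode = c) (hcw : c < 2 ^ w) (hkw : k + 1 < 2 ^ w) :
    Runs w ω writeCycle s (k * 30 + 20) fun s' =>
      s'.var vOut = 1 ∧ ∀ i < k, s'.arr aOut i = c / n ^ i % n := by
  refine (Runs.seq (T := 2) (Q := fun s' => s'.var vIdx = 0)
    ((Runs.of_loopFree rfl (by simp)).mono (by decide) fun _ _ h => h)
    fun s1 h1 hf1 => Runs.seq (Runs.loop_const k (fun y s' => s'.var vIdx = y ∧
      s'.var vBestCode = c / n ^ y ∧ ∀ i < y, s'.arr aOut i = c / n ^ i % n) 20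
      ⟨h1, by rw [hf1.var _ (by decide), hc]; simp, by simp⟩ ?_ ?_) (T' := 4) fun s2 h2 hf2 =>
      (Runs.of_loopFree rfl ?_).mono (by decide) fun _ _ h => h).mono ?_ fun _ _ h => h
  · rintro y hy s2 ⟨k1, k2, k3⟩ hf2
    have hn2 : s2.var vNum = n := ((hf2.var _ (by decide)).trans (hf1.var _ (by decide))).trans hn
    have hk2 : s2.var vCyc = k := ((hf2.var _ (by decide)).trans (hf1.var _ (by decide))).trans hk
    refine ⟨by simp only [Test.Holds, IntExpr.eval, k1, hk2]; exact hy, ?_⟩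
    refine (Runs.of_loopFree rfl ?_).mono (by decide) fun _ _ h => h
    have b0 : c / n ^ y ≤ c := Nat.div_le_self _ _
    have b1 : c / n ^ y % n < 2 ^ w := lt_of_le_of_lt (Nat.mod_le _ _) (by omega)
    have b2 : c / n ^ y / n < 2 ^ w := lt_of_le_of_lt (Nat.div_le_self _ _) (by omega)
    refine ⟨by simp (disch := omega) [k1, Nat.mod_eq_of_lt], ?_, fun i hi => ?_⟩
    · rw [pow_succ, ← Nat.div_div_eq_div_mul]
      simp [k2, hn2, Nat.mod_eq_of_lt b2]
    · rcases Nat.lt_succ_iff_lt_or_eq.1 hi with hlt | rfl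
      · simpa [k1, hlt.ne] using k3 i hlt
      · simp [k1, k2, hn2, Nat.mod_eq_of_lt b1]
  · rintro s2 ⟨k1, -⟩ hf2
    have hk2 : s2.var vCyc = k := ((hf2.var _ (by decide)).trans (hf1.var _ (by decide))).trans hk
    simp only [Test.Holds, IntExpr.eval, k1, hk2]; exact lt_irrefl _
  · exact ⟨by simp (disch := omega) [Nat.mod_eq_of_lt], fun i hi => by simpa using h2.2.2 i hi⟩
  · simp only [Test.cost, IntExpr.cost]; omega

/-- A bound for the time of the algorithm. -/
def searchTime (n r k : ℕ) : ℕ :=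
  r * (2 ^ ((k + 3) * (k + 3)) * (trialTime n (Nat.log 65536 n + 1) k + 10) + 20) + n * 20 + k * 30 + 200

/-- `s₁` is the state after all trials. The output depends on it only through the best flag and the
best code. -/
theorem cycleProgram_runs {s : State} {n r k : ℕ} (hn : s.var vNum = n) (hr : s.var vConf = r)
    (hb : s.var vBestFlag = 0) (hc : s.coins = 0)
    (hrw : r < 2 ^ w) (hn0 : 0 < n) (hw : WordBound n (Nat.log 65536 n + 1) k w)
    (hT : 2 ^ ((k + 3) * (k + 3)) < 2 ^ w) (hnw : 65536 * n < 2 ^ w) :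
    Runs w ω (cycleProgram k) s (searchTime n r k) fun s' => ∃ s₁ : State,
      HoldsBest n k (s.arr aAdj) (s.real rWt) ω (r * 2 ^ ((k + 3) * (k + 3))) s₁ ∧
      (s₁.var vBestFlag = k + 3 → s'.var vOut = 1 ∧
        ∀ i < k + 3, s'.arr aOut i = s₁.var vBestCode / n ^ i % n) ∧
      (s₁.var vBestFlag ≠ k + 3 → s'.var vOut = 0) := by
  have hlen := hw.length
  -- A frame only sees which names are written, so the constants `0` can stand for the actual
  -- values.
  have hframe : ∀ s', Frame (.assign vCyc (.const 0) ;; .assign vTrials (.const 0)) s s' →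
      s'.var vNum = n ∧ s'.var vConf = r ∧ s'.var vBestFlag = 0 ∧ s'.coins = 0 ∧
      s'.arr aAdj = s.arr aAdj ∧ s'.real rWt = s.real rWt := fun s' hf =>
    ⟨(hf.var _ (by decide)).trans hn, (hf.var _ (by decide)).trans hr,
      (hf.var _ (by decide)).trans hb, (hf.coins rfl).trans hc, hf.arr _ (by decide),
      hf.real _ (by decide)⟩
  refine (Runs.seq (T := 4) (Q := fun s' => s'.var vCyc = k + 3 ∧
      s'.var vTrials = 2 ^ ((k + 3) * (k + 3)))
    ((Runs.of_loopFree rfl ?_).mono le_rfl fun _ _ h => h)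
    fun s1 ⟨h1, h1'⟩ hf1 => Runs.seq (initBlock_runs (n := n) ?_ hn0 hnw) fun s2 ⟨h2, h2'⟩ hf2 =>
      Runs.seq (rounds_runs (d := Nat.log 65536 n + 1) (k := k) (r := r) (adj := s.arr aAdj)
        (wt := s.real rWt) ?_ ?_ hrw (Nat.succ_pos _) hn0 hw hT ?_)
        (T' := k * 30 + 150) fun s3 h3 hf3 => Runs.mono (Q := fun s' =>
          (s3.var vBestFlag = k + 3 → s'.var vOut = 1 ∧
            ∀ i < k + 3, s'.arr aOut i = s3.var vBestCode / n ^ i % n) ∧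
          (s3.var vBestFlag ≠ k + 3 → s'.var vOut = 0))
        (Runs.ite (T := k * 30 + 120) (fun htest => (writeCycle_runs (n := n) (k := k + 3)
          (c := s3.var vBestCode) ?_ ?_ rfl ?_ ?_).mono ?_ ?_)
        fun htest => ?_) ?_ fun s' _ h' => ⟨s3, h3, h'⟩).mono ?_ fun _ _ h => h
  · simp (disch := omega) [Nat.mod_eq_of_lt hT, Nat.mod_eq_of_lt]
  · exact (hframe s1 ⟨hf1.1, hf1.2, hf1.3, hf1.4⟩).1
  · obtain ⟨f1, f2, f3, f4, f5, f6⟩ := hframe s1 ⟨hf1.1, hf1.2, hf1.3, hf1.4⟩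
    exact ⟨(hf2.var _ (by decide)).trans h1, (hf2.var _ (by decide)).trans h1',
      (hf2.var _ (by decide)).trans f1, h2, h2', (hf2.arr _ (by decide)).trans f5,
      (hf2.real _ (by decide)).trans f6⟩
  · exact (hf2.var _ (by decide)).trans (hframe s1 ⟨hf1.1, hf1.2, hf1.3, hf1.4⟩).2.1
  · obtain ⟨f1, f2, f3, f4, f5, f6⟩ := hframe s1 ⟨hf1.1, hf1.2, hf1.3, hf1.4⟩
    exact ⟨by rw [hf2.coins rfl, f4, zero_mul], Or.inl ((hf2.var _ (by decide)).trans f3),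
      fun τ hτ => by omega⟩
  · rw [hf3.var _ (by decide), hf2.var _ (by decide)]; exact (hframe s1 ⟨hf1.1, hf1.2, hf1.3, hf1.4⟩).1
  · rw [hf3.var _ (by decide), hf2.var _ (by decide), h1]
  -- The code is known to fit into a word only if it belongs to a closed path. The other case of
  -- `IsAttained` has flag `0` and fails the test.
  · rcases h3.attained with h | ⟨col, x, hx, -, hcode⟩
    · have hk : s3.var vCyc = k + 3 := by rw [hf3.var _ (by decide), hf2.var _ (by decide), h1]
      simp [h, hk] at htest
    · rw [hcode]
      exact (chainCode_lt fun t ht => hx t (by omega)).trans hw.code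
  · omega
  · omega
  · intro s' _ ⟨g1, g2⟩
    have hk : s3.var vCyc = k + 3 := by rw [hf3.var _ (by decide), hf2.var _ (by decide), h1]
    have : s3.var vBestFlag = k + 3 := by simpa [hk] using htest
    exact ⟨fun _ => ⟨g1, g2⟩, fun h => absurd this h⟩
  · have hk : s3.var vCyc = k + 3 := by rw [hf3.var _ (by decide), hf2.var _ (by decide), h1]
    have : s3.var vBestFlag ≠ k + 3 := by simpa [hk] using htest
    exact (Runs.of_loopFree rfl ⟨fun h => absurd h this, fun _ => by simp⟩).mono
      (le_trans (show _ ≤ 10 by decide) (by omega)) fun _ _ h => h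
  · simp only [Test.cost, IntExpr.cost]; omega
  · rw [searchTime]; omega

end WordRAM


namespace WordRAM
open MeasureTheory ProbabilityTheory

/-! ### The probability of failure -/

instance : IsProbabilityMeasure coinMeasure := by
  unfold coinMeasure; infer_instance

/-- The coins that decide the colors of `x 0, …, x (K - 1)` in trial `τ`. -/
def colorCoins (n K : ℕ) (x : ℕ → ℕ) (τ : ℕ) : Finset ℕ :=
  (Finset.range K ×ˢ Finset.range K).image fun q => (τ * n + x q.1) * K + q.2

/-- The number of a coin has trial, vertex and flip as its digits in mixed radix. -/
theorem colorCoins_inj {n K τ τ' t t' b b' : ℕ} {x : ℕ → ℕ} (hx : ∀ t < K, x t < n)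
    (hinj : ∀ t < K, ∀ t' < K, x t = x t' → t = t') (ht : t < K) (ht' : t' < K) (hb : b < K)
    (hb' : b' < K) (h : (τ * n + x t) * K + b = (τ' * n + x t') * K + b') :
    τ = τ' ∧ t = t' ∧ b = b' := by
  have h1 : τ * n + x t = τ' * n + x t' ∧ b = b' := cell_inj hb hb' (by linarith)
  have h2 : τ = τ' ∧ x t = x t' := cell_inj (hx t ht) (hx t' ht') (by linarith [h1.1])
  exact ⟨h2.1, hinj t ht t' ht' h2.2, h1.2⟩

theorem coinMeasure_pi (s : Finset ℕ) (f : ℕ → Bool) :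
    coinMeasure (Set.pi s fun c => {f c}) = (2⁻¹ : ENNReal) ^ s.card := by
  rw [coinMeasure, Measure.infinitePi_pi _ (fun i _ => MeasurableSet.singleton _)]
  rw [Finset.prod_congr rfl fun c _ => PMF.toMeasure_apply_singleton _ (f c) (MeasurableSet.singleton _)]
  simp

/-- Trial after trial, the patterns of disjoint sets of coins are independent. -/
theorem coinMeasure_iInter_compl_pi {I : ℕ → Finset ℕ} {m M : ℕ} (f : ℕ → Bool)
    (hcard : ∀ τ, (I τ).card = m) (hdisj : Pairwise fun τ τ' => Disjoint (I τ) (I τ')) :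
    coinMeasure (⋂ τ ∈ Finset.range M, (Set.pi (I τ) fun c => {f c})ᶜ)
      = (1 - (2⁻¹ : ENNReal) ^ m) ^ M := by
  classical
  have hmeas : ∀ τ, MeasurableSet (Set.pi (I τ : Set ℕ) fun c => ({f c} : Set Bool)) := fun τ =>
    MeasurableSet.pi (I τ).countable_toSet fun _ _ => MeasurableSet.singleton _
  have hind : iIndepSet (fun τ => Set.pi (I τ : Set ℕ) fun c => ({f c} : Set Bool)) coinMeasure := by
    rw [iIndepSet_iff_meas_biInter hmeas]
    intro s
    have h1 : (⋂ τ ∈ s, Set.pi (I τ : Set ℕ) fun c => ({f c} : Set Bool)) =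
        Set.pi (s.biUnion I : Finset ℕ) fun c => ({f c} : Set Bool) := by
      ext ω
      simp only [Set.mem_iInter, Set.mem_pi, Finset.mem_coe, Finset.mem_biUnion]
      exact ⟨fun h c ⟨τ, h1, h2⟩ => h τ h1 c h2, fun h τ h1 c h2 => h c ⟨τ, h1, h2⟩⟩
    rw [h1, coinMeasure_pi, Finset.card_biUnion fun τ _ τ' _ h => hdisj h, ← Finset.prod_pow_eq_pow_sum]
    exact Finset.prod_congr rfl fun τ _ => (coinMeasure_pi _ _).symm
  rw [iIndep.meas_biInter hind fun τ _ => ?_]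
  · simp only [prob_compl_eq_one_sub (hmeas _), coinMeasure_pi, hcard, Finset.prod_const,
      Finset.card_range]
  · exact (MeasurableSpace.measurableSet_generateFrom (Set.mem_singleton _)).compl

theorem one_sub_inv_pow_le_exp (T r : ℕ) (hT : 0 < T) :
    (1 - 1 / (T : ℝ)) ^ (r * T) ≤ Real.exp (-(r : ℝ)) := by
  have hT' : (0 : ℝ) < T := by exact_mod_cast hT
  have h1 : (1 : ℝ) / T ≤ 1 := by
    rw [div_le_one hT']; exact_mod_cast hT
  calc (1 - 1 / (T : ℝ)) ^ (r * T) ≤ Real.exp (-(1 / (T : ℝ))) ^ (r * T) :=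
        pow_le_pow_left₀ (by linarith) (Real.one_sub_le_exp_neg _) _
    _ = Real.exp (-(r : ℝ)) := by
        rw [← Real.exp_nat_mul]
        congr 1
        push_cast
        field_simp

/-- The event that no trial colors `x 0, …, x (K - 1)` with `0, …, K - 1`. -/
theorem coinMeasure_forall_ne_le {n K r : ℕ} {x : ℕ → ℕ} (hx : ∀ t < K, x t < n)
    (hinj : ∀ t < K, ∀ t' < K, x t = x t' → t = t') :
    coinMeasure {ω | ∀ τ < r * 2 ^ (K * K), ∃ t < K, heads ω (τ * (n * K) + x t * K) K ≠ t} ≤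
      ENNReal.ofReal (Real.exp (-(r : ℝ))) := by
  obtain ⟨pos, hpos⟩ : ∃ pos : ℕ → ℕ, ∀ t < K, pos (x t) = t := by
    refine ⟨fun v => if h : ∃ t < K, x t = v then h.choose else 0, fun t ht => ?_⟩
    have h : ∃ t' < K, x t' = x t := ⟨t, ht, rfl⟩
    simp only [dif_pos h]
    exact hinj _ h.choose_spec.1 _ ht h.choose_spec.2
  -- The prescribed pattern: for the vertex `x t` the first `t` of its `K` flips are heads and the
  -- others tails. The vertex and the flip are read off the number of the coin.
  set f : ℕ → Bool := fun c => decide (c % K < pos (c / K % n)) with hf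
  have hfc : ∀ τ t b, t < K → b < K → f ((τ * n + x t) * K + b) = decide (b < t) := by
    intro τ t b ht hb
    have e1 : ((τ * n + x t) * K + b) % K = b := by
      rw [mul_comm, Nat.mul_add_mod, Nat.mod_eq_of_lt hb]
    have e2 : ((τ * n + x t) * K + b) / K = τ * n + x t := by
      rw [mul_comm, Nat.mul_add_div (by omega), Nat.div_eq_of_lt hb, add_zero]
    have e3 : (τ * n + x t) % n = x t := by
      rw [mul_comm, Nat.mul_add_mod, Nat.mod_eq_of_lt (hx t ht)]
    rw [hf]
    simp only [e1, e2, e3, hpos t ht]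
  have hcard : ∀ τ, (colorCoins n K x τ).card = K * K := by
    intro τ
    rw [colorCoins, Finset.card_image_of_injOn, Finset.card_product, Finset.card_range]
    rintro ⟨t, b⟩ h ⟨t', b'⟩ h' he
    simp only [Finset.coe_product, Finset.coe_range, Set.mem_prod, Set.mem_Iio] at h h'
    obtain ⟨-, rfl, rfl⟩ := colorCoins_inj hx hinj h.1 h'.1 h.2 h'.2 he
    rfl
  have hdisj : Pairwise fun τ τ' => Disjoint (colorCoins n K x τ) (colorCoins n K x τ') := by
    intro τ τ' hne
    rw [Finset.disjoint_left]
    intro c h h'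
    simp only [colorCoins, Finset.mem_image, Finset.mem_product, Finset.mem_range, Prod.exists] at h h'
    obtain ⟨t, b, h1, h2⟩ := h
    obtain ⟨t', b', h1', h2'⟩ := h'
    exact hne (colorCoins_inj hx hinj h1.1 h1'.1 h1.2 h1'.2 (h2.trans h2'.symm)).1
  -- Other patterns give the same colors, so this is only an inclusion. The single pattern has
  -- probability exactly `2 ^ (-K * K)`, and patterns of different trials use disjoint coins.
  have hsub : {ω | ∀ τ < r * 2 ^ (K * K), ∃ t < K, heads ω (τ * (n * K) + x t * K) K ≠ t} ⊆
      ⋂ τ ∈ Finset.range (r * 2 ^ (K * K)), (Set.pi (colorCoins n K x τ) fun c => {f c})ᶜ := by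
    intro ω hω
    simp only [Set.mem_iInter, Finset.mem_range, Set.mem_compl_iff]
    intro τ hτ hmem
    obtain ⟨t, ht, hne⟩ := hω τ hτ
    refine hne ?_
    have hω' : ∀ b ∈ Finset.range K, (if ω (τ * (n * K) + x t * K + b) then 1 else 0) =
        if b < t then 1 else 0 := by
      intro b hb
      rw [Finset.mem_range] at hb
      have h1 := hmem ((τ * n + x t) * K + b) (by
        simp only [colorCoins, Finset.coe_image, Set.mem_image, Finset.mem_coe, Finset.mem_product,
          Finset.mem_range, Prod.exists]
        exact ⟨t, b, ⟨ht, hb⟩, rfl⟩)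
      rw [Set.mem_singleton_iff, hfc τ t b ht hb] at h1
      rw [show τ * (n * K) + x t * K + b = (τ * n + x t) * K + b by ring, h1]
      simp
    rw [heads, Finset.sum_congr rfl hω', Finset.sum_boole,
      show (Finset.range K).filter (fun b => b < t) = Finset.range t by
        ext b; simp only [Finset.mem_filter, Finset.mem_range]; omega]
    simp
  refine (measure_mono hsub).trans ?_
  rw [coinMeasure_iInter_compl_pi f hcard hdisj]
  have h2 : (1 - (2⁻¹ : ENNReal) ^ (K * K)) = ENNReal.ofReal (1 - 1 / ((2 ^ (K * K) : ℕ) : ℝ)) := by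
    rw [ENNReal.ofReal_sub _ (by positivity), ENNReal.ofReal_one, one_div,
      ENNReal.ofReal_inv_of_pos (by positivity), ENNReal.ofReal_natCast, ← ENNReal.inv_pow]
    push_cast
    rfl
  have h3 : (1 : ℝ) / ((2 ^ (K * K) : ℕ) : ℝ) ≤ 1 := by
    rw [div_le_one (by positivity)]
    exact_mod_cast Nat.one_le_two_pow
  rw [h2, ← ENNReal.ofReal_pow (by linarith)]
  exact ENNReal.ofReal_le_ofReal (one_sub_inv_pow_le_exp _ r (by positivity))

end WordRAM


namespace MaxCycle
open SimpleGraph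

/-! ### Cycles as sequences of vertices -/

section
variable {V : Type*} {G : SimpleGraph V}

theorem exists_walk_of_adj (x : ℕ → V) (m : ℕ) (h : ∀ t < m, G.Adj (x t) (x (t + 1))) :
    ∃ p : G.Walk (x 0) (x m), p.length = m ∧ ∀ i ≤ m, p.getVert i = x i := by
  induction m generalizing x with
  | zero => exact ⟨.nil, rfl, fun i hi => by obtain rfl : i = 0 := by omega
                                             rfl⟩
  | succ m ih =>
    obtain ⟨q, h1, h2⟩ := ih (fun t => x (t + 1)) fun t ht => h (t + 1) (by omega)
    refine ⟨.cons (h 0 (by omega)) q, by rw [Walk.length_cons, h1], fun i hi => ?_⟩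
    cases i with
    | zero => rfl
    | succ i => rw [Walk.getVert_cons_succ]; exact h2 i (by omega)

/-- The cycle is the edge from `x 0` to `x 1` followed by the path `x 1, …, x m, x 0`. -/
theorem exists_cycle_of_adj (x : ℕ → V) {m : ℕ} (hm : 2 ≤ m) (h : ∀ t ≤ m, G.Adj (x t) (x (t + 1)))
    (hx : x (m + 1) = x 0) (hinj : ∀ t ≤ m, ∀ t' ≤ m, x t = x t' → t = t') :
    ∃ p : G.Walk (x 0) (x 0), p.IsCycle ∧ p.length = m + 1 ∧ ∀ i ≤ m + 1, p.getVert i = x i := by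
  obtain ⟨q, h1, h2⟩ := exists_walk_of_adj (fun t => x (t + 1)) m fun t ht => h (t + 1) (by omega)
  have hinj' : ∀ t ≤ m, ∀ t' ≤ m, x (t + 1) = x (t' + 1) → t = t' := by
    intro t ht t' ht' he
    rcases ht.lt_or_eq with ht | rfl <;> rcases ht'.lt_or_eq with ht' | rfl
    · have := hinj _ (by omega) _ (by omega) he; omega
    · rw [hx] at he
      have := hinj _ (by omega) _ (by omega) he; omega
    · rw [hx] at he
      have := hinj _ (by omega) _ (by omega) he; omega
    · rfl
  have hq : q.IsPath := by
    rw [← Walk.IsPath.getVert_injOn_iff]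
    intro t ht t' ht' he
    simp only [Set.mem_ofPred_eq, h1] at ht ht'
    rw [h2 t ht, h2 t' ht'] at he
    exact hinj' t ht t' ht' he
  refine ⟨(Walk.cons (h 0 (by omega)) q).copy rfl hx, ?_, ?_, ?_⟩
  · have hcyc : ∀ (v : V) (hv : x (m + 1) = v) (ha : G.Adj v (x 1)),
        (Walk.cons ha (q.copy rfl hv)).IsCycle := by
      rintro _ rfl ha
      rw [Walk.copy_rfl_rfl, Walk.cons_isCycle_iff]
      refine ⟨hq, fun hmem => ?_⟩
      -- If the first edge occurred again on the path, it would have to be its last edge, which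
      -- forces `x 1 = x m`. This contradicts `2 ≤ m`.
      have h3 := hq.eq_penultimate_of_mem_edges hmem
      rw [Walk.penultimate, h1, h2 _ (by omega)] at h3
      have := hinj' 0 (by omega) (m - 1) (by omega) h3
      omega
    have := hcyc (x 0) hx (h 0 (by omega))
    convert this using 1
    exact Walk.copy_cons ..
  · rw [Walk.length_copy, Walk.length_cons, h1]
  · intro i hi
    rw [Walk.getVert_copy]
    cases i with
    | zero => rfl
    | succ i => rw [Walk.getVert_cons_succ]; exact h2 i (by omega)

theorem walkWeight_eq (wt : G.edgeSet → ℝ) {u v : V} (p : G.Walk u v) :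
    walkWeight G wt p =
      ∑ t ∈ Finset.range p.length, edgeWeight G wt s(p.getVert t, p.getVert (t + 1)) := by
  induction p with
  | nil => simp [walkWeight]
  | cons h q ih =>
    rw [walkWeight] at ih ⊢
    rw [Walk.edges_cons, List.map_cons, List.sum_cons, ih, Walk.length_cons, Finset.sum_range_succ',
      add_comm]
    simp

/-- The weight of a walk depends only on its sequence of vertices, so walks of length `k` have
finitely many weights. -/
theorem exists_isMaxCycle [Finite V] (k : ℕ) (wt : G.edgeSet → ℝ) {v : V} (p : G.Walk v v)
    (hp : p.IsCycle) (hk : p.length = k) : ∃ (u : V) (q : G.Walk u u), IsMaxCycle k G wt q := by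
  set S : Set ℝ := {a | ∃ (u : V) (q : G.Walk u u), q.IsCycle ∧ q.length = k ∧ walkWeight G wt q = a}
  have hfin : S.Finite := by
    refine (Set.finite_range fun f : Fin (k + 1) → V => ∑ t : Fin k,
      edgeWeight G wt s(f t.castSucc, f t.succ)).subset ?_
    rintro _ ⟨u, q, -, hq, rfl⟩
    refine ⟨fun t => q.getVert t, ?_⟩
    rw [walkWeight_eq, hq, Finset.sum_range]
    rfl
  obtain ⟨a, ⟨u, q, h1, h2, h3⟩, hmax⟩ := Set.exists_max_image S id hfin ⟨_, v, p, hp, hk, rfl⟩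
  exact ⟨u, q, h1, h2, fun u' q' h1' h2' => by
    rw [h3]; exact hmax _ ⟨u', q', h1', h2', rfl⟩⟩

end

/-! ### The input -/

section
variable {n r : ℕ} {G : SimpleGraph (Fin n)} {wt : G.edgeSet → ℝ}

theorem symm_finProdFinEquiv_mk (a b : Fin n) (h : n * (a : ℕ) + b < n * n) :
    finProdFinEquiv.symm (⟨n * a + b, h⟩ : Fin (n * n)) = (a, b) := by
  rw [Equiv.symm_apply_eq]
  ext
  simp [finProdFinEquiv, add_comm]

theorem inputState_adj (a b : Fin n) :
    (inputState n r G wt).arr 0 (n * a + b) = 1 ↔ G.Adj a b := by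
  have h := WordRAM.cell_lt a.2 b.2
  simp only [inputState, h, and_self, dif_pos, symm_finProdFinEquiv_mk]
  split <;> rename_i h' <;> simp only [symm_finProdFinEquiv_mk] at h' <;> simp [h']

theorem inputState_wt (a b : Fin n) :
    (inputState n r G wt).real 0 (n * a + b) = edgeWeight G wt s(a, b) := by
  have h := WordRAM.cell_lt a.2 b.2
  simp only [inputState, h, and_self, dif_pos, symm_finProdFinEquiv_mk]

end

end MaxCycle

/-! ### Values and codes of closed layered paths. -/

namespace WordRAM
open MaxCycle

section
variable {n m : ℕ} {adj : ℕ → ℕ} {wt : ℕ → ℝ} {col x : ℕ → ℕ}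

theorem ofLex_chainVal :
    (∀ t < m, adj (n * x t + x (t + 1)) = 1 ∧ col (x t) = t ∧ col (x (t + 1)) = t + 1) →
    chainVal n adj wt col m x = toLex ((m : ℤ), ∑ t ∈ Finset.range m, wt (n * x t + x (t + 1))) := by
  intro h
  induction m with
  | zero => simp [chainVal]; rfl
  | succ m ih =>
    have h1 : chainVal n adj wt col (m + 1) x =
        chainVal n adj wt col m x + edgeVal n adj wt col m (x m) (x (m + 1)) :=
      Finset.sum_range_succ _ _
    rw [h1, ih fun t ht => h t (by omega), edgeVal, if_pos (h m (by omega)), ← toLex_add,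
      Prod.mk_add_mk, Finset.sum_range_succ]
    push_cast
    rfl

theorem of_fst_chainVal (h : (ofLex (chainVal n adj wt col m x)).1 = m) :
    ∀ t < m, adj (n * x t + x (t + 1)) = 1 ∧ col (x t) = t ∧ col (x (t + 1)) = t + 1 := by
  induction m with
  | zero => intro t ht; omega
  | succ m ih =>
    have h1 : chainVal n adj wt col (m + 1) x =
        chainVal n adj wt col m x + edgeVal n adj wt col m (x m) (x (m + 1)) :=
      Finset.sum_range_succ _ _
    have h2 := fst_chainVal_le (n := n) (m := m) (adj := adj) (wt := wt) (col := col) (x := x)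
    rw [h1, ofLex_add, Prod.fst_add, edgeVal, ofLex_toLex] at h
    push_cast at h
    by_cases hc : adj (n * x m + x (m + 1)) = 1 ∧ col (x m) = m ∧ col (x (m + 1)) = m + 1
    · rw [if_pos hc] at h
      intro t ht
      rcases Nat.lt_succ_iff_lt_or_eq.1 ht with ht | rfl
      · exact ih (by omega) t ht
      · exact hc
    · rw [if_neg hc] at h
      omega

theorem fst_cycleVal_le : (ofLex (cycleVal n adj wt col m x)).1 ≤ m + 1 := by
  have h2 := fst_chainVal_le (n := n) (m := m) (adj := adj) (wt := wt) (col := col) (x := x)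
  rw [cycleVal, ofLex_add, Prod.fst_add, closeVal, ofLex_toLex]
  dsimp only
  split <;> omega

/-- Soundness of the flags: the full count `m + 1` leaves no edge that could have failed its test.
-/
theorem of_fst_cycleVal (hm : 0 < m) (h : (ofLex (cycleVal n adj wt col m x)).1 = m + 1) :
    (∀ t < m, adj (n * x t + x (t + 1)) = 1) ∧ adj (n * x m + x 0) = 1 ∧ ∀ t ≤ m, col (x t) = t := by
  have h2 := fst_chainVal_le (n := n) (m := m) (adj := adj) (wt := wt) (col := col) (x := x)
  rw [cycleVal, ofLex_add, Prod.fst_add, closeVal, ofLex_toLex] at h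
  dsimp only at h
  by_cases hc : adj (n * x m + x 0) = 1 ∧ col (x m) = m
  · rw [if_pos hc] at h
    have h3 := of_fst_chainVal (m := m) (show (ofLex (chainVal n adj wt col m x)).1 = m by omega)
    refine ⟨fun t ht => (h3 t ht).1, hc.1, fun t ht => ?_⟩
    rcases ht.lt_or_eq with ht | rfl
    · exact (h3 t ht).2.1
    · exact hc.2
  · rw [if_neg hc] at h
    omega

theorem cycleVal_eq (h1 : ∀ t < m, adj (n * x t + x (t + 1)) = 1) (h2 : adj (n * x m + x 0) = 1)
    (h3 : ∀ t ≤ m, col (x t) = t) :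
    cycleVal n adj wt col m x = toLex (((m + 1 : ℕ) : ℤ),
      ∑ t ∈ Finset.range m, wt (n * x t + x (t + 1)) + wt (n * x m + x 0)) := by
  rw [cycleVal, ofLex_chainVal fun t ht => ⟨h1 t ht, h3 t ht.le, h3 (t + 1) ht⟩, closeVal,
    if_pos ⟨h2, h3 m le_rfl⟩, ← toLex_add, Prod.mk_add_mk]
  push_cast
  rfl

theorem chainCode_digit {i : ℕ} (hx : ∀ t < m, x t < n) (hi : i < m) :
    chainCode n x m / n ^ i % n = x (m - 1 - i) := by
  induction m generalizing i with
  | zero => omega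
  | succ m ih =>
    have hm := hx m (by omega)
    rw [chainCode]
    cases i with
    | zero => rw [pow_zero, Nat.div_one, mul_comm, Nat.mul_add_mod, Nat.mod_eq_of_lt hm]; rfl
    | succ i =>
      rw [pow_succ', ← Nat.div_div_eq_div_mul, mul_comm (chainCode n x m), Nat.mul_add_div (by omega),
        Nat.div_eq_of_lt hm, add_zero, ih (fun t ht => hx t (by omega)) (by omega)]
      congr 1
      omega

end

end WordRAM


/-! ### From the best value to a correct output. -/

namespace MaxCycle
open WordRAM

variable {n r k M : ℕ} {G : SimpleGraph (Fin n)} {wt : G.edgeSet → ℝ} {ω : ℕ → Bool} {s : State}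

theorem bestFlag_le {adj : ℕ → ℕ} {wt : ℕ → ℝ} (h : IsAttained n adj wt (k + 2) s) :
    s.var vBestFlag ≤ k + 3 := by
  rcases h with h | ⟨col, x, -, h, -⟩
  · omega
  · have h1 := fst_cycleVal_le (n := n) (m := k + 2) (adj := adj) (wt := wt) (col := col) (x := x)
    rw [← h, bestVal, ofLex_toLex] at h1
    push_cast at h1
    omega

/-- A full flag makes the recorded path closed and layered, and the distinct colors make its
vertices distinct. This holds for all outcomes of the coins. -/
theorem exists_cycle_of_bestFlag (hflag : s.var vBestFlag = k + 3)
    (h : IsAttained n ((inputState n r G wt).arr aAdj) ((inputState n r G wt).real rWt) (k + 2) s) :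
    ∃ (v : Fin n) (p : G.Walk v v), p.IsCycle ∧ p.length = k + 3 ∧
      walkWeight G wt p = s.real rBest 0 ∧
      ∀ i < k + 3, s.var vBestCode / n ^ i % n = (p.getVert i : ℕ) := by
  obtain ⟨m, hm⟩ : ∃ m, k + 2 = m := ⟨_, rfl⟩
  rcases h with h | ⟨col, x, hx, hval, hcode⟩
  · omega
  rw [hm] at hx hval hcode
  have hfst := congrArg (fun z => (ofLex z).1) hval
  rw [bestVal, ofLex_toLex] at hfst
  obtain ⟨h1, h2, h3⟩ := of_fst_cycleVal (by omega) (hfst.symm.trans (by rw [hflag]; push_cast; omega))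
  -- The digits of the code come out in reverse order. The additional value at `m + 1` repeats `y 0`
  -- and closes the walk.
  set y : ℕ → Fin n := fun t =>
    if t ≤ m then ⟨x (m - t), hx _ (by omega)⟩ else ⟨x m, hx m le_rfl⟩ with hy
  have hy1 : ∀ t ≤ m, (y t : ℕ) = x (m - t) := fun t ht => by rw [hy]; simp [ht]
  have hy2 : (y (m + 1) : ℕ) = x m := by rw [hy]; simp
  have hlast : y (m + 1) = y 0 := Fin.ext (by rw [hy2, hy1 0 (by omega), Nat.sub_zero])
  have hadj : ∀ t ≤ m, G.Adj (y t) (y (t + 1)) := by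
    intro t ht
    refine SimpleGraph.Adj.symm ((inputState_adj (r := r) (wt := wt) _ _).1 ?_)
    rcases ht.lt_or_eq with ht | rfl
    · rw [hy1 t ht.le, hy1 (t + 1) ht]
      have := h1 (m - (t + 1)) (by omega)
      rwa [show m - (t + 1) + 1 = m - t by omega] at this
    · rw [hy1 t le_rfl, hy2, Nat.sub_self]
      exact h2
  obtain ⟨p, p1, p2, p3⟩ := exists_cycle_of_adj y (m := m) (by omega) hadj hlast fun t ht t' ht' he => by
    have he' := congrArg (fun v : Fin n => col v) he
    simp only [hy1 t ht, hy1 t' ht', h3 (m - t) (by omega), h3 (m - t') (by omega)] at he'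
    omega
  refine ⟨y 0, p, p1, by omega, ?_, fun i hi => ?_⟩
  · have hsnd := congrArg (fun z => (ofLex z).2) hval
    rw [cycleVal_eq h1 h2 h3, bestVal, ofLex_toLex, ofLex_toLex] at hsnd
    dsimp only at hsnd
    rw [hsnd, walkWeight_eq, p2, Finset.sum_range_succ, ← Finset.sum_range_reflect]
    congr 1
    · refine Finset.sum_congr rfl fun t ht => ?_
      rw [Finset.mem_range] at ht
      rw [p3 _ (by omega), p3 _ (by omega), Sym2.eq_swap, ← inputState_wt (r := r), hy1 _ (by omega),
        hy1 _ (by omega)]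
      congr 3 <;> congr 1 <;> omega
    · rw [p3 _ (by omega), p3 _ le_rfl, Sym2.eq_swap, ← inputState_wt (r := r), hy1 m le_rfl, hy2,
        Nat.sub_self]
  · rw [hcode, chainCode_digit (fun t ht => hx t (by omega)) (by omega), p3 i (by omega),
      hy1 i (by omega)]
    congr 1

/-- A well-colored cycle has the full first component `k + 3`, which no value exceeds. The best
value then has the same flag, and what remains of the lexicographic comparison is that of the
weights. -/
theorem le_best_of_colored (h : HoldsBest n k ((inputState n r G wt).arr aAdj)
      ((inputState n r G wt).real rWt) ω M s) {v : Fin n} (p : G.Walk v v) (hlen : p.length = k + 3)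
    {τ : ℕ} (hτ : τ < M)
    (hcol : ∀ t < k + 3, heads ω (τ * (n * (k + 3)) + (p.getVert t : ℕ) * (k + 3)) (k + 3) = t) :
    s.var vBestFlag = k + 3 ∧ walkWeight G wt p ≤ s.real rBest 0 := by
  have h1 := h.tried τ hτ (fun v => heads ω (τ * (n * (k + 3)) + v * (k + 3)) (k + 3))
    (fun t => p.getVert t) (fun _ _ => rfl) fun t _ => (p.getVert t).2
  have hclose : p.getVert (k + 2 + 1) = p.getVert 0 := by
    rw [p.getVert_zero, p.getVert_of_length_le (by omega)]
  have hadj : ∀ t < k + 3, G.Adj (p.getVert t) (p.getVert (t + 1)) := fun t ht =>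
    p.adj_getVert_succ (by omega)
  have hlast := hadj (k + 2) (by omega)
  rw [hclose] at hlast
  rw [cycleVal_eq (fun t ht => (inputState_adj _ _).2 (hadj t (by omega)))
    ((inputState_adj _ _).2 hlast) (fun t ht => hcol t (by omega)), bestVal,
    Prod.Lex.toLex_le_toLex] at h1
  have h2 := bestFlag_le h.attained
  have hw : walkWeight G wt p = ∑ t ∈ Finset.range (k + 2), (inputState n r G wt).real rWt
      (n * (p.getVert t : ℕ) + (p.getVert (t + 1) : ℕ)) +
      (inputState n r G wt).real rWt (n * (p.getVert (k + 2) : ℕ) + (p.getVert 0 : ℕ)) := by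
    rw [walkWeight_eq, hlen, Finset.sum_range_succ, hclose]
    simp only [inputState_wt]
  rw [hw]
  dsimp only at h1
  rcases h1 with h1 | ⟨h1, h1'⟩
  · omega
  · exact ⟨by omega, h1'⟩

theorem correctOutput_of_best {s' : State} (h : HoldsBest n k ((inputState n r G wt).arr aAdj)
      ((inputState n r G wt).real rWt) ω M s)
    (h1 : s.var vBestFlag = k + 3 → s'.var vOut = 1 ∧
      ∀ i < k + 3, s'.arr aOut i = s.var vBestCode / n ^ i % n)
    (h2 : s.var vBestFlag ≠ k + 3 → s'.var vOut = 0)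
    (hgood : ∀ (v : Fin n) (p : G.Walk v v), p.IsCycle → p.length = k + 3 →
      ∃ (u : Fin n) (q : G.Walk u u), IsMaxCycle (k + 3) G wt q ∧ ∃ τ < M, ∀ t < k + 3,
        heads ω (τ * (n * (k + 3)) + (q.getVert t : ℕ) * (k + 3)) (k + 3) = t) :
    CorrectOutput (k + 3) G wt s' := by
  by_cases hflag : s.var vBestFlag = k + 3
  · obtain ⟨v, p, p1, p2, p3, p4⟩ := exists_cycle_of_bestFlag hflag h.attained
    obtain ⟨u, q, hq, τ, hτ, hcol⟩ := hgood v p p1 p2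
    obtain ⟨-, hle⟩ := le_best_of_colored h q hq.2.1 hτ hcol
    refine Or.inl ⟨(h1 hflag).1, v, p, ⟨p1, p2, fun u' q' hq1 hq2 => ?_⟩, fun i hi => ?_⟩
    · rw [p3]
      exact (hq.2.2 u' q' hq1 hq2).trans hle
    · rw [← p4 i hi]
      exact (h1 hflag).2 i hi
  · refine Or.inr ⟨h2 hflag, fun v p hp hlen => ?_⟩
    obtain ⟨u, q, hq, τ, hτ, hcol⟩ := hgood v p hp hlen
    exact hflag (le_best_of_colored h q hq.2.1 hτ hcol).1

end MaxCycle


namespace WordRAM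

/-! ### Time and word length -/

theorem clog_double_le (n : ℕ) : Nat.clog 2 (n + n) ≤ Nat.log 2 n + 2 := by
  refine Nat.clog_le_of_le_pow ?_
  have := Nat.lt_pow_succ_log_self (b := 2) (by norm_num) n
  rw [Nat.succ_eq_add_one] at this
  calc n + n ≤ 2 ^ (Nat.log 2 n + 1) * 2 := by omega
    _ = 2 ^ (Nat.log 2 n + 2) := by ring

theorem log_bounds (n : ℕ) (hn : n ≠ 0) :
    16 * Nat.log 65536 n ≤ Nat.log 2 n ∧ Nat.log 2 n ≤ 16 * Nat.log 65536 n + 15 := by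
  have h1 := Nat.pow_log_le_self 65536 hn
  have h2 := Nat.lt_pow_succ_log_self (b := 65536) (by norm_num) n
  have h3 := Nat.pow_log_le_self 2 hn
  rw [show 65536 = 2 ^ 16 by norm_num, ← pow_mul] at h1 h2
  norm_num only at h1 h2
  constructor
  · exact Nat.le_log_of_pow_le (by norm_num) h1
  · have := (Nat.pow_lt_pow_iff_right (a := 2) (by norm_num)).1 (h3.trans_lt h2)
    omega

/-- Without the factors in `d`, the cost is about `3 ^ (log₂ n)`, a power of `n` with exponent below
`2`. The gap to `n * n` has to absorb `3 ^ d` and three factors of order `log n`; a block length of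
about `log₂ n / 16` is short enough. -/
theorem comparison_cost_le (n : ℕ) (hn : n ≠ 0) (d H : ℕ) (hd : d = Nat.log 65536 n + 1)
    (hH : H = Nat.clog 2 (n + n)) :
    d * ((d + 1) * (3 ^ d * 3 ^ H * (H * 700 + 1100))) ≤ 702000 * (n * n) := by
  obtain ⟨h1, h2⟩ := log_bounds n hn
  have h3 := clog_double_le n
  have h4 := Nat.pow_log_le_self 2 hn
  rw [← hH] at h3
  obtain ⟨q, hq⟩ : ∃ q, Nat.log 65536 n = q := ⟨_, rfl⟩
  obtain ⟨h, hh⟩ : ∃ h, Nat.log 2 n = h := ⟨_, rfl⟩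
  rw [hq] at h1 h2 hd
  rw [hh] at h1 h2 h3 h4
  have e1 : 3 ^ H ≤ 9 * 3 ^ h := by
    calc 3 ^ H ≤ 3 ^ (h + 2) := Nat.pow_le_pow_right (by norm_num) h3
      _ = 9 * 3 ^ h := by ring
  have e2 : (q + 1) ^ 3 ≤ 8 ^ q := by
    have : q + 1 ≤ 2 ^ q := Nat.lt_two_pow_self
    calc (q + 1) ^ 3 ≤ (2 ^ q) ^ 3 := Nat.pow_le_pow_left this 3
      _ = 8 ^ q := by rw [← pow_mul, mul_comm, pow_mul]; norm_num
  have e3 : 24 ^ q * 3 ^ h ≤ 4 ^ h := by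
    -- For each unit of `q` there are sixteen units of `h`, and `24 * 3 ^ 16 ≤ 4 ^ 16`. The factor
    -- `24` is `8` for the polynomial factors times `3` for `3 ^ d`.
    obtain ⟨e, rfl⟩ := Nat.exists_eq_add_of_le h1
    calc 24 ^ q * 3 ^ (16 * q + e) = (24 * 3 ^ 16) ^ q * 3 ^ e := by
          rw [pow_add, pow_mul, mul_pow]; ring
      _ ≤ (4 ^ 16) ^ q * 4 ^ e := Nat.mul_le_mul (Nat.pow_le_pow_left (by norm_num) _)
          (Nat.pow_le_pow_left (by norm_num) _)
      _ = 4 ^ (16 * q + e) := by rw [pow_add, pow_mul]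
  have e4 : 4 ^ h ≤ n * n := by
    calc 4 ^ h = 2 ^ h * 2 ^ h := by rw [← mul_pow]; norm_num
      _ ≤ n * n := Nat.mul_le_mul h4 h4
  subst hd
  calc (q + 1) * ((q + 1 + 1) * (3 ^ (q + 1) * 3 ^ H * (H * 700 + 1100)))
      ≤ (q + 1) * ((2 * (q + 1)) * (3 ^ (q + 1) * (9 * 3 ^ h) * (13000 * (q + 1)))) := by
        gcongr <;> omega
    _ = 702000 * ((q + 1) ^ 3 * 3 ^ q * 3 ^ h) := by ring
    _ ≤ 702000 * (8 ^ q * 3 ^ q * 3 ^ h) := by gcongr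
    _ = 702000 * (24 ^ q * 3 ^ h) := by rw [← mul_pow]; norm_num
    _ ≤ 702000 * (n * n) := Nat.mul_le_mul_left _ (e3.trans e4)

theorem blockLength_le (n : ℕ) (hn : n ≠ 0) : Nat.log 65536 n + 1 ≤ n := Nat.log_lt_self _ hn

/-- The number of blocks times `d` is at most `2 * n`, and one block costs `O(n * n)`. -/
theorem multiplyTime_mul_le (n : ℕ) (hn : n ≠ 0) (d : ℕ) (hd : d = Nat.log 65536 n + 1) :
    multiplyTime n d * d ≤ 1500000 * n ^ 3 := by
  have h1 := comparison_cost_le n hn d _ hd rfl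
  have h2 : d ≤ n := hd ▸ blockLength_le n hn
  have h3 : n ≤ n * n := Nat.le_mul_self n
  have h4 : (n + d - 1) / d * d ≤ 2 * n := (Nat.div_mul_le_self _ _).trans (by omega)
  rw [multiplyTime, mul_add d]
  set B := d * ((d + 1) * (3 ^ d * 3 ^ Nat.clog 2 (n + n) * (Nat.clog 2 (n + n) * 700 + 1100)))
  have hB : B + d * 10 + n * n * 150 + 40 ≤ 702200 * (n * n) := by omega
  calc ((n + d - 1) / d * (B + d * 10 + n * n * 150 + 40) + n * n * 90 + 30) * d
      = (n + d - 1) / d * d * (B + d * 10 + n * n * 150 + 40) + (n * n * 90 + 30) * d := by ring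
    _ ≤ 2 * n * (702200 * (n * n)) + (120 * (n * n)) * n := by gcongr; omega
    _ = 1404520 * n ^ 3 := by ring
    _ ≤ 1500000 * n ^ 3 := by gcongr; norm_num

theorem searchTime_mul_le (n r k : ℕ) (hn : n ≠ 0) (hr : r ≠ 0) :
    searchTime n r k * (Nat.log 65536 n + 1) ≤
      (2 ^ ((k + 3) * (k + 3)) * (1501000 * (k + 1)) + 30 * k + 300) * (r * n ^ 3) := by
  obtain ⟨d, hd⟩ : ∃ d, d = Nat.log 65536 n + 1 := ⟨_, rfl⟩
  have h1 := multiplyTime_mul_le n hn d hd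
  have h2 : d ≤ n := hd ▸ blockLength_le n hn
  have hn1 : 1 ≤ n := by omega
  have h3 : n * n * d ≤ n ^ 3 := by
    calc n * n * d ≤ n * n * n := by gcongr
      _ = n ^ 3 := by ring
  have h4 : n * d ≤ n ^ 3 := by
    calc n * d ≤ n * n * d := by gcongr; exact Nat.le_mul_self n
      _ ≤ n ^ 3 := h3
  have h5 : d ≤ n ^ 3 := by
    calc d = 1 * d := (one_mul d).symm
      _ ≤ n * d := by gcongr
      _ ≤ n ^ 3 := h4
  rw [searchTime, ← hd]
  have ht : (trialTime n d k + 10) * d ≤ 1501000 * (k + 1) * n ^ 3 := by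
    rw [trialTime]
    calc _ = n * d * (k * 20 + 100) + k * (multiplyTime n d * d + n * n * d * 50 + 30 * d) +
          multiplyTime n d * d + n * n * d * 250 + 110 * d := by ring
      _ ≤ n ^ 3 * (k * 20 + 100) + k * (1500000 * n ^ 3 + n ^ 3 * 50 + 30 * n ^ 3) +
          1500000 * n ^ 3 + n ^ 3 * 250 + 110 * n ^ 3 := by gcongr
      _ = (1500100 * k + 1500460) * n ^ 3 := by ring
      _ ≤ 1501000 * (k + 1) * n ^ 3 := by gcongr; omega
  have hr1 : 1 ≤ r := by omega
  have e1 : n * d ≤ r * n ^ 3 := h4.trans (Nat.le_mul_of_pos_left _ hr1)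
  have e2 : d ≤ r * n ^ 3 := h5.trans (Nat.le_mul_of_pos_left _ hr1)
  have e3 : r * d ≤ r * n ^ 3 := Nat.mul_le_mul_left _ h5
  set T := 2 ^ ((k + 3) * (k + 3))
  calc _ = r * (T * ((trialTime n d k + 10) * d)) + 20 * (r * d) + 20 * (n * d) + (30 * k + 200) * d := by
        ring
    _ ≤ r * (T * (1501000 * (k + 1) * n ^ 3)) + 20 * (r * n ^ 3) + 20 * (r * n ^ 3) +
        (30 * k + 200) * (r * n ^ 3) := by gcongr
    _ = (T * (1501000 * (k + 1)) + 30 * k + 240) * (r * n ^ 3) := by ring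
    _ ≤ _ := by gcongr; omega

theorem log_le_blockLength (n : ℕ) (hn : n ≠ 0) :
    Real.log n ≤ 16 * ((Nat.log 65536 n + 1 : ℕ) : ℝ) := by
  have h1 : (n : ℝ) ≤ 2 ^ (16 * (Nat.log 65536 n + 1)) := by
    have := (Nat.lt_pow_succ_log_self (b := 65536) (by norm_num) n).le
    rw [Nat.succ_eq_add_one, show 65536 ^ (Nat.log 65536 n + 1) = 2 ^ (16 * (Nat.log 65536 n + 1)) by
      rw [pow_mul]; norm_num] at this
    exact_mod_cast this
  have h2 : (0 : ℝ) < n := by exact_mod_cast Nat.pos_of_ne_zero hn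
  calc Real.log n ≤ Real.log (2 ^ (16 * (Nat.log 65536 n + 1))) := Real.log_le_log h2 h1
    _ = ((16 * (Nat.log 65536 n + 1) : ℕ) : ℝ) * Real.log 2 := Real.log_pow _ _
    _ ≤ ((16 * (Nat.log 65536 n + 1) : ℕ) : ℝ) * 1 := by
        gcongr
        linarith [Real.log_two_lt_d9]
    _ = 16 * ((Nat.log 65536 n + 1 : ℕ) : ℝ) := by push_cast; ring

theorem searchTime_le (n r k : ℕ) (hn : 2 ≤ n) (hr : 1 ≤ r) :
    (searchTime n r k : ℝ) ≤
      ((16 * (2 ^ ((k + 3) * (k + 3)) * (1501000 * (k + 1)) + 30 * k + 300) : ℕ) : ℝ) * r *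
        ((n : ℝ) ^ 3 / Real.log n) := by
  have h1 := searchTime_mul_le n r k (by omega) (by omega)
  have h2 := log_le_blockLength n (by omega)
  have h3 : 0 < Real.log n := Real.log_pos (by exact_mod_cast hn)
  have h4 : (searchTime n r k : ℝ) * ((Nat.log 65536 n + 1 : ℕ) : ℝ) ≤
      ((2 ^ ((k + 3) * (k + 3)) * (1501000 * (k + 1)) + 30 * k + 300 : ℕ) : ℝ) * (r * (n : ℝ) ^ 3) := by
    exact_mod_cast h1
  rw [← mul_div_assoc, le_div_iff₀ h3]
  calc (searchTime n r k : ℝ) * Real.log n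
      ≤ (searchTime n r k : ℝ) * (16 * ((Nat.log 65536 n + 1 : ℕ) : ℝ)) := by gcongr
    _ = 16 * ((searchTime n r k : ℝ) * ((Nat.log 65536 n + 1 : ℕ) : ℝ)) := by ring
    _ ≤ 16 * (((2 ^ ((k + 3) * (k + 3)) * (1501000 * (k + 1)) + 30 * k + 300 : ℕ) : ℝ) *
        (r * (n : ℝ) ^ 3)) := by gcongr
    _ = _ := by push_cast; ring

/-- A crude polynomial bound for the memory of a product. The numerical factor is absorbed by `2 ^
16 ≤ n ^ 16`. -/
theorem product_bound (n : ℕ) (hn : 2 ≤ n) :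
    2 * ((Nat.log 65536 n + 1 + 2) * (3 ^ (Nat.log 65536 n + 1) * 3 ^ Nat.clog 2 (n + n))) +
      4 * (n + n) + 20 < n ^ 20 := by
  have h1 : 3 ^ (Nat.log 65536 n + 1) ≤ 3 * n := by
    rw [pow_succ']
    exact Nat.mul_le_mul_left _ ((Nat.pow_le_pow_left (by norm_num) _).trans
      (Nat.pow_log_le_self 65536 (by omega)))
  have h2 : 3 ^ Nat.clog 2 (n + n) ≤ 16 * n ^ 2 := by
    calc 3 ^ Nat.clog 2 (n + n) ≤ 4 ^ (Nat.log 2 n + 2) :=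
          (Nat.pow_le_pow_left (by norm_num) _).trans
            (Nat.pow_le_pow_right (by norm_num) (clog_double_le n))
      _ = 16 * (2 ^ Nat.log 2 n) ^ 2 := by rw [pow_add, ← pow_mul, mul_comm _ 2, pow_mul]; ring
      _ ≤ 16 * n ^ 2 := by
          gcongr
          exact Nat.pow_log_le_self 2 (by omega)
  have h3 := blockLength_le n (by omega)
  have h4 : 1 ≤ n ^ 3 := Nat.one_le_pow _ _ (by omega)
  have h5 : n ≤ n ^ 4 := Nat.le_self_pow (by norm_num) n
  have h6 : 2 ^ 16 ≤ n ^ 16 := Nat.pow_le_pow_left hn 16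
  have h7 : 1 ≤ n ^ 4 := Nat.one_le_pow _ _ (by omega)
  calc _ ≤ 2 * ((2 * n) * ((3 * n) * (16 * n ^ 2))) + 4 * (n + n) + 20 := by gcongr; omega
    _ = 192 * n ^ 4 + 8 * n + 20 := by ring
    _ < 2 ^ 16 * n ^ 4 := by omega
    _ ≤ n ^ 16 * n ^ 4 := by gcongr
    _ = n ^ 20 := by ring

theorem wordBound_of_pow_le {n k w : ℕ} (hn : 2 ≤ n) (h : n ^ ((k + 3) * (k + 3) + 40) ≤ 2 ^ w) :
    WordBound n (Nat.log 65536 n + 1) k w ∧ 2 ^ ((k + 3) * (k + 3)) < 2 ^ w ∧ 65536 * n < 2 ^ w := by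
  have hpow : ∀ e, e < (k + 3) * (k + 3) + 40 → n ^ e < 2 ^ w := fun e he =>
    (Nat.pow_lt_pow_right (by omega) he).trans_le h
  have h2 : ∀ e, e < (k + 3) * (k + 3) + 40 → 2 ^ e < 2 ^ w := fun e he =>
    (Nat.pow_le_pow_left hn e).trans_lt (hpow e he)
  have hk : 3 * k + 9 ≤ (k + 3) * (k + 3) := by nlinarith
  have h20 := hpow 20 (by omega)
  have h4 : 1 ≤ n ^ 4 := Nat.one_le_pow _ _ (by omega)
  have h3 : 65536 ≤ n ^ 16 := (Nat.pow_le_pow_left hn 16)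
  refine ⟨⟨(product_bound n hn).trans h20, ?_, hpow _ (by omega), ?_⟩, h2 _ (by omega), ?_⟩
  · have := hpow 3 (by omega)
    nlinarith
  · have h5 := h2 (2 * k + 20) (by omega)
    have h6 : 2 * k + 20 < 2 ^ (2 * k + 20) := Nat.lt_two_pow_self
    omega
  · calc 65536 * n ≤ n ^ 16 * n := by gcongr
      _ = n ^ 17 := by ring
      _ < 2 ^ w := hpow 17 (by omega)

end WordRAM


/-! ### The theorem. -/

namespace MaxCycle
open WordRAM

theorem correctOutput_of_le_two {n r k : ℕ} {G : SimpleGraph (Fin n)} {wt : G.edgeSet → ℝ}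
    (hk : k ≤ 2) : CorrectOutput k G wt (inputState n r G wt) :=
  Or.inr ⟨by simp [inputState], fun _ _ hp hlen => by have := hp.three_le_length; omega⟩

end MaxCycle

open WordRAM MaxCycle in
theorem theorem5 (k : ℕ) (hk : 1 ≤ k) :
    ∃ (P : Program) (c C : ℕ),
      ∀ (n r w : ℕ), 2 ≤ n → 1 ≤ r → n ^ c ≤ 2 ^ w → r < 2 ^ w →
      ∀ (G : SimpleGraph (Fin n)) (wt : G.edgeSet → ℝ),
        (∀ ω : ℕ → Bool, ∃ (s : State) (t : ℕ),
          Exec w ω P (inputState n r G wt) s t ∧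
            (t : ℝ) ≤ C * r * ((n : ℝ) ^ 3 / Real.log n)) ∧
        coinMeasure {ω : ℕ → Bool | ¬ ∃ (s : State) (t : ℕ),
          Exec w ω P (inputState n r G wt) s t ∧ CorrectOutput k G wt s}
          ≤ ENNReal.ofReal (Real.exp (-(r : ℝ))) := by
  by_cases hk3 : k < 3
  -- Doing nothing leaves variable `2` at `0`, the correct answer for `k < 3`. The single step is
  -- within the bound because `log n ≤ n ^ 3`.
  · refine ⟨.skip, 0, 1, fun n r w hn hr _ _ G wt => ⟨fun ω => ⟨_, 1, .skip _, ?_⟩, ?_⟩⟩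
    · have hn' : (2 : ℝ) ≤ n := by exact_mod_cast hn
      have hr' : (1 : ℝ) ≤ r := by exact_mod_cast hr
      have hlog : 0 < Real.log n := Real.log_pos (by linarith)
      have hle : Real.log n ≤ (n : ℝ) ^ 3 := by
        have h1 := Real.log_le_sub_one_of_pos (show (0 : ℝ) < n by linarith)
        have h2 : (n : ℝ) ≤ (n : ℝ) ^ 3 := le_self_pow₀ (by linarith) (by norm_num)
        linarith
      have h3 : 1 ≤ (n : ℝ) ^ 3 / Real.log n := by rwa [one_le_div hlog]
      push_cast
      nlinarith
    · have hempty : {ω : ℕ → Bool | ¬ ∃ (s : State) (t : ℕ),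
          Exec w ω .skip (inputState n r G wt) s t ∧ CorrectOutput k G wt s} = ∅ :=
        Set.eq_empty_of_forall_notMem fun ω h =>
          h ⟨_, 1, .skip _, correctOutput_of_le_two (by omega)⟩
      rw [hempty, MeasureTheory.measure_empty]
      exact zero_le
  · obtain ⟨k, rfl⟩ := Nat.exists_eq_add_of_le' (not_lt.1 hk3)
    refine ⟨cycleProgram k, (k + 3) * (k + 3) + 40,
      16 * (2 ^ ((k + 3) * (k + 3)) * (1501000 * (k + 1)) + 30 * k + 300),
      fun n r w hn hr hw hrw G wt => ?_⟩
    obtain ⟨hw1, hw2, hw3⟩ := wordBound_of_pow_le hn hw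
    have hrun := fun ω => cycleProgram_runs (w := w) (ω := ω) (s := inputState n r G wt) (n := n)
      (r := r) (k := k) (by simp [inputState]) (by simp [inputState]) (by simp [inputState])
      (by simp [inputState]) hrw (by omega) hw1 hw2 hw3
    refine ⟨fun ω => ?_, ?_⟩
    · obtain ⟨s, t, he, ht, -⟩ := hrun ω
      exact ⟨s, t, he, le_trans (by exact_mod_cast ht) (searchTime_le n r k hn hr)⟩
    · by_cases hcyc : ∃ (v : Fin n) (p : G.Walk v v), p.IsCycle ∧ p.length = k + 3
      · obtain ⟨v, p, hp, hlen⟩ := hcyc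
        obtain ⟨u, q, hq⟩ := exists_isMaxCycle (k + 3) wt p hp hlen
        -- One maximum cycle `q` is fixed before the coins are flipped. The algorithm can fail only
        -- if no trial colors `q` in order.
        refine (MeasureTheory.measure_mono fun ω hω => ?_).trans
          (coinMeasure_forall_ne_le (n := n) (K := k + 3) (r := r)
            (x := fun t => (q.getVert t : ℕ)) (fun t _ => (q.getVert t).2) fun t ht t' ht' he => ?_)
        · by_contra hgood
          simp only [Set.mem_ofPred_eq, not_forall, not_exists, not_and, not_not] at hgood
          obtain ⟨τ, hτ, hcol⟩ := hgood
          obtain ⟨s, t, he, -, s₁, h1, h2, h3⟩ := hrun ω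
          exact hω ⟨s, t, he, correctOutput_of_best h1 h2 h3 fun _ _ _ _ => ⟨u, q, hq, τ, hτ, hcol⟩⟩
        · have := hq.2.1
          exact hq.1.getVert_injOn' (by rw [Set.mem_ofPred_eq]; omega)
            (by rw [Set.mem_ofPred_eq]; omega) (Fin.ext he)
      -- Without a cycle on `k + 3` vertices the flag is never full, so the output is correct for
      -- all coin sequences.
      · have hempty : {ω : ℕ → Bool | ¬ ∃ (s : State) (t : ℕ),
            Exec w ω (cycleProgram k) (inputState n r G wt) s t ∧
              CorrectOutput (k + 3) G wt s} = ∅ := by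
          refine Set.eq_empty_of_forall_notMem fun ω h => h ?_
          obtain ⟨s, t, he, -, s₁, h1, h2, h3⟩ := hrun ω
          exact ⟨s, t, he, correctOutput_of_best h1 h2 h3 fun v p hp hlen =>
            absurd ⟨v, p, hp, hlen⟩ hcyc⟩
        rw [hempty, MeasureTheory.measure_empty]
        exact zero_le
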